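/- Let $\Omega\subset\mathbb R^d$ be a smooth bounded domain (open, connected, nonempty), $\Gamma=\partial\Omega$, and let $\kappa>0$. Let $\mathcal P^\oplus(\bar\Omega)$ be the set of pairs $\rho=(\omega,\gamma)$ of finite nonnegative Borel measures, $\omega$ on $\bar\Omega$ and $\gamma$ on $\Gamma$, such that $\omega+\gamma$ is a probability measure on $\bar\Omega$ (with $\gamma$ extended by zero). For $\rho_0=(\omega_0,\gamma_0)$ and $\rho_1=(\omega_1,\gamma_1)$ in $\mathcal P^\oplus(\bar\Omega)$ let $\mathcal{CE}(\rho_0,\rho_1)$ be the set of tuples $\mu=(\omega,F;\gamma,G,f)$, where $\omega$ is a finite signed measure and $F$ an $\mathbb R^d$-valued measure on $[0,1]\times\bar\Omega$, and $\gamma,f$ are finite signed measures and $G$ a measure with values in the tangent spaces $T_x\Gamma$ on $[0,1]\times\Gamma$, such that $$\iint_{[0,1]\times\bar\Omega}\partial_t\varphi\,d\omega+\iint_{[0,1]\times\bar\Omega}\nabla\varphi\cdot dF-\iint_{[0,1]\times\Gamma}\varphi\,df=\int_{\bar\Omega}\varphi(1,\cdot)\,d\omega_1-\int_{\bar\Omega}\varphi(0,\cdot)\,d\omega_0,$$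 $$\iint_{[0,1]\times\Gamma}\partial_t\psi\,d\gamma+\iint_{[0,1]\times\Gamma}\nabla_\Gamma\psi\cdot dG+\iint_{[0,1]\times\Gamma}\psi\,df=\int_{\Gamma}\psi(1,\cdot)\,d\gamma_1-\int_{\Gamma}\psi(0,\cdot)\,d\gamma_0$$ for all $\varphi\in C^1([0,1]\times\bar\Omega)$ and $\psi\in C^1([0,1]\times\Gamma)$. The action of $\mu$ is $$\mathcal A(\mu)=\iint_{[0,1]\times\bar\Omega}\frac{|F|^2}{2\omega}+\iint_{[0,1]\times\Gamma}\frac{|G|^2+\kappa^2f^2}{2\gamma}\in[0,+\infty],$$ where the integrands are evaluated on the densities of the measures with respect to any dominating nonnegative measures (the choice does not matter, by $1$-homogeneity), each quotient being $0$ if its numerator and denominator both vanish, and $+\infty$ if its denominator is negative, or zero with nonzero numerator. Set $$\mathcal W_\kappa^2(\rho_0,\rho_1)=\inf_{\mu\in\mathcal{CE}(\rho_0,\rho_1)}\mathcal A(\mu),\qquad \mathcal W_\kappa=\sqrt{\mathcal W_\kappa^2}.$$ A $\mathcal W_\kappa$-geodesic from $\rho_0$ to $\rho_1$ is a minimizer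 $\mu\in\mathcal{CE}(\rho_0,\rho_1)$, that is, one with $\mathcal A(\mu)=\mathcal W_\kappa^2(\rho_0,\rho_1)$. **Proposition.** Let $\rho_0,\rho_1\in\mathcal P^\oplus(\bar\Omega)$ and let $\mu=(\omega,F;\gamma,G,f)$ be any $\mathcal W_\kappa$-geodesic from $\rho_0$ to $\rho_1$. Then $\mu$ has an interpolant, i.e. a curve $t\mapsto\rho_t=(\omega_t,\gamma_t)\in\mathcal P^\oplus(\bar\Omega)$, $t\in[0,1]$, such that $t\mapsto\omega_t$ and $t\mapsto\gamma_t$ are narrowly continuous and $\omega=\omega_t\,dt$, $\gamma=\gamma_t\,dt$; and every such interpolant satisfies $$\mathcal W_\kappa(\rho_s,\rho_t)=|t-s|\,\mathcal W_\kappa(\rho_0,\rho_1)\qquad\text{for all }s,t\in[0,1].$$ -/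

import Mathlib

open MeasureTheory Set Topology unitInterval
open scoped ENNReal

noncomputable section

namespace RingRoad

variable {d : ℕ}

/-- A smooth bounded domain of `ℝ^d`: a bounded, open, connected, nonempty set that is, near each
of its boundary points, the strict sublevel set `{r < 0}` of a smooth function `r` whose
differential does not vanish at that point. -/
structure IsSmoothBoundedDomain (Ω : Set (EuclideanSpace ℝ (Fin d))) : Prop where
  isOpen : IsOpen Ω
  isConnected : IsConnected Ω
  isBounded : Bornology.IsBounded Ω
  smooth_boundary : ∀ x ∈ frontier Ω, ∃ r : EuclideanSpace ℝ (Fin d) → ℝ,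
    ContDiff ℝ ((⊤ : ℕ∞) : WithTop ℕ∞) r ∧ fderiv ℝ r x ≠ 0 ∧ ∀ᶠ y in 𝓝 x, (y ∈ Ω ↔ r y < 0)

/-- The space-time cylinder `[0,1] × Ω̄`. -/
abbrev QInt (Ω : Set (EuclideanSpace ℝ (Fin d))) : Type := I × closure Ω

/-- The space-time cylinder `[0,1] × Γ`, with `Γ = ∂Ω`. -/
abbrev QBdry (Ω : Set (EuclideanSpace ℝ (Fin d))) : Type := I × frontier Ω

/-- The pairs `(ω, γ)` of finite nonnegative Borel measures, `ω` on `Ω̄` and `γ` on `Γ = ∂Ω`, such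
that `ω + γ` (with `γ` extended by zero to `Ω̄`) is a probability measure on `Ω̄`. -/
structure POplus (Ω : Set (EuclideanSpace ℝ (Fin d))) where
  ω : FiniteMeasure (closure Ω)
  γ : FiniteMeasure (frontier Ω)
  isProb : IsProbabilityMeasure ((ω : Measure (closure Ω)) +
    (γ : Measure (frontier Ω)).map (inclusion frontier_subset_closure))

/-- The density of an `ℝ^d`-valued measure (given by its `d` components) with respect to `ν`. -/
def vecDensity {X : Type*} [MeasurableSpace X] (F : Fin d → SignedMeasure X) (ν : Measure X)
    (p : X) : EuclideanSpace ℝ (Fin d) :=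
  WithLp.toLp 2 fun i => (F i).rnDeriv ν p

/-- Tuples `(ω, F ; γ, G, f)` of finite signed or vector-valued measures: `ω` and the `ℝ^d`-valued
`F` on `[0,1] × Ω̄`; `γ`, `f` and `G` on `[0,1] × Γ`, where `G` takes its values in the tangent
spaces `T_x Γ`, viewed as subspaces of `ℝ^d`. (For a smooth hypersurface `Γ` the tangent cone at
`x ∈ Γ` is the tangent space `T_x Γ`.) -/
structure MeasureTuple (Ω : Set (EuclideanSpace ℝ (Fin d))) where
  ω : SignedMeasure (QInt Ω)
  F : Fin d → SignedMeasure (QInt Ω)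
  γ : SignedMeasure (QBdry Ω)
  G : Fin d → SignedMeasure (QBdry Ω)
  f : SignedMeasure (QBdry Ω)
  tangent : ∀ᵐ p ∂(∑ i, (G i).totalVariation),
    vecDensity G (∑ i, (G i).totalVariation) p ∈
      tangentConeAt ℝ (frontier Ω) (p.2 : EuclideanSpace ℝ (Fin d))

/-- Time derivative of a function of `(t, x)`. -/
def dt (φ : ℝ × EuclideanSpace ℝ (Fin d) → ℝ) (p : ℝ × EuclideanSpace ℝ (Fin d)) : ℝ :=
  fderiv ℝ φ p (1, 0)

/-- Partial derivative in the `i`-th space direction of a function of `(t, x)`. -/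
def dx (i : Fin d) (φ : ℝ × EuclideanSpace ℝ (Fin d) → ℝ)
    (p : ℝ × EuclideanSpace ℝ (Fin d)) : ℝ :=
  fderiv ℝ φ p (0, EuclideanSpace.single i 1)

/-- A point of the cylinder `[0,1] × S` as a point of `ℝ × ℝ^d`. -/
def toAmbient {S : Set (EuclideanSpace ℝ (Fin d))} (p : I × S) :
    ℝ × EuclideanSpace ℝ (Fin d) :=
  ((p.1 : ℝ), (p.2 : EuclideanSpace ℝ (Fin d)))

/-- `μ ∈ CE(ρ₀, ρ₁)`: weak form of the two continuity equations
`∂ₜω + div F = 0` in `Ω`, `F · n = f` on `∂Ω`, and `∂ₜγ + div G = f` on `Γ`,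
with initial and terminal data `ρ₀`, `ρ₁`.
The test functions, of class `C¹` on the closed cylinder `[0,1] × Ω̄` (up to the boundary),
respectively on `[0,1] × Γ`, are the restrictions of `C¹` functions on `ℝ × ℝ^d`.
As `G` is tangent to `Γ`, pairing `G` with the full gradient of such an extension is the same as
pairing it with the tangential gradient on `Γ`. -/
structure IsCE {Ω : Set (EuclideanSpace ℝ (Fin d))} (ρ₀ ρ₁ : POplus Ω) (μ : MeasureTuple Ω) :
    Prop where
  interior : ∀ φ : ℝ × EuclideanSpace ℝ (Fin d) → ℝ, ContDiff ℝ 1 φ →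
    (∫ᵛ p, dt φ (toAmbient p) ∂<•μ.ω) + (∑ i, ∫ᵛ p, dx i φ (toAmbient p) ∂<•(μ.F i))
        - (∫ᵛ p, φ (toAmbient p) ∂<•μ.f)
      = (∫ x, φ (1, x) ∂(ρ₁.ω : Measure (closure Ω)))
        - ∫ x, φ (0, x) ∂(ρ₀.ω : Measure (closure Ω))
  boundary : ∀ ψ : ℝ × EuclideanSpace ℝ (Fin d) → ℝ, ContDiff ℝ 1 ψ →
    (∫ᵛ p, dt ψ (toAmbient p) ∂<•μ.γ) + (∑ i, ∫ᵛ p, dx i ψ (toAmbient p) ∂<•(μ.G i))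
        + (∫ᵛ p, ψ (toAmbient p) ∂<•μ.f)
      = (∫ x, ψ (1, x) ∂(ρ₁.γ : Measure (frontier Ω)))
        - ∫ x, ψ (0, x) ∂(ρ₀.γ : Measure (frontier Ω))

/-- The interior Lagrangian `|F|² / (2ω)`, in the generalized sense. -/
def lagInt (w : ℝ) (F : EuclideanSpace ℝ (Fin d)) : ℝ≥0∞ :=
  open Classical in
  if 0 < w then ENNReal.ofReal (‖F‖ ^ 2 / (2 * w))
  else if w = 0 ∧ F = 0 then 0 else ⊤

/-- The boundary Lagrangian `(|G|² + κ² f²) / (2γ)`, in the generalized sense. -/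
def lagBdry (κ : ℝ) (g : ℝ) (G : EuclideanSpace ℝ (Fin d)) (f : ℝ) : ℝ≥0∞ :=
  open Classical in
  if 0 < g then ENNReal.ofReal ((‖G‖ ^ 2 + κ ^ 2 * f ^ 2) / (2 * g))
  else if g = 0 ∧ G = 0 ∧ f = 0 then 0 else ⊤

/-- A nonnegative measure dominating `ω` and `F`. -/
def MeasureTuple.refInt {Ω : Set (EuclideanSpace ℝ (Fin d))} (μ : MeasureTuple Ω) :
    Measure (QInt Ω) :=
  μ.ω.totalVariation + ∑ i, (μ.F i).totalVariation

/-- A nonnegative measure dominating `γ`, `G` and `f`. -/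
def MeasureTuple.refBdry {Ω : Set (EuclideanSpace ℝ (Fin d))} (μ : MeasureTuple Ω) :
    Measure (QBdry Ω) :=
  μ.γ.totalVariation + ∑ i, (μ.G i).totalVariation + μ.f.totalVariation

/-- The action of a tuple of measures. The Lagrangians being `1`-homogeneous, it does not depend
on the choice of the dominating reference measures; here those are the sums of the total variations
of the components. -/
def action {Ω : Set (EuclideanSpace ℝ (Fin d))} (κ : ℝ) (μ : MeasureTuple Ω) : ℝ≥0∞ :=
  (∫⁻ p, lagInt (μ.ω.rnDeriv μ.refInt p) (vecDensity μ.F μ.refInt p) ∂μ.refInt) +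
  ∫⁻ p, lagBdry κ (μ.γ.rnDeriv μ.refBdry p) (vecDensity μ.G μ.refBdry p)
    (μ.f.rnDeriv μ.refBdry p) ∂μ.refBdry

/-- The squared distance `W_κ²(ρ₀, ρ₁)`: infimum of the action over `CE(ρ₀, ρ₁)`. -/
def WSq {Ω : Set (EuclideanSpace ℝ (Fin d))} (κ : ℝ) (ρ₀ ρ₁ : POplus Ω) : ℝ≥0∞ :=
  ⨅ (μ : MeasureTuple Ω) (_ : IsCE ρ₀ ρ₁ μ), action κ μ

/-- The distance `W_κ(ρ₀, ρ₁)`, the square root of `WSq`. -/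
def W {Ω : Set (EuclideanSpace ℝ (Fin d))} (κ : ℝ) (ρ₀ ρ₁ : POplus Ω) : ℝ≥0∞ :=
  (WSq κ ρ₀ ρ₁) ^ (1 / 2 : ℝ)

/-- `μ` is a `W_κ`-geodesic from `ρ₀` to `ρ₁`: a minimizer in the definition of `W_κ²(ρ₀, ρ₁)`. -/
structure IsGeodesic {Ω : Set (EuclideanSpace ℝ (Fin d))} (κ : ℝ) (ρ₀ ρ₁ : POplus Ω)
    (μ : MeasureTuple Ω) : Prop where
  isCE : IsCE ρ₀ ρ₁ μ
  action_eq : action κ μ = WSq κ ρ₀ ρ₁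

/-- `ρ_t = (ω_t, γ_t)`, `t ∈ [0,1]`, is the interpolant of `μ = (ω, F ; γ, G, f)`: the narrowly
continuous curve in `POplus Ω` with `ω = ω_t dt` and `γ = γ_t dt`. (The topology on
`FiniteMeasure` is that of narrow convergence; `volume` on `I` is the Lebesgue measure.) -/
structure IsInterpolant {Ω : Set (EuclideanSpace ℝ (Fin d))} (μ : MeasureTuple Ω)
    (ρ : I → POplus Ω) : Prop where
  continuous_ω : Continuous fun t => (ρ t).ω
  continuous_γ : Continuous fun t => (ρ t).γ
  disintegration_ω : ∀ B : Set (QInt Ω), MeasurableSet B →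
    μ.ω B = ∫ t : I, ((ρ t).ω : Measure (closure Ω)).real (Prod.mk t ⁻¹' B)
  disintegration_γ : ∀ B : Set (QBdry Ω), MeasurableSet B →
    μ.γ B = ∫ t : I, ((ρ t).γ : Measure (frontier Ω)).real (Prod.mk t ⁻¹' B)

end RingRoad

end

/-!
A minimizer has finite action because any two states are at finite distance (`WSq_lt_top`), and a
tuple of finite action is a flow: nonnegative measures `m`, `n` together with velocities `v`, `w`
and an exchange rate `h` (`Flow.exists_of_action_lt_top`). For flows the action is an ordinary
integral, and flows can be restricted to time intervals, reparametrized in time and concatenated.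

*Interpolant.* Testing the continuity equations with functions of time alone shows that the time
marginal of `m + n` is the Lebesgue measure (`Flow.Joins.marginal`). Testing them with
`N(t) φ(t, x)` then shows that the integrals of `φ` over the time slices of `m` and `n` agree, for
almost every time, with a function continuous in time, the `pairing`; by density of the `C¹`
functions and the theorem of M. Riesz the slices have narrowly continuous versions
(`exists_slices`). For any interpolant, the slices are given by the pairing at *every* time, so it
starts at `ρ₀`, ends at `ρ₁`, and the part of the flow in `(s, t]` connects `ρ_s` to `ρ_t`.

*Constant speed.* Running the part of the flow in `(s, t]` during the unit time multiplies its
action by `t - s`, whence `W(ρ_s, ρ_t)² ≤ (t - s) A(s, t)`, where `A(s, t)` is the action spent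
in `(s, t]` (`Flow.Joins.WSq_interpolant_le`). By the triangle inequality
(`Flow.sqrt_WSq_triangle`) the distances over the three intervals cut out by `s ≤ t` add up to at
least `W(ρ₀, ρ₁)`, while the three actions add up to at most `W(ρ₀, ρ₁)²`. The equality case of
the Cauchy–Schwarz inequality makes the distances proportional to the lengths of the intervals
(`eq_mul_of_sq_le_mul`).

*Finiteness of the distance.* Boundary mass decreasing as `(1 - t)²`, the loss being handed over to
the interior component, has finite action (`exchange`), so that only interior states matter. These
are transported along straight segments contained in `Ω̄` (`WSq_map_lt_top`). By compactness,
smoothness of the boundary and connectedness of `Ω`, finitely many such displacements bring all of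
`Ω̄` to a single point (`moves_id_const`).
-/

noncomputable section

namespace RingRoad

variable {d : ℕ}

/-! ### Signed measures with a density -/

section SignedDensity

variable {X : Type*} [MeasurableSpace X]

theorem integral_withDensityᵥ {m : Measure X} {h : X → ℝ} (hh : Integrable h m)
    {g : X → ℝ} (hg : Measurable g) {C : ℝ} (hC : ∀ x, |g x| ≤ C) :
    (∫ᵛ x, g x ∂<•(m.withDensityᵥ h)) = ∫ x, g x * h x ∂m := by
  have : IsFiniteMeasure (m.withDensity fun x => ENNReal.ofReal (h x)) :=
    isFiniteMeasure_withDensity_ofReal hh.2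
  have : IsFiniteMeasure (m.withDensity fun x => ENNReal.ofReal (-h x)) :=
    isFiniteMeasure_withDensity_ofReal hh.neg.2
  have hn : AEMeasurable (fun x => ENNReal.ofReal (-h x)) m :=
    hh.neg.1.aemeasurable.ennreal_ofReal
  have hgi : ∀ (μ : Measure X) [IsFiniteMeasure μ], Integrable g μ := fun μ _ =>
    Integrable.of_bound hg.aestronglyMeasurable C (ae_of_all _ hC)
  rw [withDensityᵥ_eq_withDensity_pos_part_sub_withDensity_neg_part hh,
    VectorMeasure.integral_sub_vectorMeasure, VectorMeasure.integral_toSignedMeasure,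
    VectorMeasure.integral_toSignedMeasure,
    integral_withDensity_eq_integral_toReal_smul₀ hh.1.aemeasurable.ennreal_ofReal
      (ae_of_all _ fun _ => ENNReal.ofReal_lt_top),
    integral_withDensity_eq_integral_toReal_smul₀ hn
      (ae_of_all _ fun _ => ENNReal.ofReal_lt_top), ← integral_sub]
  · refine integral_congr_ae (ae_of_all _ fun x => ?_)
    simp only [smul_eq_mul, ENNReal.toReal_ofReal', ← sub_mul]
    rw [mul_comm, max_zero_sub_eq_self]
  · exact (integrable_withDensity_iff_integrable_smul₀' hh.1.aemeasurable.ennreal_ofReal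
      (ae_of_all _ fun _ => ENNReal.ofReal_lt_top)).1 (hgi _)
  · exact (integrable_withDensity_iff_integrable_smul₀' hn
      (ae_of_all _ fun _ => ENNReal.ofReal_lt_top)).1 (hgi _)
  · rw [VectorMeasure.Integrable, Measure.variation_toSignedMeasure]; exact hgi _
  · rw [VectorMeasure.Integrable, Measure.variation_toSignedMeasure]; exact hgi _

theorem rnDeriv_withDensityᵥ {ν : Measure X} {h : X → ℝ} (hh : Integrable h ν) :
    SignedMeasure.rnDeriv (ν.withDensityᵥ h) ν =ᵐ[ν] h :=
  (SignedMeasure.eq_rnDeriv 0 h hh VectorMeasure.MutuallySingular.zero_left (by simp)).symm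

theorem withDensityᵥ_rnDeriv {ν : Measure X} [SigmaFinite ν] {s : SignedMeasure X}
    (hs : s.totalVariation ≪ ν) : ν.withDensityᵥ (s.rnDeriv ν) = s := by
  have h := SignedMeasure.singularPart_add_withDensity_rnDeriv_eq ν s
  rw [SignedMeasure.totalVariation_absolutelyContinuous_iff] at hs
  have h0 : s.singularPart ν = 0 := by
    simp only [SignedMeasure.singularPart, Measure.singularPart_eq_zero_of_ac hs.1,
      Measure.singularPart_eq_zero_of_ac hs.2, sub_self]
  rwa [h0, zero_add] at h

/-- Change of reference measure: `h m = (dm/dν * h) ν`. -/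
theorem withDensityᵥ_change {m ν : Measure X} [SigmaFinite ν] [SigmaFinite m]
    (hm : m ≪ ν) {h : X → ℝ} (hh : Integrable h m) :
    Integrable (fun x => (m.rnDeriv ν x).toReal * h x) ν ∧
    ν.withDensityᵥ (fun x => (m.rnDeriv ν x).toReal * h x) = m.withDensityᵥ h := by
  have hi : Integrable (fun x => (m.rnDeriv ν x).toReal * h x) ν :=
    (integrable_rnDeriv_smul_iff hm).2 hh
  refine ⟨hi, ?_⟩
  have := withDensityᵥ_smul_eq_withDensityᵥ_withDensity' (f := m.rnDeriv ν) (g := h)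
    (m.measurable_rnDeriv ν).aemeasurable (m.rnDeriv_lt_top ν) hi
  rwa [Measure.withDensity_rnDeriv_eq m ν hm] at this

theorem totalVariation_withDensityᵥ_ac {m : Measure X} {h : X → ℝ} (hh : Integrable h m) :
    SignedMeasure.totalVariation (m.withDensityᵥ h) ≪ m := by
  rw [SignedMeasure.totalVariation_eq_variation, Measure.variation_withDensityᵥ hh]
  exact withDensity_absolutelyContinuous _ _

theorem totalVariation_toSignedMeasure {m : Measure X} [IsFiniteMeasure m] :
    m.toSignedMeasure.totalVariation = m := by
  rw [SignedMeasure.totalVariation_eq_variation, Measure.variation_toSignedMeasure]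

theorem toSignedMeasure_eq_withDensityᵥ {m : Measure X} [IsFiniteMeasure m] :
    m.toSignedMeasure = m.withDensityᵥ fun _ => (1 : ℝ) := by
  ext s hs
  rw [Measure.toSignedMeasure_apply_measurable hs, withDensityᵥ_apply (integrable_const _) hs]
  simp

/-- With respect to a dominating measure `ν`, the density of `h m` is `dm/dν * h`. -/
theorem rnDeriv_withDensityᵥ_of_ac {m ν : Measure X} [SigmaFinite ν] [SigmaFinite m]
    (hm : m ≪ ν) {h : X → ℝ} (hh : Integrable h m) :
    SignedMeasure.rnDeriv (m.withDensityᵥ h) ν =ᵐ[ν] fun x => (m.rnDeriv ν x).toReal * h x := by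
  obtain ⟨hi, he⟩ := withDensityᵥ_change hm hh
  rw [← he]
  exact rnDeriv_withDensityᵥ hi

theorem rnDeriv_toSignedMeasure_of_ac {m ν : Measure X} [SigmaFinite ν] [IsFiniteMeasure m]
    (hm : m ≪ ν) :
    m.toSignedMeasure.rnDeriv ν =ᵐ[ν] fun x => (m.rnDeriv ν x).toReal := by
  rw [toSignedMeasure_eq_withDensityᵥ]
  simpa using rnDeriv_withDensityᵥ_of_ac hm (integrable_const (1 : ℝ))

/-- If the signed measure `s` has a nonnegative density `a` with respect to `ν`, then it is the
measure `a ν`. -/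
theorem toSignedMeasure_withDensity_rnDeriv {ν : Measure X} [SigmaFinite ν]
    {s : SignedMeasure X} (hs : s.totalVariation ≪ ν) (h0 : ∀ᵐ x ∂ν, 0 ≤ s.rnDeriv ν x)
    [IsFiniteMeasure (ν.withDensity fun x => ENNReal.ofReal (s.rnDeriv ν x))] :
    (ν.withDensity fun x => ENNReal.ofReal (s.rnDeriv ν x)).toSignedMeasure = s := by
  have hi := SignedMeasure.integrable_rnDeriv s ν
  conv_rhs => rw [← withDensityᵥ_rnDeriv hs]
  rw [← withDensityᵥ_toReal hi.1.aemeasurable.ennreal_ofReal hi.lintegral_lt_top.ne]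
  refine WithDensityᵥEq.congr_ae ?_
  filter_upwards [h0] with x hx
  rw [ENNReal.toReal_ofReal hx]

/-- Division of densities: if the density `b` of `s` with respect to `ν` vanishes where `a` does,
then `s` is the measure `a ν` with density `b / a`. -/
theorem withDensityᵥ_div {ν : Measure X} [SigmaFinite ν] {s : SignedMeasure X}
    (hs : s.totalVariation ≪ ν) {a : X → ℝ} (ha : Measurable a) (h0 : ∀ᵐ x ∂ν, 0 ≤ a x)
    (hz : ∀ᵐ x ∂ν, a x = 0 → s.rnDeriv ν x = 0) :
    Integrable (fun x => s.rnDeriv ν x / a x) (ν.withDensity fun x => ENNReal.ofReal (a x)) ∧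
    (ν.withDensity fun x => ENNReal.ofReal (a x)).withDensityᵥ (fun x => s.rnDeriv ν x / a x)
      = s := by
  have he : (fun x => (ENNReal.ofReal (a x)).toReal • (s.rnDeriv ν x / a x))
      =ᵐ[ν] s.rnDeriv ν := by
    filter_upwards [h0, hz] with x hx hzx
    rw [ENNReal.toReal_ofReal hx, smul_eq_mul]
    by_cases h : a x = 0
    · simp [h, hzx h]
    · field_simp
  have hi := (SignedMeasure.integrable_rnDeriv s ν).congr he.symm
  refine ⟨(integrable_withDensity_iff_integrable_smul₀' ha.ennreal_ofReal.aemeasurable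
      (ae_of_all _ fun _ => ENNReal.ofReal_lt_top)).2 hi, ?_⟩
  rw [← withDensityᵥ_smul_eq_withDensityᵥ_withDensity' ha.ennreal_ofReal.aemeasurable
      (ae_of_all _ fun _ => ENNReal.ofReal_lt_top) hi, WithDensityᵥEq.congr_ae he,
      withDensityᵥ_rnDeriv hs]

end SignedDensity

/-! ### Flows: tuples given by velocity fields -/

/-- The Euclidean space `ℝ^d`. -/
abbrev Vec (d : ℕ) : Type := EuclideanSpace ℝ (Fin d)

/-- The convective derivative `∂ₜφ + v · ∇φ` of `φ` at a space-time point. -/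
def adv (φ : ℝ × Vec d → ℝ) (v : Vec d) (q : ℝ × Vec d) : ℝ :=
  dt φ q + ∑ i, dx i φ q * v i

/-- Weak form, on the time interval `[a, b]`, of `∂ₜm + div (v m) = h n` with initial datum `α`
and terminal datum `β`; here `m` lives on `[0,1] × S` and the source `h n` on `[0,1] × B`. The
interval enters only through the data; it is up to `m` and `n` to be carried by it. -/
def ContEq {S B : Set (Vec d)} (a b : ℝ) (α β : Measure S) (m : Measure (I × S))
    (v : I × S → Vec d) (n : Measure (I × B)) (h : I × B → ℝ) : Prop :=
  ∀ φ : ℝ × Vec d → ℝ, ContDiff ℝ 1 φ →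
    (∫ p, adv φ (v p) (toAmbient p) ∂m) + (∫ p, φ (toAmbient p) * h p ∂n)
      = (∫ x, φ (b, x) ∂β) - ∫ x, φ (a, x) ∂α

/-- A tuple `(m, v m ; n, w n, h n)` with `m` and `n` finite nonnegative measures, described by
the interior and tangential velocities `v`, `w` and the exchange rate `h`. Every tuple of finite
action is of this form. -/
structure Flow (Ω : Set (Vec d)) where
  m : Measure (QInt Ω)
  v : QInt Ω → Vec d
  n : Measure (QBdry Ω)
  w : QBdry Ω → Vec d
  h : QBdry Ω → ℝ
  finite_m : IsFiniteMeasure m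
  finite_n : IsFiniteMeasure n
  measurable_v : Measurable v
  measurable_w : Measurable w
  measurable_h : Measurable h
  integrable_v : Integrable v m
  integrable_w : Integrable w n
  integrable_h : Integrable h n
  tangent : ∀ᵐ p ∂n, w p ∈ tangentConeAt ℝ (frontier Ω) (p.2 : Vec d)

namespace Flow

variable {Ω : Set (Vec d)}

instance (Φ : Flow Ω) : IsFiniteMeasure Φ.m := Φ.finite_m
instance (Φ : Flow Ω) : IsFiniteMeasure Φ.n := Φ.finite_n

/-- The action of a flow. -/
def act (κ : ℝ) (Φ : Flow Ω) : ℝ≥0∞ :=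
  (∫⁻ p, ENNReal.ofReal (‖Φ.v p‖ ^ 2 / 2) ∂Φ.m) +
    ∫⁻ p, ENNReal.ofReal ((‖Φ.w p‖ ^ 2 + κ ^ 2 * Φ.h p ^ 2) / 2) ∂Φ.n

/-- The flow solves both continuity equations on the time interval `[a, b]`, with initial datum
`ρ` and terminal datum `ρ'`. -/
def Joins (Φ : Flow Ω) (a b : ℝ) (ρ ρ' : POplus Ω) : Prop :=
  ContEq a b (ρ.ω : Measure (closure Ω)) ρ'.ω Φ.m Φ.v Φ.n (-Φ.h) ∧
  ContEq a b (ρ.γ : Measure (frontier Ω)) ρ'.γ Φ.n Φ.w Φ.n Φ.h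

end Flow

/-! ### Test functions -/

section Test

variable {S : Set (Vec d)} {φ : ℝ × Vec d → ℝ}

theorem continuous_toAmbient : Continuous (toAmbient : I × S → ℝ × Vec d) := by
  unfold toAmbient; fun_prop

theorem continuous_dt (hφ : ContDiff ℝ 1 φ) : Continuous (dt φ) :=
  (hφ.continuous_fderiv one_ne_zero).clm_apply continuous_const

theorem continuous_dx (hφ : ContDiff ℝ 1 φ) (i : Fin d) : Continuous (dx i φ) :=
  (hφ.continuous_fderiv one_ne_zero).clm_apply continuous_const

theorem measurable_adv (hφ : ContDiff ℝ 1 φ) {v : I × S → Vec d} (hv : Measurable v) :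
    Measurable fun p : I × S => adv φ (v p) (toAmbient p) := by
  unfold adv
  refine ((continuous_dt hφ).comp continuous_toAmbient).measurable.add
    (Finset.measurable_sum _ fun i _ => ?_)
  exact ((continuous_dx hφ i).comp continuous_toAmbient).measurable.mul (by fun_prop)

theorem exists_bound_of_compact (hS : IsCompact S) {g : ℝ × Vec d → ℝ} (hg : Continuous g) :
    ∃ C, ∀ p : I × S, |g (toAmbient p)| ≤ C := by
  have : CompactSpace S := isCompact_iff_compactSpace.1 hS
  obtain ⟨C, hC⟩ := isCompact_univ.exists_bound_of_continuousOn
    (hg.comp (continuous_toAmbient (S := S))).continuousOn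
  exact ⟨C, fun p => hC p trivial⟩

theorem integrable_test (hS : IsCompact S) {g : ℝ × Vec d → ℝ} (hg : Continuous g)
    {m : Measure (I × S)} [IsFiniteMeasure m] : Integrable (fun p => g (toAmbient p)) m := by
  obtain ⟨C, hC⟩ := exists_bound_of_compact hS hg
  exact Integrable.of_bound (hg.comp continuous_toAmbient).measurable.aestronglyMeasurable C
    (ae_of_all _ hC)

theorem integrable_test_mul (hS : IsCompact S) {g : ℝ × Vec d → ℝ} (hg : Continuous g)
    {m : Measure (I × S)} {h : I × S → ℝ} (hh : Integrable h m) :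
    Integrable (fun p => g (toAmbient p) * h p) m := by
  obtain ⟨C, hC⟩ := exists_bound_of_compact hS hg
  exact hh.bdd_mul (hg.comp continuous_toAmbient).measurable.aestronglyMeasurable
    (ae_of_all _ hC)

theorem integrable_coord {X : Type*} [MeasurableSpace X] {m : Measure X} {v : X → Vec d}
    (hv : Integrable v m) (i : Fin d) : Integrable (fun p => v p i) m :=
  (EuclideanSpace.proj (𝕜 := ℝ) i).integrable_comp hv

theorem integrable_adv (hS : IsCompact S) (hφ : ContDiff ℝ 1 φ) {m : Measure (I × S)}
    [IsFiniteMeasure m] {v : I × S → Vec d} (hv : Integrable v m) :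
    Integrable (fun p => adv φ (v p) (toAmbient p)) m :=
  (integrable_test hS (continuous_dt hφ)).add (integrable_finsetSum _ fun i _ =>
    integrable_test_mul hS (continuous_dx hφ i) (integrable_coord hv i))

theorem integral_adv (hS : IsCompact S) (hφ : ContDiff ℝ 1 φ) {m : Measure (I × S)}
    [IsFiniteMeasure m] {v : I × S → Vec d} (hv : Integrable v m) :
    ∫ p, adv φ (v p) (toAmbient p) ∂m
      = (∫ p, dt φ (toAmbient p) ∂m) + ∑ i, ∫ p, dx i φ (toAmbient p) * v p i ∂m := by
  unfold adv
  rw [integral_add (integrable_test hS (continuous_dt hφ)) (integrable_finsetSum _ fun i _ =>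
    integrable_test_mul hS (continuous_dx hφ i) (integrable_coord hv i)),
    integral_finsetSum _ fun i _ =>
    integrable_test_mul hS (continuous_dx hφ i) (integrable_coord hv i)]

end Test

/-! ### The tangent cone -/

theorem smul_mem_tangentConeAt {S : Set (Vec d)} {x u : Vec d} (hu : u ∈ tangentConeAt ℝ S x)
    (c : ℝ) : c • u ∈ tangentConeAt ℝ S x := by
  rw [mem_tangentConeAt_iff_exists_seq] at hu ⊢
  obtain ⟨a, b, h0, hS, hl⟩ := hu
  refine ⟨fun k => c * a k, b, h0, hS, ?_⟩
  simpa only [mul_smul] using hl.const_smul c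

/-! ### Flows and tuples of measures -/

theorem lagInt_smul (a : ℝ) (ha : 0 ≤ a) (u : Vec d) :
    lagInt a (a • u) = ENNReal.ofReal a * ENNReal.ofReal (‖u‖ ^ 2 / 2) := by
  unfold lagInt
  rcases ha.eq_or_lt with rfl | h
  · simp
  · rw [if_pos h, ← ENNReal.ofReal_mul ha, norm_smul, Real.norm_of_nonneg ha]
    congr 1; field_simp

theorem lagBdry_smul (κ a : ℝ) (ha : 0 ≤ a) (u : Vec d) (h : ℝ) :
    lagBdry κ a (a • u) (a * h)
      = ENNReal.ofReal a * ENNReal.ofReal ((‖u‖ ^ 2 + κ ^ 2 * h ^ 2) / 2) := by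
  unfold lagBdry
  rcases ha.eq_or_lt with rfl | h
  · simp
  · rw [if_pos h, ← ENNReal.ofReal_mul ha, norm_smul, Real.norm_of_nonneg ha]
    congr 1; field_simp

theorem measurable_lagInt : Measurable fun q : ℝ × Vec d => lagInt q.1 q.2 := by
  unfold lagInt
  refine Measurable.ite (measurableSet_lt measurable_const measurable_fst) (by fun_prop)
    (Measurable.ite ?_ measurable_const measurable_const)
  exact (measurableSet_eq_fun measurable_fst measurable_const).inter
    (measurableSet_eq_fun measurable_snd measurable_const)

theorem measurable_lagBdry (κ : ℝ) :
    Measurable fun q : ℝ × Vec d × ℝ => lagBdry κ q.1 q.2.1 q.2.2 := by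
  unfold lagBdry
  refine Measurable.ite (measurableSet_lt measurable_const measurable_fst) (by fun_prop)
    (Measurable.ite ?_ measurable_const measurable_const)
  exact (measurableSet_eq_fun measurable_fst measurable_const).inter
    ((measurableSet_eq_fun measurable_snd.fst measurable_const).inter
      (measurableSet_eq_fun measurable_snd.snd measurable_const))

theorem of_lagInt_lt_top {a : ℝ} {u : Vec d} (h : lagInt a u < ⊤) :
    0 ≤ a ∧ (a = 0 → u = 0) := by
  unfold lagInt at h
  split_ifs at h with h1 h2
  · exact ⟨h1.le, fun h => absurd h h1.ne'⟩
  · exact ⟨h2.1.ge, fun _ => h2.2⟩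
  · exact absurd h (lt_irrefl _)

theorem of_lagBdry_lt_top {κ a : ℝ} {u : Vec d} {b : ℝ} (h : lagBdry κ a u b < ⊤) :
    0 ≤ a ∧ (a = 0 → u = 0) ∧ (a = 0 → b = 0) := by
  unfold lagBdry at h
  split_ifs at h with h1 h2
  · exact ⟨h1.le, fun h => absurd h h1.ne', fun h => absurd h h1.ne'⟩
  · exact ⟨h2.1.ge, fun _ => h2.2.1, fun _ => h2.2.2⟩
  · exact absurd h (lt_irrefl _)

theorem measurable_vecDensity {X : Type*} [MeasurableSpace X] {k : ℕ}
    (F : Fin k → SignedMeasure X) (ν : Measure X) : Measurable (vecDensity F ν) :=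
  (PiLp.continuous_toLp 2 _).measurable.comp
    (measurable_pi_iff.2 fun i => SignedMeasure.measurable_rnDeriv (F i) ν)

theorem vecDensity_eq_smul {X : Type*} [MeasurableSpace X] {m ν : Measure X} [SigmaFinite ν]
    [SigmaFinite m] (hm : m ≪ ν) {v : X → Vec d} (hv : Integrable v m) :
    vecDensity (fun i => m.withDensityᵥ fun p => v p i) ν
      =ᵐ[ν] fun p => (m.rnDeriv ν p).toReal • v p := by
  have : ∀ i, SignedMeasure.rnDeriv (m.withDensityᵥ fun p => v p i) ν
      =ᵐ[ν] fun p => (m.rnDeriv ν p).toReal * v p i := fun i =>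
    rnDeriv_withDensityᵥ_of_ac hm (integrable_coord hv i)
  filter_upwards [ae_all_iff.2 this] with p hp
  ext i
  simpa [vecDensity] using hp i

theorem ac_sum_totalVariation {X : Type*} [MeasurableSpace X] {m : Measure X} {v : X → Vec d}
    (hv : Integrable v m) :
    ∑ i, SignedMeasure.totalVariation (m.withDensityᵥ fun p => v p i) ≪ m := by
  rw [← Measure.sum_fintype]
  exact Measure.absolutelyContinuous_sum_left fun i =>
    totalVariation_withDensityᵥ_ac (integrable_coord hv i)

theorem totalVariation_ac_sum {X : Type*} [MeasurableSpace X] {k : ℕ}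
    (s : Fin k → SignedMeasure X) (i : Fin k) :
    (s i).totalVariation ≪ ∑ i, (s i).totalVariation := by
  rw [← Measure.sum_fintype]
  exact (Measure.le_sum _ i).absolutelyContinuous

instance isFiniteMeasure_totalVariation {X : Type*} [MeasurableSpace X] (s : SignedMeasure X) :
    IsFiniteMeasure s.totalVariation := by
  unfold SignedMeasure.totalVariation; infer_instance

instance isFiniteMeasure_sum_totalVariation {X : Type*} [MeasurableSpace X] {k : ℕ}
    (s : Fin k → SignedMeasure X) : IsFiniteMeasure (∑ i, (s i).totalVariation) := by
  rw [← Measure.sum_fintype]; infer_instance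

instance isFiniteMeasure_refInt {Ω : Set (Vec d)} (μ : MeasureTuple Ω) :
    IsFiniteMeasure μ.refInt := by
  unfold MeasureTuple.refInt; infer_instance

instance isFiniteMeasure_refBdry {Ω : Set (Vec d)} (μ : MeasureTuple Ω) :
    IsFiniteMeasure μ.refBdry := by
  unfold MeasureTuple.refBdry; infer_instance

namespace Flow

variable {Ω : Set (Vec d)}

/-- The tuple of measures `(m, v m ; n, w n, h n)`. -/
def toTuple (Φ : Flow Ω) : MeasureTuple Ω where
  ω := Φ.m.toSignedMeasure
  F i := Φ.m.withDensityᵥ fun p => Φ.v p i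
  γ := Φ.n.toSignedMeasure
  G i := Φ.n.withDensityᵥ fun p => Φ.w p i
  f := Φ.n.withDensityᵥ Φ.h
  tangent := by
    set τ := ∑ i, SignedMeasure.totalVariation (Φ.n.withDensityᵥ fun p => Φ.w p i) with hτ
    have hac : τ ≪ Φ.n := ac_sum_totalVariation Φ.integrable_w
    have hle : ∀ i, SignedMeasure.totalVariation (Φ.n.withDensityᵥ fun p => Φ.w p i) ≪ τ :=
      fun i => totalVariation_ac_sum
        (fun i => (Φ.n.withDensityᵥ fun p => Φ.w p i : SignedMeasure _)) i
    set u := fun i => SignedMeasure.rnDeriv (Φ.n.withDensityᵥ fun p => Φ.w p i) τ with hu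
    have h1 : ∀ i, (fun p => Φ.w p i) =ᵐ[Φ.n] fun p => (τ.rnDeriv Φ.n p).toReal * u i p := by
      intro i
      obtain ⟨hi, he⟩ := withDensityᵥ_change hac (SignedMeasure.integrable_rnDeriv
        (Φ.n.withDensityᵥ fun p => Φ.w p i) τ)
      rw [withDensityᵥ_rnDeriv (hle i)] at he
      exact (integrable_coord Φ.integrable_w i).ae_eq_of_withDensityᵥ_eq hi he.symm
    filter_upwards [Measure.rnDeriv_pos hac, hac.ae_le (τ.rnDeriv_lt_top Φ.n),
      hac.ae_le (ae_all_iff.2 h1), hac.ae_le Φ.tangent] with p hp hp' hw ht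
    have hc : (τ.rnDeriv Φ.n p).toReal ≠ 0 := (ENNReal.toReal_pos hp.ne' hp'.ne).ne'
    have : vecDensity (fun i => Φ.n.withDensityᵥ fun p => Φ.w p i) τ p
        = (τ.rnDeriv Φ.n p).toReal⁻¹ • Φ.w p := by
      ext i
      simp only [vecDensity, PiLp.smul_apply, smul_eq_mul, hw i]
      rw [inv_mul_cancel_left₀ hc]
    rw [this]
    exact smul_mem_tangentConeAt ht _

theorem action_toTuple (κ : ℝ) (Φ : Flow Ω) : action κ Φ.toTuple = Φ.act κ := by
  have e1 : Φ.toTuple.ω.totalVariation = Φ.m := totalVariation_toSignedMeasure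
  have e2 : Φ.toTuple.γ.totalVariation = Φ.n := totalVariation_toSignedMeasure
  have hm : Φ.m ≪ Φ.toTuple.refInt := by
    rw [MeasureTuple.refInt, e1]
    exact (Measure.le_add_right le_rfl).absolutelyContinuous
  have hn : Φ.n ≪ Φ.toTuple.refBdry := by
    rw [MeasureTuple.refBdry, e2, add_assoc]
    exact (Measure.le_add_right le_rfl).absolutelyContinuous
  rw [action, act]
  congr 1
  · rw [← lintegral_rnDeriv_mul hm]
    · refine lintegral_congr_ae ?_
      filter_upwards [rnDeriv_toSignedMeasure_of_ac hm, vecDensity_eq_smul hm Φ.integrable_v,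
        Φ.m.rnDeriv_lt_top Φ.toTuple.refInt] with p h1 h2 h3
      change lagInt (Φ.m.toSignedMeasure.rnDeriv Φ.toTuple.refInt p) _ = _
      rw [h1, show vecDensity Φ.toTuple.F Φ.toTuple.refInt p = _ from h2,
        lagInt_smul _ ENNReal.toReal_nonneg, ENNReal.ofReal_toReal h3.ne]
    · have := Φ.measurable_v; fun_prop
  · rw [← lintegral_rnDeriv_mul hn]
    · refine lintegral_congr_ae ?_
      filter_upwards [rnDeriv_toSignedMeasure_of_ac hn, vecDensity_eq_smul hn Φ.integrable_w,
        rnDeriv_withDensityᵥ_of_ac hn Φ.integrable_h,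
        Φ.n.rnDeriv_lt_top Φ.toTuple.refBdry] with p h1 h2 h3 h4
      change lagBdry κ (Φ.n.toSignedMeasure.rnDeriv Φ.toTuple.refBdry p) _
        (SignedMeasure.rnDeriv (Φ.n.withDensityᵥ Φ.h) _ p) = _
      rw [h1, h3, show vecDensity Φ.toTuple.G Φ.toTuple.refBdry p = _ from h2,
        lagBdry_smul _ _ ENNReal.toReal_nonneg, ENNReal.ofReal_toReal h4.ne]
    · have := Φ.measurable_w; have := Φ.measurable_h; fun_prop

/-- For tuples with nonnegative `ω`, `γ` dominating the remaining components, the signed-measure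
form of the continuity equations is the form with velocities. -/
theorem isCE_iff_joins (hΩ : Bornology.IsBounded Ω) (Φ : Flow Ω) {μ : MeasureTuple Ω}
    (hω : μ.ω = Φ.m.toSignedMeasure) (hF : ∀ i, μ.F i = Φ.m.withDensityᵥ fun p => Φ.v p i)
    (hγ : μ.γ = Φ.n.toSignedMeasure) (hG : ∀ i, μ.G i = Φ.n.withDensityᵥ fun p => Φ.w p i)
    (hf : μ.f = Φ.n.withDensityᵥ Φ.h) (ρ ρ' : POplus Ω) :
    IsCE ρ ρ' μ ↔ Φ.Joins 0 1 ρ ρ' := by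
  have hcl : IsCompact (closure Ω) := hΩ.isCompact_closure
  have hfr : IsCompact (frontier Ω) := hcl.of_isClosed_subset isClosed_frontier
    frontier_subset_closure
  have key : ∀ {S : Set (Vec d)} (_ : IsCompact S) {g : ℝ × Vec d → ℝ} (_ : Continuous g)
      {m : Measure (I × S)} {h : I × S → ℝ} (_ : Integrable h m),
      (∫ᵛ p, g (toAmbient p) ∂<•(m.withDensityᵥ h)) = ∫ p, g (toAmbient p) * h p ∂m := by
    intro S hS g hg m h hh
    obtain ⟨C, hC⟩ := exists_bound_of_compact hS hg
    exact integral_withDensityᵥ hh (hg.comp continuous_toAmbient).measurable hC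
  have hi : ∀ φ : ℝ × Vec d → ℝ, ContDiff ℝ 1 φ →
      (∫ᵛ p, dt φ (toAmbient p) ∂<•μ.ω) + (∑ i, ∫ᵛ p, dx i φ (toAmbient p) ∂<•(μ.F i))
        - (∫ᵛ p, φ (toAmbient p) ∂<•μ.f) = (∫ p, adv φ (Φ.v p) (toAmbient p) ∂Φ.m)
          + ∫ p, φ (toAmbient p) * (-Φ.h) p ∂Φ.n := by
    intro φ hφ
    rw [integral_adv hcl hφ Φ.integrable_v, hω, hf, VectorMeasure.integral_toSignedMeasure,
      key hfr hφ.continuous Φ.integrable_h]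
    simp only [hF, key hcl (continuous_dx hφ _) (integrable_coord Φ.integrable_v _),
      Pi.neg_apply, mul_neg, integral_neg]
    ring
  have hb : ∀ φ : ℝ × Vec d → ℝ, ContDiff ℝ 1 φ →
      (∫ᵛ p, dt φ (toAmbient p) ∂<•μ.γ) + (∑ i, ∫ᵛ p, dx i φ (toAmbient p) ∂<•(μ.G i))
        + (∫ᵛ p, φ (toAmbient p) ∂<•μ.f) = (∫ p, adv φ (Φ.w p) (toAmbient p) ∂Φ.n)
          + ∫ p, φ (toAmbient p) * Φ.h p ∂Φ.n := by
    intro φ hφ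
    rw [integral_adv hfr hφ Φ.integrable_w, hγ, hf, VectorMeasure.integral_toSignedMeasure,
      key hfr hφ.continuous Φ.integrable_h]
    simp only [hG, key hfr (continuous_dx hφ _) (integrable_coord Φ.integrable_w _)]
  constructor
  · rintro ⟨h1, h2⟩
    exact ⟨fun φ hφ => by rw [← hi φ hφ]; exact h1 φ hφ,
      fun φ hφ => by rw [← hb φ hφ]; exact h2 φ hφ⟩
  · rintro ⟨h1, h2⟩
    exact ⟨fun φ hφ => by rw [hi φ hφ]; exact h1 φ hφ,
      fun φ hφ => by rw [hb φ hφ]; exact h2 φ hφ⟩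

theorem WSq_le_act (hΩ : Bornology.IsBounded Ω) {κ : ℝ} {Φ : Flow Ω} {ρ ρ' : POplus Ω}
    (h : Φ.Joins 0 1 ρ ρ') : WSq κ ρ ρ' ≤ Φ.act κ := by
  rw [← action_toTuple]
  exact iInf₂_le _ ((isCE_iff_joins hΩ Φ rfl (fun _ => rfl) rfl (fun _ => rfl) rfl ρ ρ').2 h)

/-- A tuple of finite action is a flow: finiteness forces `ω, γ ≥ 0`, `F ≪ ω` and
`G, f ≪ γ`. -/
theorem exists_of_action_lt_top (hΩ : Bornology.IsBounded Ω) {κ : ℝ} {ρ ρ' : POplus Ω}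
    {μ : MeasureTuple Ω} (hCE : IsCE ρ ρ' μ) (hμ : action κ μ < ⊤) :
    ∃ Φ : Flow Ω, Φ.Joins 0 1 ρ ρ' ∧ Φ.act κ = action κ μ ∧ μ.ω = Φ.m.toSignedMeasure ∧
      μ.γ = Φ.n.toSignedMeasure := by
  set ν := μ.refInt with hν
  set η := μ.refBdry with hη
  have acω : μ.ω.totalVariation ≪ ν :=
    (Measure.le_add_right le_rfl).absolutelyContinuous
  have acF : ∀ i, (μ.F i).totalVariation ≪ ν := fun i =>
    (totalVariation_ac_sum μ.F i).trans (Measure.le_add_left le_rfl).absolutelyContinuous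
  have acf : μ.f.totalVariation ≪ η := (Measure.le_add_left le_rfl).absolutelyContinuous
  have acγ : μ.γ.totalVariation ≪ η := by
    rw [hη, MeasureTuple.refBdry, add_assoc]
    exact (Measure.le_add_right le_rfl).absolutelyContinuous
  have acS : ∑ i, (μ.G i).totalVariation ≪ η :=
    (Measure.le_add_right (Measure.le_add_left le_rfl)).absolutelyContinuous
  have acG : ∀ i, (μ.G i).totalVariation ≪ η := fun i =>
    (totalVariation_ac_sum μ.G i).trans acS
  set a := μ.ω.rnDeriv ν with ha
  set b := μ.γ.rnDeriv η with hb
  have ma : Measurable a := SignedMeasure.measurable_rnDeriv _ _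
  have mb : Measurable b := SignedMeasure.measurable_rnDeriv _ _
  have mF := measurable_vecDensity μ.F ν
  have mG := measurable_vecDensity μ.G η
  have mf : Measurable (μ.f.rnDeriv η) := SignedMeasure.measurable_rnDeriv _ _
  have hact : action κ μ = (∫⁻ p, lagInt (a p) (vecDensity μ.F ν p) ∂ν) +
    ∫⁻ p, lagBdry κ (b p) (vecDensity μ.G η p) (μ.f.rnDeriv η p) ∂η := rfl
  rw [hact] at hμ
  have L1 : ∀ᵐ p ∂ν, 0 ≤ a p ∧ (a p = 0 → vecDensity μ.F ν p = 0) := by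
    filter_upwards [ae_lt_top (measurable_lagInt.comp (ma.prodMk mF))
      (ENNReal.add_lt_top.1 hμ).1.ne] with p hp using of_lagInt_lt_top hp
  have L2 : ∀ᵐ p ∂η, 0 ≤ b p ∧ (b p = 0 → vecDensity μ.G η p = 0) ∧
      (b p = 0 → μ.f.rnDeriv η p = 0) := by
    filter_upwards [ae_lt_top ((measurable_lagBdry κ).comp (mb.prodMk (mG.prodMk mf)))
      (ENNReal.add_lt_top.1 hμ).2.ne] with p hp using of_lagBdry_lt_top hp
  have fm : IsFiniteMeasure (ν.withDensity fun p => ENNReal.ofReal (a p)) :=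
    isFiniteMeasure_withDensity_ofReal (SignedMeasure.integrable_rnDeriv _ _).2
  have fn : IsFiniteMeasure (η.withDensity fun p => ENNReal.ofReal (b p)) :=
    isFiniteMeasure_withDensity_ofReal (SignedMeasure.integrable_rnDeriv _ _).2
  have dF := fun i => withDensityᵥ_div (acF i) ma (L1.mono fun _ h => h.1)
    (L1.mono fun p h h0 => congrArg (fun u : Vec d => u i) (h.2 h0))
  have dG := fun i => withDensityᵥ_div (acG i) mb (L2.mono fun _ h => h.1)
    (L2.mono fun p h h0 => congrArg (fun u : Vec d => u i) (h.2.1 h0))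
  have df := withDensityᵥ_div acf mb (L2.mono fun _ h => h.1) (L2.mono fun p h => h.2.2)
  have hT : vecDensity μ.G η =ᵐ[η] fun p => ((∑ i, (μ.G i).totalVariation).rnDeriv η p).toReal •
      vecDensity μ.G (∑ i, (μ.G i).totalVariation) p := by
    have : ∀ i, (μ.G i).rnDeriv η =ᵐ[η] fun p =>
        ((∑ i, (μ.G i).totalVariation).rnDeriv η p).toReal *
          (μ.G i).rnDeriv (∑ i, (μ.G i).totalVariation) p := by
      intro i
      have h := rnDeriv_withDensityᵥ_of_ac acS (SignedMeasure.integrable_rnDeriv (μ.G i)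
        (∑ i, (μ.G i).totalVariation))
      rwa [withDensityᵥ_rnDeriv (totalVariation_ac_sum μ.G i)] at h
    filter_upwards [ae_all_iff.2 this] with p hp
    ext i
    simpa [vecDensity] using hp i
  have hT' : ∀ᵐ p ∂η, (∑ i, (μ.G i).totalVariation).rnDeriv η p ≠ 0 →
      vecDensity μ.G (∑ i, (μ.G i).totalVariation) p ∈
        tangentConeAt ℝ (frontier Ω) (p.2 : Vec d) := by
    rw [← ae_withDensity_iff (Measure.measurable_rnDeriv _ _),
      Measure.withDensity_rnDeriv_eq _ _ acS]
    exact μ.tangent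
  let Φ : Flow Ω :=
    { m := ν.withDensity fun p => ENNReal.ofReal (a p)
      v := fun p => (a p)⁻¹ • vecDensity μ.F ν p
      n := η.withDensity fun p => ENNReal.ofReal (b p)
      w := fun p => (b p)⁻¹ • vecDensity μ.G η p
      h := fun p => μ.f.rnDeriv η p / b p
      finite_m := fm
      finite_n := fn
      measurable_v := ma.inv.smul mF
      measurable_w := mb.inv.smul mG
      measurable_h := mf.div mb
      integrable_v := by
        refine Integrable.of_eval_piLp fun i => ?_
        simpa [vecDensity, div_eq_inv_mul] using (dF i).1
      integrable_w := by
        refine Integrable.of_eval_piLp fun i => ?_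
        simpa [vecDensity, div_eq_inv_mul] using (dG i).1
      integrable_h := df.1
      tangent := by
        refine (withDensity_absolutelyContinuous _ _).ae_le ?_
        filter_upwards [hT, hT'] with p h1 h2
        refine smul_mem_tangentConeAt ?_ _
        rw [h1]
        by_cases h0 : (∑ i, (μ.G i).totalVariation).rnDeriv η p = 0
        · simpa [h0] using zero_mem_tangentConeAt (𝕜 := ℝ) (subset_closure p.2.2)
        · exact smul_mem_tangentConeAt (h2 h0) _ }
  have eω : μ.ω = Φ.m.toSignedMeasure :=
    (toSignedMeasure_withDensity_rnDeriv acω (L1.mono fun _ h => h.1)).symm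
  have eγ : μ.γ = Φ.n.toSignedMeasure :=
    (toSignedMeasure_withDensity_rnDeriv acγ (L2.mono fun _ h => h.1)).symm
  refine ⟨Φ, ?_, ?_, eω, eγ⟩
  · refine (isCE_iff_joins hΩ Φ eω (fun i => ?_) eγ (fun i => ?_) df.2.symm ρ ρ').1 hCE
    · simpa [Φ, vecDensity, div_eq_inv_mul] using (dF i).2.symm
    · simpa [Φ, vecDensity, div_eq_inv_mul] using (dG i).2.symm
  · rw [hact, act]
    have mv := Φ.measurable_v
    have mw := Φ.measurable_w
    have mh := Φ.measurable_h
    congr 1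
    · rw [lintegral_withDensity_eq_lintegral_mul _ ma.ennreal_ofReal (by fun_prop)]
      refine lintegral_congr_ae ?_
      filter_upwards [L1] with p hp
      rw [Pi.mul_apply, ← lagInt_smul _ hp.1]
      by_cases h0 : a p = 0
      · simp [h0, hp.2 h0]
      · simp [Φ, h0]
    · rw [lintegral_withDensity_eq_lintegral_mul _ mb.ennreal_ofReal (by fun_prop)]
      refine lintegral_congr_ae ?_
      filter_upwards [L2] with p hp
      rw [Pi.mul_apply, ← lagBdry_smul _ _ hp.1]
      by_cases h0 : b p = 0
      · simp [h0, hp.2.1 h0, hp.2.2 h0]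
      · simp [Φ, h0, mul_div_cancel₀]

end Flow

/-! ### Calculus of test functions -/

section Calculus

variable {φ : ℝ × Vec d → ℝ}

theorem adv_affine_time (hφ : ContDiff ℝ 1 φ) (α β : ℝ) (u : Vec d) (q : ℝ × Vec d) :
    adv (fun q => φ (α + β * q.1, q.2)) u q
      = β * dt φ (α + β * q.1, q.2) + ∑ i, dx i φ (α + β * q.1, q.2) * u i := by
  have hL : HasFDerivAt (fun q : ℝ × Vec d => (α + β * q.1, q.2))
      ((β • ContinuousLinearMap.fst ℝ ℝ (Vec d)).prod (ContinuousLinearMap.snd ℝ ℝ (Vec d))) q :=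
    ((hasFDerivAt_fst.const_mul β).const_add α).prodMk hasFDerivAt_snd
  have h := ((hφ.differentiable one_ne_zero) (α + β * q.1, q.2)).hasFDerivAt.comp q hL
  have hf : fderiv ℝ (fun q : ℝ × Vec d => φ (α + β * q.1, q.2)) q = _ := h.fderiv
  have h10 : ((β, 0) : ℝ × Vec d) = β • (1, 0) := by simp
  simp only [adv, dt, dx, hf, ContinuousLinearMap.comp_apply, ContinuousLinearMap.prod_apply,
    smul_apply, ContinuousLinearMap.coe_fst', ContinuousLinearMap.coe_snd',
    smul_eq_mul, mul_one, mul_zero, h10, map_smul]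

theorem adv_time_mul {N η : ℝ → ℝ} (hN : ∀ t, HasDerivAt N (η t) t) (hφ : ContDiff ℝ 1 φ)
    (u : Vec d) (q : ℝ × Vec d) :
    adv (fun q => N q.1 * φ q) u q = η q.1 * φ q + N q.1 * adv φ u q := by
  have h1 : HasFDerivAt (fun q : ℝ × Vec d => N q.1)
      (η q.1 • ContinuousLinearMap.fst ℝ ℝ (Vec d)) q :=
    (hN q.1).comp_hasFDerivAt q hasFDerivAt_fst
  have hf := (h1.mul ((hφ.differentiable one_ne_zero) q).hasFDerivAt).fderiv
  have hf' : fderiv ℝ (fun q : ℝ × Vec d => N q.1 * φ q) q = _ := hf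
  simp only [adv, dt, dx, hf', add_apply, smul_apply,
    ContinuousLinearMap.coe_fst', smul_eq_mul, mul_one, mul_zero, add_zero, mul_add,
    Finset.mul_sum]
  simp only [mul_assoc]
  ring

theorem contDiff_time_mul {N η : ℝ → ℝ} (hN : ∀ t, HasDerivAt N (η t) t) (hη : Continuous η)
    (hφ : ContDiff ℝ 1 φ) : ContDiff ℝ 1 fun q : ℝ × Vec d => N q.1 * φ q := by
  have : ContDiff ℝ 1 N := contDiff_one_iff_deriv.2
    ⟨fun t => (hN t).differentiableAt, by rwa [funext fun t => (hN t).deriv]⟩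
  exact (this.comp contDiff_fst).mul hφ

end Calculus

theorem integral_unitInterval (f : ℝ → ℝ) : ∫ t : I, f t = ∫ t in (0 : ℝ)..1, f t := by
  rw [intervalIntegral.integral_of_le zero_le_one, ← integral_Icc_eq_integral_Ioc,
    ← integral_subtype_comap measurableSet_Icc]
  rfl

theorem POplus.mass {Ω : Set (Vec d)} (ρ : POplus Ω) :
    (ρ.ω : Measure (closure Ω)).real univ + (ρ.γ : Measure (frontier Ω)).real univ = 1 := by
  have h := ρ.isProb.measure_univ
  rw [Measure.add_apply, Measure.map_apply (by fun_prop) MeasurableSet.univ, preimage_univ] at h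
  rw [measureReal_def, measureReal_def, ← ENNReal.toReal_add (measure_ne_top _ _)
    (measure_ne_top _ _), h, ENNReal.toReal_one]

/-! ### Operations on flows -/

/-- Affine change of time `t ↦ α + β t` on the cylinder `[0,1] × S` (truncated to `[0,1]`). -/
def timeMap (α β : ℝ) {S : Set (Vec d)} (p : I × S) : I × S :=
  (projIcc 0 1 zero_le_one (α + β * p.1), p.2)

theorem measurable_timeMap (α β : ℝ) {S : Set (Vec d)} :
    Measurable (timeMap α β : I × S → I × S) := by
  refine Measurable.prodMk ?_ measurable_snd
  exact continuous_projIcc.measurable.comp (by fun_prop)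

theorem toAmbient_timeMap {α β : ℝ} {S : Set (Vec d)} {p : I × S}
    (hp : α + β * (p.1 : ℝ) ∈ Icc (0 : ℝ) 1) :
    toAmbient (timeMap α β p) = (α + β * (p.1 : ℝ), (p.2 : Vec d)) := by
  simp [toAmbient, timeMap, projIcc_of_mem _ hp]

theorem timeMap_timeMap {α β : ℝ} (hβ : β ≠ 0) {S : Set (Vec d)} {p : I × S}
    (hp : α + β * (p.1 : ℝ) ∈ Icc (0 : ℝ) 1) :
    timeMap (-(β⁻¹ * α)) β⁻¹ (timeMap α β p) = p := by
  refine Prod.ext (Subtype.ext ?_) rfl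
  simp only [timeMap, projIcc_of_mem _ hp]
  have : -(β⁻¹ * α) + β⁻¹ * (α + β * (p.1 : ℝ)) = p.1 := by field_simp; ring
  rw [this, projIcc_val]

theorem measurable_comp_timeMap {E : Type*} [NormedAddCommGroup E] [NormedSpace ℝ E]
    [MeasurableSpace E] [BorelSpace E] {X : Set (Vec d)} {g : I × X → E} (hg : Measurable g)
    (α β : ℝ) : Measurable fun p => β⁻¹ • g (timeMap (-(β⁻¹ * α)) β⁻¹ p) :=
  (hg.comp (measurable_timeMap _ _)).const_smul β⁻¹

section ContEqOperations

variable {S B : Set (Vec d)} {a b c : ℝ} {ρ ρ' ρ'' : Measure S} {m : Measure (I × S)}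
  {v : I × S → Vec d} {n : Measure (I × B)} {h : I × B → ℝ}

theorem integral_timeMap {α β : ℝ} {X : Set (Vec d)} {m : Measure (I × X)} {G : I × X → ℝ}
    (hG : Measurable G) :
    ∫ p, G p ∂(ENNReal.ofReal |β| • m.map (timeMap α β))
      = |β| * ∫ p, G (timeMap α β p) ∂m := by
  rw [integral_smul_measure, integral_map (measurable_timeMap α β).aemeasurable
    hG.aestronglyMeasurable, ENNReal.toReal_ofReal (abs_nonneg β), smul_eq_mul]

/-- Testing with `φ (α + β t, x)` gives the weak form of the continuity equation after the change
of time. The factor `|β| β⁻¹` is the sign of `β`, that is, the orientation of time. -/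
theorem ContEq.weak_timeMap {α β : ℝ} (hβ : β ≠ 0) (H : ContEq a b ρ ρ' m v n h)
    (hv : Measurable v) (hh : Measurable h)
    (hm : ∀ᵐ p ∂m, α + β * (p.1 : ℝ) ∈ Icc (0 : ℝ) 1)
    (hn : ∀ᵐ p ∂n, α + β * (p.1 : ℝ) ∈ Icc (0 : ℝ) 1) {φ : ℝ × Vec d → ℝ}
    (hφ : ContDiff ℝ 1 φ) :
    (∫ p, adv φ (β⁻¹ • v (timeMap (-(β⁻¹ * α)) β⁻¹ p)) (toAmbient p)
        ∂(ENNReal.ofReal |β| • m.map (timeMap α β))) +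
      (∫ p, φ (toAmbient p) * (β⁻¹ * h (timeMap (-(β⁻¹ * α)) β⁻¹ p))
        ∂(ENNReal.ofReal |β| • n.map (timeMap α β)))
      = |β| * β⁻¹ * ((∫ x, φ (α + β * b, x) ∂ρ') - ∫ x, φ (α + β * a, x) ∂ρ) := by
  have hc : ContDiff ℝ 1 fun q : ℝ × Vec d => φ (α + β * q.1, q.2) := by fun_prop
  have key := H _ hc
  have hM : Measurable fun p : I × B =>
      φ (toAmbient p) * (β⁻¹ * h (timeMap (-(β⁻¹ * α)) β⁻¹ p)) :=
    (hφ.continuous.comp continuous_toAmbient).measurable.mul (measurable_comp_timeMap hh α β)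
  rw [integral_timeMap (measurable_adv hφ (measurable_comp_timeMap hv α β)),
    integral_timeMap hM, ← key, mul_assoc, mul_add, mul_add]
  congr 2
  · rw [← integral_const_mul]
    refine integral_congr_ae ?_
    filter_upwards [hm] with p hp
    rw [timeMap_timeMap hβ hp, toAmbient_timeMap hp, adv_affine_time hφ, adv]
    simp only [toAmbient, PiLp.smul_apply, smul_eq_mul, mul_add, Finset.mul_sum]
    rw [inv_mul_cancel_left₀ hβ]
    congr 1
    exact Finset.sum_congr rfl fun i _ => by ring
  · rw [← integral_const_mul]
    refine integral_congr_ae ?_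
    filter_upwards [hn] with p hp
    rw [timeMap_timeMap hβ hp, toAmbient_timeMap hp]
    simp only [toAmbient]
    ring

theorem ContEq.glue {m₁ m₂ : Measure (I × S)} {v₁ v₂ : I × S → Vec d}
    {n₁ n₂ : Measure (I × B)} {h₁ h₂ : I × B → ℝ}
    (hS : IsCompact S) (hB : IsCompact B)
    [IsFiniteMeasure m₁] [IsFiniteMeasure m₂]
    (H₁ : ContEq a b ρ ρ' m₁ v₁ n₁ h₁) (H₂ : ContEq b c ρ' ρ'' m₂ v₂ n₂ h₂)
    (hv₁ : Integrable v₁ m₁) (hv₂ : Integrable v₂ m₂)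
    (hh₁ : Integrable h₁ n₁) (hh₂ : Integrable h₂ n₂)
    {v : I × S → Vec d} {h : I × B → ℝ} (e₁ : v =ᵐ[m₁] v₁) (e₂ : v =ᵐ[m₂] v₂)
    (f₁ : h =ᵐ[n₁] h₁) (f₂ : h =ᵐ[n₂] h₂) :
    ContEq a c ρ ρ'' (m₁ + m₂) v (n₁ + n₂) h := by
  intro φ hφ
  rw [integral_add_measure (integrable_adv hS hφ (hv₁.congr e₁.symm))
      (integrable_adv hS hφ (hv₂.congr e₂.symm)),
    integral_add_measure (integrable_test_mul hB hφ.continuous (hh₁.congr f₁.symm))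
      (integrable_test_mul hB hφ.continuous (hh₂.congr f₂.symm))]
  have i₁ : ∫ p, adv φ (v p) (toAmbient p) ∂m₁ = ∫ p, adv φ (v₁ p) (toAmbient p) ∂m₁ :=
    integral_congr_ae (e₁.mono fun p hp => by simp only [hp])
  have i₂ : ∫ p, adv φ (v p) (toAmbient p) ∂m₂ = ∫ p, adv φ (v₂ p) (toAmbient p) ∂m₂ :=
    integral_congr_ae (e₂.mono fun p hp => by simp only [hp])
  have j₁ : ∫ p, φ (toAmbient p) * h p ∂n₁ = ∫ p, φ (toAmbient p) * h₁ p ∂n₁ :=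
    integral_congr_ae (f₁.mono fun p hp => by simp only [hp])
  have j₂ : ∫ p, φ (toAmbient p) * h p ∂n₂ = ∫ p, φ (toAmbient p) * h₂ p ∂n₂ :=
    integral_congr_ae (f₂.mono fun p hp => by simp only [hp])
  rw [i₁, i₂, j₁, j₂]
  linarith [H₁ φ hφ, H₂ φ hφ]

end ContEqOperations

namespace Flow

variable {Ω : Set (Vec d)}

theorem integrable_timeMap {α β : ℝ} (hβ : β ≠ 0) {X : Set (Vec d)} {E : Type*}
    [NormedAddCommGroup E] [NormedSpace ℝ E] [MeasurableSpace E] [BorelSpace E]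
    [SecondCountableTopology E] {m : Measure (I × X)} {g : I × X → E} (hg : Measurable g)
    (hi : Integrable g m) (hm : ∀ᵐ p ∂m, α + β * (p.1 : ℝ) ∈ Icc (0 : ℝ) 1) :
    Integrable (fun p => β⁻¹ • g (timeMap (-(β⁻¹ * α)) β⁻¹ p))
      (ENNReal.ofReal |β| • m.map (timeMap α β)) := by
  refine Integrable.smul_measure ?_ ENNReal.ofReal_ne_top
  refine (integrable_map_measure ?_ (measurable_timeMap α β).aemeasurable).2 ?_
  · exact (measurable_comp_timeMap hg α β).aestronglyMeasurable
  · refine (hi.smul β⁻¹).congr ?_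
    filter_upwards [hm] with p hp
    simp [timeMap_timeMap hβ hp]

theorem quasiMeasurePreserving_timeMap {α β : ℝ} (hβ : β ≠ 0) {X : Set (Vec d)}
    {m : Measure (I × X)} (hm : ∀ᵐ p ∂m, α + β * (p.1 : ℝ) ∈ Icc (0 : ℝ) 1) :
    Measure.QuasiMeasurePreserving (timeMap (-(β⁻¹ * α)) β⁻¹) (m.map (timeMap α β)) m := by
  refine ⟨measurable_timeMap _ _, ?_⟩
  have h : timeMap (-(β⁻¹ * α)) β⁻¹ ∘ timeMap α β =ᵐ[m] id :=
    hm.mono fun p hp => timeMap_timeMap hβ hp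
  rw [Measure.map_map (measurable_timeMap _ _) (measurable_timeMap _ _), Measure.map_congr h,
    Measure.map_id]

/-- The affine change of time `t ↦ α + β t` of a flow carried by times that it keeps
in `[0, 1]`. Velocities and exchange rates are divided by `β`. -/
def reparam (Φ : Flow Ω) (α β : ℝ) (hβ : β ≠ 0)
    (hm : ∀ᵐ p ∂Φ.m, α + β * (p.1 : ℝ) ∈ Icc (0 : ℝ) 1)
    (hn : ∀ᵐ p ∂Φ.n, α + β * (p.1 : ℝ) ∈ Icc (0 : ℝ) 1) : Flow Ω where
  m := ENNReal.ofReal |β| • Φ.m.map (timeMap α β)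
  v p := β⁻¹ • Φ.v (timeMap (-(β⁻¹ * α)) β⁻¹ p)
  n := ENNReal.ofReal |β| • Φ.n.map (timeMap α β)
  w p := β⁻¹ • Φ.w (timeMap (-(β⁻¹ * α)) β⁻¹ p)
  h p := β⁻¹ * Φ.h (timeMap (-(β⁻¹ * α)) β⁻¹ p)
  finite_m := Measure.smul_finite _ ENNReal.ofReal_ne_top
  finite_n := Measure.smul_finite _ ENNReal.ofReal_ne_top
  measurable_v := measurable_comp_timeMap Φ.measurable_v α β
  measurable_w := measurable_comp_timeMap Φ.measurable_w α β
  measurable_h := measurable_comp_timeMap Φ.measurable_h α β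
  integrable_v := integrable_timeMap hβ Φ.measurable_v Φ.integrable_v hm
  integrable_w := integrable_timeMap hβ Φ.measurable_w Φ.integrable_w hn
  integrable_h := integrable_timeMap hβ Φ.measurable_h Φ.integrable_h hn
  tangent := by
    refine (Measure.smul_absolutelyContinuous).ae_le ?_
    filter_upwards [(quasiMeasurePreserving_timeMap hβ hn).ae Φ.tangent] with p hp
    exact smul_mem_tangentConeAt hp _

theorem act_reparam (κ : ℝ) (Φ : Flow Ω) (α β : ℝ) (hβ : β ≠ 0)
    (hm : ∀ᵐ p ∂Φ.m, α + β * (p.1 : ℝ) ∈ Icc (0 : ℝ) 1)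
    (hn : ∀ᵐ p ∂Φ.n, α + β * (p.1 : ℝ) ∈ Icc (0 : ℝ) 1) :
    (Φ.reparam α β hβ hm hn).act κ = ENNReal.ofReal |β|⁻¹ * Φ.act κ := by
  have mv := (Φ.reparam α β hβ hm hn).measurable_v
  have mw := (Φ.reparam α β hβ hm hn).measurable_w
  have mh := (Φ.reparam α β hβ hm hn).measurable_h
  have e : ∀ x : ℝ, ENNReal.ofReal |β| * ENNReal.ofReal (β⁻¹ ^ 2 * x)
      = ENNReal.ofReal |β|⁻¹ * ENNReal.ofReal x := by
    intro x
    rw [← ENNReal.ofReal_mul (abs_nonneg β), ← ENNReal.ofReal_mul (by positivity)]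
    congr 1
    rw [inv_pow, ← sq_abs β]
    have := abs_pos.2 hβ
    field_simp
  have mv' := Φ.measurable_v
  have mw' := Φ.measurable_w
  have mh' := Φ.measurable_h
  rw [act, act, mul_add]
  congr 1
  · rw [← lintegral_const_mul _ (by fun_prop)]
    have M : Measurable fun p => ENNReal.ofReal (‖(Φ.reparam α β hβ hm hn).v p‖ ^ 2 / 2) := by
      fun_prop
    change ∫⁻ p, ENNReal.ofReal (‖(Φ.reparam α β hβ hm hn).v p‖ ^ 2 / 2)
      ∂(ENNReal.ofReal |β| • Φ.m.map (timeMap α β)) = _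
    rw [lintegral_smul_measure, lintegral_map (by fun_prop) (measurable_timeMap α β), smul_eq_mul,
      ← lintegral_const_mul _ ?_]
    · refine lintegral_congr_ae ?_
      filter_upwards [hm] with p hp
      rw [← e]
      congr 2
      simp only [reparam, timeMap_timeMap hβ hp, norm_smul, mul_pow, Real.norm_eq_abs, sq_abs]
      ring
    · exact M.comp (measurable_timeMap α β)
  · rw [← lintegral_const_mul _ (by fun_prop)]
    have M : Measurable fun p => ENNReal.ofReal ((‖(Φ.reparam α β hβ hm hn).w p‖ ^ 2 +
        κ ^ 2 * (Φ.reparam α β hβ hm hn).h p ^ 2) / 2) := by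
      fun_prop
    change ∫⁻ p, ENNReal.ofReal ((‖(Φ.reparam α β hβ hm hn).w p‖ ^ 2 +
      κ ^ 2 * (Φ.reparam α β hβ hm hn).h p ^ 2) / 2)
      ∂(ENNReal.ofReal |β| • Φ.n.map (timeMap α β)) = _
    rw [lintegral_smul_measure, lintegral_map (by fun_prop) (measurable_timeMap α β), smul_eq_mul,
      ← lintegral_const_mul _ ?_]
    · refine lintegral_congr_ae ?_
      filter_upwards [hn] with p hp
      rw [← e]
      congr 2
      simp only [reparam, timeMap_timeMap hβ hp, norm_smul, mul_pow, Real.norm_eq_abs, sq_abs]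
      ring
    · exact M.comp (measurable_timeMap α β)

theorem Joins.reparam_of_pos {Φ : Flow Ω} {a b : ℝ} {ρ ρ' : POplus Ω} (H : Φ.Joins a b ρ ρ')
    {α β : ℝ} (hβ : 0 < β)
    (hm : ∀ᵐ p ∂Φ.m, α + β * (p.1 : ℝ) ∈ Icc (0 : ℝ) 1)
    (hn : ∀ᵐ p ∂Φ.n, α + β * (p.1 : ℝ) ∈ Icc (0 : ℝ) 1) :
    (Φ.reparam α β hβ.ne' hm hn).Joins (α + β * a) (α + β * b) ρ ρ' := by
  constructor
  · intro φ hφ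
    have h := H.1.weak_timeMap hβ.ne' Φ.measurable_v Φ.measurable_h.neg hm hn hφ
    rw [abs_of_pos hβ, mul_inv_cancel₀ hβ.ne', one_mul] at h
    rw [← h]
    simp [Flow.reparam, abs_of_pos hβ]
  · intro φ hφ
    have h := H.2.weak_timeMap hβ.ne' Φ.measurable_w Φ.measurable_h hn hn hφ
    rw [abs_of_pos hβ, mul_inv_cancel₀ hβ.ne', one_mul] at h
    rw [← h]
    simp [Flow.reparam, abs_of_pos hβ]

theorem Joins.reparam_of_neg {Φ : Flow Ω} {a b : ℝ} {ρ ρ' : POplus Ω} (H : Φ.Joins a b ρ ρ')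
    {α β : ℝ} (hβ : β < 0)
    (hm : ∀ᵐ p ∂Φ.m, α + β * (p.1 : ℝ) ∈ Icc (0 : ℝ) 1)
    (hn : ∀ᵐ p ∂Φ.n, α + β * (p.1 : ℝ) ∈ Icc (0 : ℝ) 1) :
    (Φ.reparam α β hβ.ne hm hn).Joins (α + β * b) (α + β * a) ρ' ρ := by
  have e : |β| * β⁻¹ = -1 := by rw [abs_of_neg hβ]; field_simp [hβ.ne]
  constructor
  · intro φ hφ
    have h := H.1.weak_timeMap hβ.ne Φ.measurable_v Φ.measurable_h.neg hm hn hφ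
    rw [e, neg_one_mul, neg_sub] at h
    rw [← h]
    simp [Flow.reparam]
  · intro φ hφ
    have h := H.2.weak_timeMap hβ.ne Φ.measurable_w Φ.measurable_h hn hn hφ
    rw [e, neg_one_mul, neg_sub] at h
    rw [← h]
    simp [Flow.reparam]

/-- Restriction of a flow to a set of times. -/
def restrict (Φ : Flow Ω) (A : Set I) : Flow Ω where
  m := Φ.m.restrict (Prod.fst ⁻¹' A)
  v := Φ.v
  n := Φ.n.restrict (Prod.fst ⁻¹' A)
  w := Φ.w
  h := Φ.h
  finite_m := inferInstance
  finite_n := inferInstance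
  measurable_v := Φ.measurable_v
  measurable_w := Φ.measurable_w
  measurable_h := Φ.measurable_h
  integrable_v := Φ.integrable_v.restrict
  integrable_w := Φ.integrable_w.restrict
  integrable_h := Φ.integrable_h.restrict
  tangent := ae_restrict_of_ae Φ.tangent

/-- Juxtaposition of a flow carried by the set `A` of times and a flow carried by its
complement. -/
def glue (A : Set I) (hA : MeasurableSet A) (Φ Ψ : Flow Ω)
    (hΦm : ∀ᵐ p ∂Φ.m, p.1 ∈ A) (hΦn : ∀ᵐ p ∂Φ.n, p.1 ∈ A)
    (hΨm : ∀ᵐ p ∂Ψ.m, p.1 ∉ A) (hΨn : ∀ᵐ p ∂Ψ.n, p.1 ∉ A) : Flow Ω :=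
  open Classical in
  have hAm : MeasurableSet {p : QInt Ω | p.1 ∈ A} := measurable_fst hA
  have hAn : MeasurableSet {p : QBdry Ω | p.1 ∈ A} := measurable_fst hA
  { m := Φ.m + Ψ.m
    v := fun p => if p.1 ∈ A then Φ.v p else Ψ.v p
    n := Φ.n + Ψ.n
    w := fun p => if p.1 ∈ A then Φ.w p else Ψ.w p
    h := fun p => if p.1 ∈ A then Φ.h p else Ψ.h p
    finite_m := inferInstance
    finite_n := inferInstance
    measurable_v := Measurable.ite hAm Φ.measurable_v Ψ.measurable_v
    measurable_w := Measurable.ite hAn Φ.measurable_w Ψ.measurable_w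
    measurable_h := Measurable.ite hAn Φ.measurable_h Ψ.measurable_h
    integrable_v :=
      (Φ.integrable_v.congr (hΦm.mono fun p hp => by simp [hp])).add_measure
        (Ψ.integrable_v.congr (hΨm.mono fun p hp => by simp [hp]))
    integrable_w :=
      (Φ.integrable_w.congr (hΦn.mono fun p hp => by simp [hp])).add_measure
        (Ψ.integrable_w.congr (hΨn.mono fun p hp => by simp [hp]))
    integrable_h :=
      (Φ.integrable_h.congr (hΦn.mono fun p hp => by simp [hp])).add_measure
        (Ψ.integrable_h.congr (hΨn.mono fun p hp => by simp [hp]))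
    tangent := by
      refine ae_add_measure_iff.2 ⟨?_, ?_⟩
      · filter_upwards [Φ.tangent, hΦn] with p hp hA
        simpa [hA] using hp
      · filter_upwards [Ψ.tangent, hΨn] with p hp hA
        simpa [hA] using hp }

section Glue

variable {A : Set I} {hA : MeasurableSet A} {Φ Ψ : Flow Ω}
  {hΦm : ∀ᵐ p ∂Φ.m, p.1 ∈ A} {hΦn : ∀ᵐ p ∂Φ.n, p.1 ∈ A}
  {hΨm : ∀ᵐ p ∂Ψ.m, p.1 ∉ A} {hΨn : ∀ᵐ p ∂Ψ.n, p.1 ∉ A}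

theorem act_glue (κ : ℝ) : (glue A hA Φ Ψ hΦm hΦn hΨm hΨn).act κ = Φ.act κ + Ψ.act κ := by
  simp only [act, glue]
  rw [lintegral_add_measure, lintegral_add_measure, add_add_add_comm]
  congr 2
  · exact lintegral_congr_ae (hΦm.mono fun p hp => by simp [hp])
  · exact lintegral_congr_ae (hΦn.mono fun p hp => by simp [hp])
  · exact lintegral_congr_ae (hΨm.mono fun p hp => by simp [hp])
  · exact lintegral_congr_ae (hΨn.mono fun p hp => by simp [hp])

theorem Joins.glue (hΩ : Bornology.IsBounded Ω) {a b c : ℝ} {ρ ρ' ρ'' : POplus Ω}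
    (H : Φ.Joins a b ρ ρ') (H' : Ψ.Joins b c ρ' ρ'') :
    (Flow.glue A hA Φ Ψ hΦm hΦn hΨm hΨn).Joins a c ρ ρ'' := by
  have hcl : IsCompact (closure Ω) := hΩ.isCompact_closure
  have hfr : IsCompact (frontier Ω) := hcl.of_isClosed_subset isClosed_frontier
    frontier_subset_closure
  refine ⟨H.1.glue hcl hfr H'.1 Φ.integrable_v Ψ.integrable_v Φ.integrable_h.neg
    Ψ.integrable_h.neg ?_ ?_ ?_ ?_, H.2.glue hfr hfr H'.2 Φ.integrable_w Ψ.integrable_w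
    Φ.integrable_h Ψ.integrable_h ?_ ?_ ?_ ?_⟩
  · exact hΦm.mono fun p hp => by simp [Flow.glue, hp]
  · exact hΨm.mono fun p hp => by simp [Flow.glue, hp]
  · exact hΦn.mono fun p hp => by simp [Flow.glue, hp]
  · exact hΨn.mono fun p hp => by simp [Flow.glue, hp]
  · exact hΦn.mono fun p hp => by simp [Flow.glue, hp]
  · exact hΨn.mono fun p hp => by simp [Flow.glue, hp]
  · exact hΦn.mono fun p hp => by simp [Flow.glue, hp]
  · exact hΨn.mono fun p hp => by simp [Flow.glue, hp]

end Glue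

end Flow

/-! ### Time marginals -/

theorem compact_closure_frontier {Ω : Set (Vec d)} (hΩ : Bornology.IsBounded Ω) :
    IsCompact (closure Ω) ∧ IsCompact (frontier Ω) :=
  ⟨hΩ.isCompact_closure, hΩ.isCompact_closure.of_isClosed_subset isClosed_frontier
    frontier_subset_closure⟩

namespace Flow

variable {Ω : Set (Vec d)} {κ : ℝ} {ρ ρ' ρ₀ ρ₁ ρ₂ : POplus Ω}

/-- Testing with functions of time only shows that mass is conserved: the time marginal of
`m + n` is the Lebesgue measure. -/
theorem Joins.marginal (hΩ : Bornology.IsBounded Ω) {Φ : Flow Ω} (H : Φ.Joins 0 1 ρ ρ') :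
    Φ.m.map Prod.fst + Φ.n.map Prod.fst = (volume : Measure I) := by
  obtain ⟨hcl, hfr⟩ := compact_closure_frontier hΩ
  refine ext_of_forall_integral_eq_of_IsFiniteMeasure fun f => ?_
  set η : ℝ → ℝ := IccExtend zero_le_one f with hη
  have hηc : Continuous η := f.continuous.Icc_extend'
  have hηI : ∀ t : I, η t = f t := fun t => IccExtend_val _ _ t
  set N : ℝ → ℝ := fun t => ∫ s in (0 : ℝ)..t, η s with hNdef
  have hN : ∀ t, HasDerivAt N (η t) t := fun t => hηc.integral_hasStrictDerivAt 0 t |>.hasDerivAt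
  have hNc : Continuous N := continuous_iff_continuousAt.2 fun t => (hN t).continuousAt
  have hc : ContDiff ℝ 1 fun q : ℝ × Vec d => N q.1 * 1 :=
    contDiff_time_mul hN hηc contDiff_const
  have hadv : ∀ (u : Vec d) q, adv (fun q : ℝ × Vec d => N q.1 * 1) u q = η q.1 := by
    intro u q
    rw [adv_time_mul hN contDiff_const]
    simp [adv, dt, dx]
  have h1 := H.1 _ hc
  have h2 := H.2 _ hc
  have hN0 : N 0 = 0 := by simp [hNdef]
  have hN1 : N 1 = ∫ t : I, f t := by
    change ∫ s in (0 : ℝ)..1, η s = _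
    rw [← integral_unitInterval]
    exact integral_congr_ae (ae_of_all _ hηI)
  simp only [hadv] at h1 h2
  simp only [mul_one, hN0, integral_zero, sub_zero, integral_const, smul_eq_mul,
    Pi.neg_apply, mul_neg, integral_neg] at h1 h2
  have hi : ∀ {S : Set (Vec d)} (μ : Measure (I × S)) [IsFiniteMeasure μ],
      Integrable f (μ.map Prod.fst) := fun μ _ => f.integrable _
  rw [integral_add_measure (hi _) (hi _), integral_map measurable_fst.aemeasurable
    f.continuous.aestronglyMeasurable, integral_map measurable_fst.aemeasurable
    f.continuous.aestronglyMeasurable]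
  simp only [toAmbient, hηI] at h1 h2
  rw [← hN1]
  linear_combination h1 + h2 + N 1 * ρ'.mass

theorem Joins.map_fst_ac (hΩ : Bornology.IsBounded Ω) {Φ : Flow Ω} (H : Φ.Joins 0 1 ρ ρ') :
    Φ.m.map Prod.fst ≪ (volume : Measure I) ∧ Φ.n.map Prod.fst ≪ (volume : Measure I) := by
  rw [← H.marginal hΩ]
  exact ⟨(Measure.le_add_right le_rfl).absolutelyContinuous,
    (Measure.le_add_left le_rfl).absolutelyContinuous⟩

theorem ae_fst_ne {S : Set (Vec d)} {m : Measure (I × S)}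
    (hm : m.map Prod.fst ≪ (volume : Measure I)) (t : I) : ∀ᵐ p ∂m, p.1 ≠ t := by
  have h : ∀ᵐ s ∂(m.map Prod.fst), s ≠ t := hm.ae_le (Measure.ae_ne volume t)
  exact ae_of_ae_map measurable_fst.aemeasurable h

/-! ### Symmetry and concatenation -/

theorem exists_of_WSq_lt (hΩ : Bornology.IsBounded Ω) {c : ℝ≥0∞} (h : WSq κ ρ ρ' < c) :
    ∃ Φ : Flow Ω, Φ.Joins 0 1 ρ ρ' ∧ Φ.act κ < c := by
  obtain ⟨μ, hμ⟩ := iInf_lt_iff.1 h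
  obtain ⟨hCE, hμ⟩ := iInf_lt_iff.1 hμ
  obtain ⟨Φ, hΦ, ha, -⟩ := exists_of_action_lt_top hΩ hCE (hμ.trans_le le_top)
  exact ⟨Φ, hΦ, ha ▸ hμ⟩

theorem WSq_symm_le (hΩ : Bornology.IsBounded Ω) : WSq κ ρ' ρ ≤ WSq κ ρ ρ' := by
  refine le_of_forall_gt fun c hc => ?_
  obtain ⟨Φ, hΦ, ha⟩ := exists_of_WSq_lt hΩ hc
  have hI : ∀ {S : Set (Vec d)} (p : I × S), 1 + (-1) * (p.1 : ℝ) ∈ Icc (0 : ℝ) 1 := fun p =>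
    ⟨by linarith [p.1.2.2], by linarith [p.1.2.1]⟩
  have hJ := hΦ.reparam_of_neg (α := 1) (β := -1) (by norm_num) (ae_of_all _ hI) (ae_of_all _ hI)
  norm_num at hJ
  refine (WSq_le_act hΩ hJ).trans_lt ?_
  rw [act_reparam]
  simpa using ha

theorem WSq_symm (hΩ : Bornology.IsBounded Ω) : WSq κ ρ' ρ = WSq κ ρ ρ' :=
  le_antisymm (WSq_symm_le hΩ) (WSq_symm_le hΩ)

theorem ae_reparam {S : Set (Vec d)} {m : Measure (I × S)} {α β : ℝ} {P : ℝ → Prop}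
    (hP : MeasurableSet {t | P t}) (hm : ∀ᵐ p ∂m, α + β * (p.1 : ℝ) ∈ Icc (0 : ℝ) 1)
    (h : ∀ᵐ p ∂m, P (α + β * (p.1 : ℝ))) :
    ∀ᵐ p ∂(ENNReal.ofReal |β| • m.map (timeMap α β)), P (p.1 : ℝ) := by
  refine Measure.smul_absolutelyContinuous.ae_le ?_
  refine (ae_map_iff (measurable_timeMap α β).aemeasurable ?_).2 ?_
  · exact (measurable_subtype_coe.comp measurable_fst) hP
  · filter_upwards [hm, h] with p hp h
    simpa [timeMap, projIcc_of_mem _ hp] using h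

/-- Concatenation of two flows, the first one run on `[0, θ]` and the second one on `[θ, 1]`. -/
theorem WSq_le_of_joins (hΩ : Bornology.IsBounded Ω) {Φ Ψ : Flow Ω} (hΦ : Φ.Joins 0 1 ρ₀ ρ₁)
    (hΨ : Ψ.Joins 0 1 ρ₁ ρ₂) {θ : ℝ} (h0 : 0 < θ) (h1 : θ < 1) :
    WSq κ ρ₀ ρ₂ ≤ ENNReal.ofReal θ⁻¹ * Φ.act κ + ENNReal.ofReal (1 - θ)⁻¹ * Ψ.act κ := by
  have hI : ∀ {S : Set (Vec d)} (p : I × S), 0 + θ * (p.1 : ℝ) ∈ Icc (0 : ℝ) 1 := fun p =>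
    ⟨by have := p.1.2.1; positivity, by nlinarith [p.1.2.1, p.1.2.2]⟩
  have hI' : ∀ {S : Set (Vec d)} (p : I × S), θ + (1 - θ) * (p.1 : ℝ) ∈ Icc (0 : ℝ) 1 := fun p =>
    ⟨by nlinarith [p.1.2.1, p.1.2.2], by nlinarith [p.1.2.1, p.1.2.2]⟩
  have hθ : 0 < 1 - θ := by linarith
  have J := hΦ.reparam_of_pos h0 (ae_of_all _ hI) (ae_of_all _ hI)
  have J' := hΨ.reparam_of_pos hθ (ae_of_all _ hI') (ae_of_all _ hI')
  have e1 : 0 + θ * 0 = 0 := by ring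
  have e2 : 0 + θ * 1 = θ := by ring
  have e3 : θ + (1 - θ) * 0 = θ := by ring
  have e4 : θ + (1 - θ) * 1 = 1 := by ring
  rw [e1, e2] at J
  rw [e3, e4] at J'
  have hA : MeasurableSet {t : I | (t : ℝ) < θ} :=
    measurableSet_lt measurable_subtype_coe measurable_const
  have hlt : ∀ {S : Set (Vec d)} {m : Measure (I × S)}, m.map Prod.fst ≪ (volume : Measure I) →
      ∀ᵐ p ∂m, 0 + θ * (p.1 : ℝ) < θ := by
    intro S m hm
    filter_upwards [ae_fst_ne hm 1] with p hp
    have : (p.1 : ℝ) < 1 := lt_of_le_of_ne p.1.2.2 fun h => hp (Subtype.ext h)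
    nlinarith
  have hge : ∀ {S : Set (Vec d)} {m : Measure (I × S)},
      ∀ᵐ p ∂m, ¬ θ + (1 - θ) * (p.1 : ℝ) < θ :=
    ae_of_all _ fun p => by nlinarith [p.1.2.1]
  have hP : MeasurableSet {t : ℝ | t < θ} := measurableSet_Iio
  obtain ⟨ac1, ac2⟩ := hΦ.map_fst_ac hΩ
  set Φ' := Φ.reparam 0 θ h0.ne' (ae_of_all _ hI) (ae_of_all _ hI) with hΦ'
  set Ψ' := Ψ.reparam θ (1 - θ) hθ.ne' (ae_of_all _ hI') (ae_of_all _ hI') with hΨ'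
  have a1 : ∀ᵐ p ∂Φ'.m, p.1 ∈ {t : I | (t : ℝ) < θ} :=
    ae_reparam hP (ae_of_all _ hI) (hlt ac1)
  have a2 : ∀ᵐ p ∂Φ'.n, p.1 ∈ {t : I | (t : ℝ) < θ} :=
    ae_reparam hP (ae_of_all _ hI) (hlt ac2)
  have a3 : ∀ᵐ p ∂Ψ'.m, p.1 ∉ {t : I | (t : ℝ) < θ} :=
    ae_reparam hP.compl (ae_of_all _ hI') hge
  have a4 : ∀ᵐ p ∂Ψ'.n, p.1 ∉ {t : I | (t : ℝ) < θ} :=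
    ae_reparam hP.compl (ae_of_all _ hI') hge
  have G := J.glue (hA := hA) (hΦm := a1) (hΦn := a2) (hΨm := a3) (hΨn := a4) hΩ J'
  refine (WSq_le_act hΩ G).trans_eq ?_
  rw [act_glue, hΦ', hΨ', act_reparam, act_reparam, abs_of_pos h0, abs_of_pos hθ]

theorem WSq_trans_lt_top (hΩ : Bornology.IsBounded Ω) (h : WSq κ ρ₀ ρ₁ < ⊤)
    (h' : WSq κ ρ₁ ρ₂ < ⊤) : WSq κ ρ₀ ρ₂ < ⊤ := by
  obtain ⟨Φ, hΦ, ha⟩ := exists_of_WSq_lt hΩ h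
  obtain ⟨Ψ, hΨ, ha'⟩ := exists_of_WSq_lt hΩ h'
  refine (WSq_le_of_joins hΩ hΦ hΨ (θ := 1 / 2) (by norm_num) (by norm_num)).trans_lt ?_
  exact ENNReal.add_lt_top.2 ⟨ENNReal.mul_lt_top ENNReal.ofReal_lt_top ha,
    ENNReal.mul_lt_top ENNReal.ofReal_lt_top ha'⟩

/-- The triangle inequality. The optimal switching time of two concatenated flows divides
`[0, 1]` in proportion to the two distances. -/
theorem sqrt_WSq_triangle (hΩ : Bornology.IsBounded Ω) (h : WSq κ ρ₀ ρ₁ < ⊤)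
    (h' : WSq κ ρ₁ ρ₂ < ⊤) :
    √(WSq κ ρ₀ ρ₂).toReal ≤ √(WSq κ ρ₀ ρ₁).toReal + √(WSq κ ρ₁ ρ₂).toReal := by
  set x := (WSq κ ρ₀ ρ₁).toReal
  set y := (WSq κ ρ₁ ρ₂).toReal
  have hx : 0 ≤ x := ENNReal.toReal_nonneg
  have hy : 0 ≤ y := ENNReal.toReal_nonneg
  have key : ∀ ε > 0, √(WSq κ ρ₀ ρ₂).toReal ≤ √(x + ε) + √(y + ε) := by
    intro ε hε
    have l1 : WSq κ ρ₀ ρ₁ < ENNReal.ofReal (x + ε) := by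
      rw [ENNReal.lt_ofReal_iff_toReal_lt h.ne]; linarith
    have l2 : WSq κ ρ₁ ρ₂ < ENNReal.ofReal (y + ε) := by
      rw [ENNReal.lt_ofReal_iff_toReal_lt h'.ne]; linarith
    obtain ⟨Φ, hΦ, ha⟩ := exists_of_WSq_lt hΩ l1
    obtain ⟨Ψ, hΨ, ha'⟩ := exists_of_WSq_lt hΩ l2
    set r := √(x + ε) with hr
    set s := √(y + ε) with hs
    have r0 : 0 < r := Real.sqrt_pos.2 (by linarith)
    have s0 : 0 < s := Real.sqrt_pos.2 (by linarith)
    have hθ : 1 - r / (r + s) = s / (r + s) := by field_simp; ring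
    have := WSq_le_of_joins hΩ hΦ hΨ (κ := κ) (θ := r / (r + s)) (by positivity)
      ((div_lt_one (by positivity)).2 (by linarith))
    have h2 : WSq κ ρ₀ ρ₂ ≤ ENNReal.ofReal ((r + s) ^ 2) := by
      calc _ ≤ _ := this
        _ ≤ ENNReal.ofReal (r / (r + s))⁻¹ * ENNReal.ofReal (r ^ 2)
            + ENNReal.ofReal (s / (r + s))⁻¹ * ENNReal.ofReal (s ^ 2) := by
          rw [hθ, hr, hs, Real.sq_sqrt (by linarith), Real.sq_sqrt (by linarith)]
          gcongr
        _ = ENNReal.ofReal ((r + s) ^ 2) := by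
          rw [← ENNReal.ofReal_mul (by positivity), ← ENNReal.ofReal_mul (by positivity),
            ← ENNReal.ofReal_add (by positivity) (by positivity)]
          congr 1; field_simp
    exact Real.sqrt_le_iff.2 ⟨by positivity, ENNReal.toReal_le_of_le_ofReal (by positivity) h2⟩
  have hc : Continuous fun ε : ℝ => √(x + ε) + √(y + ε) := by fun_prop
  have ht : Filter.Tendsto (fun ε : ℝ => √(x + ε) + √(y + ε)) (𝓝[>] 0) (𝓝 (√x + √y)) := by
    have := (hc.tendsto 0).mono_left (nhdsWithin_le_nhds (s := Ioi 0))
    simpa using this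
  exact ge_of_tendsto ht (Filter.eventually_of_mem self_mem_nhdsWithin key)

end Flow

/-! ### Localization in time -/

section CumulativeIntegral

variable {X : Type*} [MeasurableSpace X] {P : Measure (I × X)} {k : I × X → ℝ}

theorem measurableSet_fst_le (s : I) : MeasurableSet {p : I × X | p.1 ≤ s} :=
  measurableSet_le measurable_fst measurable_const

theorem continuous_cumulative (hP : P.map Prod.fst ≪ (volume : Measure I))
    (hk : Integrable k P) : Continuous fun s : I => ∫ p in {p | p.1 ≤ s}, k p ∂P := by
  refine continuous_iff_continuousAt.2 fun s₀ => ?_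
  simp only [← integral_indicator (measurableSet_fst_le _)]
  have hne : ∀ᵐ p ∂P, p.1 ≠ s₀ :=
    ae_of_ae_map measurable_fst.aemeasurable (hP.ae_le (Measure.ae_ne volume s₀))
  refine continuousAt_of_dominated (bound := fun p => ‖k p‖) ?_ ?_ hk.norm ?_
  · exact Filter.Eventually.of_forall fun s => (hk.indicator (measurableSet_fst_le s)).1
  · exact Filter.Eventually.of_forall fun s => ae_of_all _ fun p => norm_indicator_le_norm_self _ _
  · filter_upwards [hne] with p hp
    rcases lt_or_gt_of_ne hp with h | h
    · refine (continuousAt_const (y := k p)).congr ?_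
      filter_upwards [Ioi_mem_nhds h] with s hs
      rw [indicator_of_mem]
      exact le_of_lt (mem_Ioi.1 hs)
    · refine (continuousAt_const (y := (0 : ℝ))).congr ?_
      filter_upwards [Iio_mem_nhds h] with s hs
      rw [indicator_of_notMem]
      exact not_le.2 (mem_Iio.1 hs)

/-- Integration by parts in time, in the form of Fubini's theorem. -/
theorem integral_primitive_mul [SFinite P] (hk : Integrable k P) {η : ℝ → ℝ}
    (hη : Continuous η) :
    ∫ p, (∫ s in (1 : ℝ)..p.1, η s) * k p ∂P
      = -∫ s : I, η s * ∫ p in {p | p.1 ≤ s}, k p ∂P := by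
  have hηi : Integrable (fun s : I => η s) volume :=
    (hη.comp continuous_subtype_val).integrable_of_hasCompactSupport
      (HasCompactSupport.of_compactSpace _)
  have hset : MeasurableSet {q : (I × X) × I | q.1.1 ≤ q.2} :=
    measurableSet_le measurable_fst.fst measurable_snd
  have h1 : ∀ p : I × X, (∫ s in (1 : ℝ)..p.1, η s) * k p
      = -∫ s : I, {q : (I × X) × I | q.1.1 ≤ q.2}.indicator (fun q => k q.1 * η q.2) (p, s) := by
    intro p
    have e : ∀ s : I, {q : (I × X) × I | q.1.1 ≤ q.2}.indicator (fun q => k q.1 * η q.2) (p, s)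
        = k p * (Ici (p.1 : ℝ)).indicator η s := by
      intro s
      by_cases h : p.1 ≤ s
      · simp [indicator, h]
      · simp [indicator, h]
    simp only [e]
    rw [integral_const_mul, integral_unitInterval, intervalIntegral.integral_of_le zero_le_one,
      setIntegral_indicator measurableSet_Ici, intervalIntegral.integral_symm,
      intervalIntegral.integral_of_le p.1.2.2]
    have : ∫ s in Ioc (0 : ℝ) 1 ∩ Ici (p.1 : ℝ), η s = ∫ s in Ioc (p.1 : ℝ) 1, η s := by
      refine setIntegral_congr_set ?_
      have : (Ioc (0 : ℝ) 1 ∩ Ici (p.1 : ℝ) : Set ℝ) =ᵐ[volume]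
          (Ioc (0 : ℝ) 1 ∩ Ioi (p.1 : ℝ) : Set ℝ) :=
        ae_eq_set_inter (Filter.EventuallyEq.refl _ _) Ioi_ae_eq_Ici.symm
      rwa [Ioc_inter_Ioi, sup_eq_right.2 p.1.2.1] at this
    rw [this]
    ring
  have hint : Integrable ({q : (I × X) × I | q.1.1 ≤ q.2}.indicator fun q => k q.1 * η q.2)
      (P.prod volume) := (hk.mul_prod hηi).indicator hset
  simp only [h1]
  rw [integral_neg, integral_integral_swap (f := fun p s =>
    {q : (I × X) × I | q.1.1 ≤ q.2}.indicator (fun q => k q.1 * η q.2) (p, s)) hint]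
  congr 1
  refine integral_congr_ae (ae_of_all _ fun s => ?_)
  simp only
  rw [← integral_indicator (measurableSet_fst_le s), ← integral_const_mul]
  refine integral_congr_ae (ae_of_all _ fun p => ?_)
  by_cases h : p.1 ≤ s
  · simp [indicator, h, mul_comm]
  · simp [indicator, h]

end CumulativeIntegral

section Localization

variable {S B : Set (Vec d)} {α β : Measure S} {m : Measure (I × S)} {v : I × S → Vec d}
  {n : Measure (I × B)} {h : I × B → ℝ}

/-- The value at time `s` of the integral of `φ` along a solution of the continuity equation, as
predicted by the initial datum, the flux and the source up to time `s`. -/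
def pairing (α : Measure S) (m : Measure (I × S)) (v : I × S → Vec d) (n : Measure (I × B))
    (h : I × B → ℝ) (φ : ℝ × Vec d → ℝ) (s : I) : ℝ :=
  (∫ x, φ (0, x) ∂α) + (∫ p in {p | p.1 ≤ s}, adv φ (v p) (toAmbient p) ∂m)
    + ∫ p in {p | p.1 ≤ s}, φ (toAmbient p) * h p ∂n

theorem continuous_pairing (hS : IsCompact S) (hB : IsCompact B) [IsFiniteMeasure m]
    (hv : Integrable v m) (hh : Integrable h n)
    (hm : m.map Prod.fst ≪ (volume : Measure I)) (hn : n.map Prod.fst ≪ (volume : Measure I))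
    {φ : ℝ × Vec d → ℝ} (hφ : ContDiff ℝ 1 φ) : Continuous (pairing α m v n h φ) :=
  (continuous_const.add (continuous_cumulative hm (integrable_adv hS hφ hv))).add
    (continuous_cumulative hn (integrable_test_mul hB hφ.continuous hh))

/-- Testing the continuity equation with `N(t) φ(t, x)`, where `N' = η` and `N(1) = 0`,
identifies the pairing of `φ` with almost every time slice of `m`. -/
theorem ContEq.integral_time_mul (hS : IsCompact S) (hB : IsCompact B) [IsFiniteMeasure m]
    [IsFiniteMeasure n] (hv : Integrable v m) (hh : Integrable h n)
    (hm : m.map Prod.fst ≪ (volume : Measure I)) (hn : n.map Prod.fst ≪ (volume : Measure I))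
    (H : ContEq 0 1 α β m v n h) {φ : ℝ × Vec d → ℝ} (hφ : ContDiff ℝ 1 φ) {η : ℝ → ℝ}
    (hη : Continuous η) :
    ∫ p, η p.1 * φ (toAmbient p) ∂m = ∫ s : I, η s * pairing α m v n h φ s := by
  set N : ℝ → ℝ := fun t => ∫ s in (1 : ℝ)..t, η s with hNdef
  have hN : ∀ t, HasDerivAt N (η t) t := fun t => (hη.integral_hasStrictDerivAt 1 t).hasDerivAt
  have hNc : Continuous N := continuous_iff_continuousAt.2 fun t => (hN t).continuousAt
  have h1 := H _ (contDiff_time_mul hN hη hφ)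
  have hN1 : N 1 = 0 := by simp [hNdef]
  have hN0 : N 0 = -∫ s : I, η s := by
    change ∫ s in (1 : ℝ)..0, η s = _
    rw [intervalIntegral.integral_symm, integral_unitInterval]
  have hi := integrable_adv hS hφ hv
  have hi' := integrable_test_mul hB hφ.continuous hh
  have hg : Integrable (fun p : I × S => η p.1 * φ (toAmbient p)) m :=
    integrable_test hS (g := fun q => η q.1 * φ q) (by fun_prop)
  have hNa : Integrable (fun p : I × S => N p.1 * adv φ (v p) (toAmbient p)) m :=
    integrable_test_mul hS (g := fun q => N q.1) (by fun_prop) hi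
  simp only [adv_time_mul hN hφ, hN1, zero_mul, integral_zero, hN0, zero_sub,
    mul_assoc] at h1
  rw [integral_const_mul] at h1
  have h2 : (∫ p : I × S, η (toAmbient p).1 * φ (toAmbient p)
      + N (toAmbient p).1 * adv φ (v p) (toAmbient p) ∂m) = (∫ p, η p.1 * φ (toAmbient p) ∂m)
      - ∫ s : I, η s * ∫ p in {p | p.1 ≤ s}, adv φ (v p) (toAmbient p) ∂m := by
    rw [sub_eq_add_neg, ← integral_primitive_mul hi hη]
    exact integral_add hg hNa
  have h3 : (∫ p : I × B, N (toAmbient p).1 * (φ (toAmbient p) * h p) ∂n)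
      = -∫ s : I, η s * ∫ p in {p | p.1 ≤ s}, φ (toAmbient p) * h p ∂n :=
    integral_primitive_mul hi' hη
  rw [h2, h3] at h1
  have ci : ∀ {g : I → ℝ}, Continuous g → Integrable (fun s : I => η s * g s) volume :=
    fun hg => ((hη.comp continuous_subtype_val).mul hg).integrable_of_hasCompactSupport
      (HasCompactSupport.of_compactSpace _)
  have c1 := ci (g := fun _ => ∫ x, φ (0, x) ∂α) continuous_const
  have c2 := ci (continuous_cumulative hm hi)
  have c3 := ci (continuous_cumulative hn hi')
  simp only [pairing, mul_add]
  rw [integral_add (by exact c1.add c2) c3, integral_add c1 c2, integral_mul_const]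
  linear_combination h1

end Localization

instance isOpenPosMeasure_unitInterval : (volume : Measure I).IsOpenPosMeasure := by
  refine ⟨fun U hU hne h0 => ?_⟩
  obtain ⟨V, hV, rfl⟩ := isOpen_induced_iff.1 hU
  obtain ⟨x, hx⟩ := hne
  have hx' : (x : ℝ) ∈ closure (Ioo (0 : ℝ) 1) := by
    rw [closure_Ioo zero_ne_one]; exact x.2
  have hpos := (hV.inter isOpen_Ioo).measure_pos volume (mem_closure_iff.1 hx' V hV hx)
  refine (hpos.trans_le ?_).ne' h0
  rw [show (volume : Measure I) = Measure.comap Subtype.val volume from rfl,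
    comap_subtype_coe_apply measurableSet_Icc, Subtype.image_preimage_coe]
  exact measure_mono fun y hy => ⟨Ioo_subset_Icc_self hy.2, hy.1⟩

/-- A continuous function of time is nonnegative if its integrals against nonnegative continuous
functions are. -/
theorem nonneg_of_forall_integral_mul_nonneg {f : I → ℝ} (hf : Continuous f)
    (H : ∀ η : ℝ → ℝ, Continuous η → (∀ t, 0 ≤ η t) → 0 ≤ ∫ s : I, η s * f s) (s : I) :
    0 ≤ f s := by
  set g : I → ℝ := fun s => max (-f s) 0 with hg
  have hgc : Continuous g := by fun_prop
  have h := H (IccExtend zero_le_one g) hgc.Icc_extend' fun t => le_max_right _ _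
  simp only [IccExtend_val] at h
  have e : ∀ s, g s * f s = -(g s) ^ 2 := by
    intro s
    rcases le_total 0 (f s) with h | h
    · simp [hg, h]
    · simp only [hg, max_eq_left (neg_nonneg.2 h)]; ring
  simp only [e, integral_neg] at h
  have h0 : ∫ s, g s ^ 2 = 0 :=
    le_antisymm (by linarith) (integral_nonneg fun s => sq_nonneg _)
  have hi : Integrable (fun s => g s ^ 2) (volume : Measure I) :=
    (hgc.pow 2).integrable_of_hasCompactSupport (HasCompactSupport.of_compactSpace _)
  rw [integral_eq_zero_iff_of_nonneg (fun s => sq_nonneg _) hi] at h0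
  have h1 := (Continuous.ae_eq_iff_eq (volume : Measure I) (hgc.pow 2) continuous_const).1 h0
  have h2 : g s = 0 := pow_eq_zero_iff two_ne_zero |>.1 (congrFun h1 s)
  have h3 : -f s ≤ g s := le_max_left _ _
  linarith

/-- Two continuous functions of time with the same integrals against continuous functions are
equal. -/
theorem eq_of_forall_integral_mul_eq {f g : I → ℝ} (hf : Continuous f) (hg : Continuous g)
    (H : ∀ η : ℝ → ℝ, Continuous η → ∫ s : I, η s * f s = ∫ s : I, η s * g s) : f = g := by
  have ci : ∀ {η : ℝ → ℝ} {g : I → ℝ}, Continuous η → Continuous g →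
      Integrable (fun s : I => η s * g s) volume :=
    fun hη hg => ((hη.comp continuous_subtype_val).mul hg).integrable_of_hasCompactSupport
      (HasCompactSupport.of_compactSpace _)
  have key : ∀ {f g : I → ℝ}, Continuous f → Continuous g →
      (∀ η : ℝ → ℝ, Continuous η → ∫ s : I, η s * f s = ∫ s : I, η s * g s) →
      ∀ s, f s ≤ g s := by
    intro f g hf hg H s
    have : 0 ≤ g s - f s := nonneg_of_forall_integral_mul_nonneg (hg.sub hf) (fun η hη _ => by
      simp only [Pi.sub_apply, mul_sub]
      rw [integral_sub (ci hη hg) (ci hη hf), H η hη, sub_self]) s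
    linarith
  exact funext fun s => le_antisymm (key hf hg H s) (key hg hf (fun η hη => (H η hη).symm) s)

/-! ### Disintegration in time -/

section Slices

open scoped ProbabilityTheory BoundedContinuousFunction

variable {X : Type*} [MetricSpace X] [MeasurableSpace X] [BorelSpace X]

theorem measurable_of_continuous_finiteMeasure {ν : I → FiniteMeasure X} (hν : Continuous ν) :
    Measurable fun t => (ν t : Measure X) := by
  have hl : ∀ f : X →ᵇ NNReal, Continuous fun t => ∫⁻ x, f x ∂(ν t : Measure X) := fun f =>
    continuous_iff_continuousAt.2 fun t =>
      FiniteMeasure.tendsto_iff_forall_lintegral_tendsto.1 (hν.tendsto t) f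
  refine Measurable.measure_of_isPiSystem
    ((BorelSpace.measurable_eq (α := X)).trans borel_eq_generateFrom_isClosed)
    isPiSystem_isClosed (fun F hF => ?_) ?_
  · refine measurable_of_tendsto_metrizable (f := fun k t => ∫⁻ x, hF.apprSeq k x
      ∂(ν t : Measure X)) (fun k => (hl _).measurable) (tendsto_pi_nhds.2 fun t => ?_)
    exact HasOuterApproxClosed.tendsto_lintegral_apprSeq hF _
  · simpa using (hl 1).measurable

/-- A narrowly continuous curve of measures, as a transition kernel. -/
def sliceKernel (ν : I → FiniteMeasure X) (hν : Continuous ν) : ProbabilityTheory.Kernel I X :=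
  ⟨fun t => (ν t : Measure X), measurable_of_continuous_finiteMeasure hν⟩

instance isFiniteKernel_sliceKernel (ν : I → FiniteMeasure X) (hν : Continuous ν) :
    ProbabilityTheory.IsFiniteKernel (sliceKernel ν hν) := by
  obtain ⟨C, hC⟩ := isCompact_univ.bddAbove_image
    (FiniteMeasure.continuous_mass.comp hν).continuousOn
  refine ⟨⟨C, ENNReal.coe_lt_top, fun t => ?_⟩⟩
  have : (ν t).mass ≤ C := hC ⟨t, trivial, rfl⟩
  change (ν t : Measure X) univ ≤ C
  rw [← FiniteMeasure.ennreal_mass]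
  exact_mod_cast this

/-- The formula `m = ν_t dt` for a measure on `[0,1] × X`. -/
theorem eq_compProd_iff {ν : I → FiniteMeasure X} (hν : Continuous ν) {m : Measure (I × X)}
    [IsFiniteMeasure m] :
    m = (volume : Measure I) ⊗ₘ sliceKernel ν hν ↔ ∀ B : Set (I × X), MeasurableSet B →
      m.real B = ∫ t : I, (ν t : Measure X).real (Prod.mk t ⁻¹' B) := by
  have key : ∀ B : Set (I × X), MeasurableSet B →
      ((volume : Measure I) ⊗ₘ sliceKernel ν hν).real B
        = ∫ t : I, (ν t : Measure X).real (Prod.mk t ⁻¹' B) := by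
    intro B hB
    rw [measureReal_def, Measure.compProd_apply hB]
    refine (integral_toReal ?_ ?_).symm
    · exact (ProbabilityTheory.Kernel.measurable_kernel_prodMk_left hB).aemeasurable
    · exact ae_of_all _ fun t => measure_lt_top _ _
  constructor
  · rintro h B hB
    rw [← key B hB, ← h]
  · intro h
    refine Measure.ext fun B hB => ?_
    rw [← ENNReal.toReal_eq_toReal_iff' (measure_ne_top _ _) (measure_ne_top _ _)]
    exact (h B hB).trans (key B hB).symm

variable [CompactSpace X]

theorem integral_compProd_sliceKernel {ν : I → FiniteMeasure X} (hν : Continuous ν)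
    {g : I × X → ℝ} (hg : Continuous g) :
    ∫ p, g p ∂((volume : Measure I) ⊗ₘ sliceKernel ν hν)
      = ∫ t : I, ∫ x, g (t, x) ∂(ν t : Measure X) :=
  Measure.integral_compProd
    (hg.integrable_of_hasCompactSupport (HasCompactSupport.of_compactSpace _))

/-- A positive linear functional on `C(X)` is the integral with respect to a finite measure. -/
theorem exists_measure_of_nonneg (L : C(X, ℝ) →ₗ[ℝ] ℝ) (hL : ∀ g, 0 ≤ g → 0 ≤ L g) :
    ∃ ν : FiniteMeasure X, ∀ g : C(X, ℝ), ∫ x, g x ∂(ν : Measure X) = L g := by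
  let T : CompactlySupportedContinuousMap X ℝ →ₗ[ℝ] ℝ :=
    { toFun := fun f => L f.toContinuousMap
      map_add' := fun f g => L.map_add f.toContinuousMap g.toContinuousMap
      map_smul' := fun c f => L.map_smul c f.toContinuousMap }
  let Λ := PositiveLinearMap.mk₀ T fun f hf => hL f.toContinuousMap hf
  refine ⟨⟨RealRMK.rieszMeasure Λ, inferInstance⟩, fun g => ?_⟩
  exact RealRMK.integral_rieszMeasure Λ (CompactlySupportedContinuousMap.continuousMapEquiv g)

/-- The slices of a measure `m` on `[0,1] × X`: if the functions `t ↦ ∫ g dm_t` have continuous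
representatives for `g` in an algebra of continuous functions that separates points, then `m` has a
narrowly continuous disintegration. The slice at `t` extends the positive functional `g ↦ Λ g t`
by M. Riesz' theorem. -/
theorem exists_slices (A : Subalgebra ℝ C(X, ℝ)) (hA : A.SeparatesPoints) {m : Measure (I × X)}
    [IsFiniteMeasure m] (H : ∀ g ∈ A, ∃ Λ : I → ℝ, Continuous Λ ∧ ∀ η : ℝ → ℝ, Continuous η →
      ∫ p, η p.1 * g p.2 ∂m = ∫ s : I, η s * Λ s) :
    ∃ ν : I → FiniteMeasure X, Continuous ν ∧
      ∀ B : Set (I × X), MeasurableSet B →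
        m.real B = ∫ t : I, (ν t : Measure X).real (Prod.mk t ⁻¹' B) := by
  have hcl : ∀ g : C(X, ℝ), g ∈ closure (A : Set C(X, ℝ)) := by
    intro g
    have := ContinuousMap.subalgebra_topologicalClosure_eq_top_of_separatesPoints A hA
    rw [← Subalgebra.topologicalClosure_coe, this]
    trivial
  choose Λ hΛc hΛ using fun g : A => H g.1 g.2
  have hint : ∀ {η : ℝ → ℝ} (_ : Continuous η) (g : C(X, ℝ)),
      Integrable (fun p : I × X => η p.1 * g p.2) m := fun hη g =>
    Continuous.integrable_of_hasCompactSupport (by fun_prop) (HasCompactSupport.of_compactSpace _)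
  have hintI : ∀ {η : ℝ → ℝ} {f : I → ℝ}, Continuous η → Continuous f →
      Integrable (fun s : I => η s * f s) volume := fun hη hf =>
    Continuous.integrable_of_hasCompactSupport (by fun_prop) (HasCompactSupport.of_compactSpace _)
  -- `g ↦ Λ g s` is linear and positive on `A`, hence extends to a positive functional on `C(X)`
  have hadd : ∀ g g', Λ (g + g') = Λ g + Λ g' := by
    intro g g'
    refine eq_of_forall_integral_mul_eq (hΛc _) ((hΛc _).add (hΛc _)) fun η hη => ?_
    rw [← hΛ _ η hη]
    simp only [Pi.add_apply, mul_add, Subalgebra.coe_add, ContinuousMap.add_apply]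
    rw [integral_add (hint hη _) (hint hη _), integral_add (hintI hη (hΛc _))
      (hintI hη (hΛc _)), hΛ _ η hη, hΛ _ η hη]
  have hsmul : ∀ (c : ℝ) g, Λ (c • g) = c • Λ g := by
    intro c g
    refine eq_of_forall_integral_mul_eq (hΛc _) ((hΛc _).const_smul c) fun η hη => ?_
    rw [← hΛ _ η hη]
    simp only [Pi.smul_apply, smul_eq_mul, Subalgebra.coe_smul, ContinuousMap.smul_apply,
      mul_left_comm _ c]
    rw [integral_const_mul, integral_const_mul, hΛ _ η hη]
  have hnn : ∀ g : A, 0 ≤ (g : C(X, ℝ)) → ∀ s, 0 ≤ Λ g s := by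
    intro g hg
    refine nonneg_of_forall_integral_mul_nonneg (hΛc _) fun η hη h0 => ?_
    rw [← hΛ _ η hη]
    exact integral_nonneg fun p => mul_nonneg (h0 _) (hg p.2)
  have hext : ∀ s, ∃ L : C(X, ℝ) →ₗ[ℝ] ℝ, (∀ g : A, L g = Λ g s) ∧ ∀ g, 0 ≤ g → 0 ≤ L g := by
    intro s
    obtain ⟨L, h1, h2⟩ := riesz_extension (PointedCone.positive ℝ C(X, ℝ))
      { domain := Subalgebra.toSubmodule A
        toFun :=
          { toFun := fun g => Λ g s
            map_add' := fun g g' => congrFun (hadd g g') s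
            map_smul' := fun c g => congrFun (hsmul c g) s } }
      (fun g hg => hnn g ((PointedCone.mem_positive ℝ _).1 hg) s)
      (fun y => by
        refine ⟨⟨algebraMap ℝ C(X, ℝ) ‖y‖, A.algebraMap_mem _⟩, ?_⟩
        rw [PointedCone.mem_positive]
        intro x
        have := (abs_le.1 (y.norm_coe_le_norm x)).1
        change 0 ≤ ‖y‖ + y x
        linarith)
    exact ⟨L, h1, fun g hg => h2 g ((PointedCone.mem_positive ℝ _).2 hg)⟩
  choose L hLΛ hL0 using hext
  choose ν hν using fun s => exists_measure_of_nonneg (L s) (hL0 s)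
  have hνA : ∀ (g : A) s, ∫ x, (g : C(X, ℝ)) x ∂(ν s : Measure X) = Λ g s := fun g s => by
    rw [hν, hLΛ]
  obtain ⟨C, hC⟩ : ∃ C, ∀ s, (ν s : Measure X).real univ ≤ C := by
    obtain ⟨C, hC⟩ := isCompact_univ.bddAbove_image (hΛc 1).continuousOn
    refine ⟨C, fun s => ?_⟩
    have h1 := hνA 1 s
    have h2 : Λ 1 s ≤ C := hC ⟨s, trivial, rfl⟩
    rw [show ((1 : A) : C(X, ℝ)) = 1 from rfl] at h1
    simp only [ContinuousMap.one_apply, integral_const, smul_eq_mul, mul_one] at h1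
    linarith
  have hdist : ∀ (g g' : C(X, ℝ)) s, |∫ x, g x ∂(ν s : Measure X) - ∫ x, g' x ∂(ν s : Measure X)|
      ≤ C * dist g g' := by
    intro g g' s
    have hi : ∀ g : C(X, ℝ), Integrable g (ν s : Measure X) := fun g =>
      g.continuous.integrable_of_hasCompactSupport (HasCompactSupport.of_compactSpace _)
    rw [← integral_sub (hi _) (hi _), ← Real.norm_eq_abs]
    refine (norm_integral_le_of_norm_le_const (C := dist g g') (ae_of_all _ fun x => ?_)).trans ?_
    · rw [← dist_eq_norm]
      exact ContinuousMap.dist_apply_le_dist x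
    · rw [mul_comm]
      exact mul_le_mul_of_nonneg_right (hC s) dist_nonneg
  -- for `g` in the closure of `A`, the integrals against `ν s` are uniform limits of some `Λ g' s`
  have hνc : Continuous ν := by
    have hg : ∀ g : C(X, ℝ), Continuous fun s => ∫ x, g x ∂(ν s : Measure X) := by
      intro g
      refine continuous_of_uniform_approx_of_continuous fun u hu => ?_
      obtain ⟨ε, hε, hu⟩ := Metric.mem_uniformity_dist.1 hu
      have hC0 : 0 ≤ C := measureReal_nonneg.trans (hC 0)
      obtain ⟨g', hg', hd⟩ := Metric.mem_closure_iff.1 (hcl g) (ε / (C + 1)) (by positivity)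
      refine ⟨Λ ⟨g', hg'⟩, hΛc _, fun s => hu ?_⟩
      rw [← hνA ⟨g', hg'⟩ s, Real.dist_eq]
      refine (hdist _ _ _).trans_lt ?_
      rw [lt_div_iff₀ (by positivity)] at hd
      nlinarith [dist_nonneg (x := g) (y := g')]
    refine continuous_iff_continuousAt.2 fun s => ?_
    exact FiniteMeasure.tendsto_iff_forall_integral_tendsto.2 fun f =>
      (hg f.toContinuousMap).tendsto s
  refine ⟨ν, hνc, (eq_compProd_iff hνc).1 ?_⟩
  refine Measure.ext_of_integral_mul_boundedContinuousFunction fun f g => ?_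
  set η : ℝ → ℝ := IccExtend zero_le_one f with hη
  have hηc : Continuous η := f.continuous.Icc_extend'
  have hηI : ∀ t : I, η t = f t := fun t => IccExtend_val _ _ t
  have hcont : ∀ (μ : Measure (I × X)) [IsFiniteMeasure μ],
      Continuous fun g : C(X, ℝ) => ∫ p, f p.1 * g p.2 ∂μ := by
    intro μ _
    refine continuous_iff_continuousAt.2 fun g₀ => ?_
    refine continuousAt_of_dominated (bound := fun _ => ‖f‖ * (‖g₀‖ + 1)) ?_ ?_
      (integrable_const _) ?_
    · exact Filter.Eventually.of_forall fun g => Continuous.aestronglyMeasurable (by fun_prop)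
    · filter_upwards [Metric.ball_mem_nhds g₀ one_pos] with g hg
      refine ae_of_all _ fun p => ?_
      rw [norm_mul]
      refine mul_le_mul (f.norm_coe_le_norm _) ((g.norm_coe_le_norm _).trans ?_) (norm_nonneg _)
        (norm_nonneg _)
      rw [mem_ball_iff_norm] at hg
      have := norm_le_norm_add_norm_sub' g g₀
      linarith
    · exact ae_of_all _ fun p => (continuous_const.mul
        (continuous_eval_const p.2)).continuousAt
  have hclosed : IsClosed {g : C(X, ℝ) | ∫ p, f p.1 * g p.2 ∂m
      = ∫ p, f p.1 * g p.2 ∂((volume : Measure I) ⊗ₘ sliceKernel ν hνc)} :=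
    isClosed_eq (hcont _) (hcont _)
  have hsub : (A : Set C(X, ℝ)) ⊆ {g : C(X, ℝ) | ∫ p, f p.1 * g p.2 ∂m
      = ∫ p, f p.1 * g p.2 ∂((volume : Measure I) ⊗ₘ sliceKernel ν hνc)} := by
    intro g hg
    have h1 := hΛ ⟨g, hg⟩ η hηc
    simp only [hηI] at h1
    rw [mem_ofPred_eq, h1, integral_compProd_sliceKernel hνc (g := fun p => f p.1 * g p.2)
      (by fun_prop)]
    refine integral_congr_ae (ae_of_all _ fun s => ?_)
    simp only [integral_const_mul]
    rw [← hνA ⟨g, hg⟩ s]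
  exact closure_minimal hsub hclosed (hcl g.toContinuousMap)

end Slices

/-! ### Interpolants -/

/-- The algebra of restrictions to `S` of `C¹` functions on `ℝ^d`. -/
def testAlgebra (S : Set (Vec d)) : Subalgebra ℝ C(S, ℝ) where
  carrier := {g | ∃ φ : Vec d → ℝ, ContDiff ℝ 1 φ ∧ ∀ x, g x = φ x}
  mul_mem' := by
    rintro _ _ ⟨φ, hφ, e⟩ ⟨ψ, hψ, e'⟩
    exact ⟨fun x => φ x * ψ x, hφ.mul hψ, fun x => by simp [e, e']⟩
  add_mem' := by
    rintro _ _ ⟨φ, hφ, e⟩ ⟨ψ, hψ, e'⟩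
    exact ⟨fun x => φ x + ψ x, hφ.add hψ, fun x => by simp [e, e']⟩
  algebraMap_mem' c := ⟨fun _ => c, contDiff_const, fun _ => rfl⟩

theorem testAlgebra_separatesPoints (S : Set (Vec d)) : (testAlgebra S).SeparatesPoints := by
  intro x y hxy
  have : ∃ i, (x : Vec d) i ≠ (y : Vec d) i := by
    by_contra! h
    exact hxy (Subtype.ext (PiLp.ext h))
  obtain ⟨i, hi⟩ := this
  have hc : ContDiff ℝ 1 fun x : Vec d => x i := by fun_prop
  exact ⟨_, ⟨⟨fun x => (x : Vec d) i, by fun_prop⟩, ⟨_, hc, fun _ => rfl⟩, rfl⟩, hi⟩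

/-- Finite measures on a compact set are determined by their integrals against `C¹` functions. -/
theorem measure_eq_of_forall_contDiff {S : Set (Vec d)} (hS : IsCompact S) {α β : Measure S}
    [IsFiniteMeasure α] [IsFiniteMeasure β]
    (H : ∀ φ : Vec d → ℝ, ContDiff ℝ 1 φ → ∫ x, φ x ∂α = ∫ x, φ x ∂β) : α = β := by
  have : CompactSpace S := isCompact_iff_compactSpace.1 hS
  refine ext_of_forall_integral_eq_of_IsFiniteMeasure fun f => ?_
  have hcont : ∀ (μ : Measure S) [IsFiniteMeasure μ],
      Continuous fun g : C(S, ℝ) => ∫ x, g x ∂μ := by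
    intro μ _
    refine continuous_iff_continuousAt.2 fun g₀ => ?_
    refine continuousAt_of_dominated (bound := fun _ => ‖g₀‖ + 1) ?_ ?_ (integrable_const _) ?_
    · exact Filter.Eventually.of_forall fun g => g.continuous.aestronglyMeasurable
    · filter_upwards [Metric.ball_mem_nhds g₀ one_pos] with g hg
      refine ae_of_all _ fun p => (g.norm_coe_le_norm _).trans ?_
      rw [mem_ball_iff_norm] at hg
      have := norm_le_norm_add_norm_sub' g g₀
      linarith
    · exact ae_of_all _ fun p => (continuous_eval_const p).continuousAt
  have hcl : f.toContinuousMap ∈ closure (testAlgebra S : Set C(S, ℝ)) := by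
    have := ContinuousMap.subalgebra_topologicalClosure_eq_top_of_separatesPoints _
      (testAlgebra_separatesPoints S)
    rw [← Subalgebra.topologicalClosure_coe, this]
    trivial
  refine closure_minimal (s := (testAlgebra S : Set C(S, ℝ)))
    (t := {g | ∫ x, g x ∂α = ∫ x, g x ∂β}) ?_ (isClosed_eq (hcont _) (hcont _)) hcl
  rintro g ⟨φ, hφ, e⟩
  rw [mem_ofPred_eq]
  simp only [e]
  exact H φ hφ

/-- Integrals of a moving continuous function against a narrowly continuous curve. -/
theorem continuous_integral_slices {X : Type*} [MetricSpace X] [CompactSpace X]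
    [MeasurableSpace X] [BorelSpace X] {ν : I → FiniteMeasure X} (hν : Continuous ν)
    {g : I × X → ℝ} (hg : Continuous g) :
    Continuous fun t => ∫ x, g (t, x) ∂(ν t : Measure X) := by
  obtain ⟨C, hC⟩ : ∃ C, ∀ s, (ν s : Measure X).real univ ≤ C := by
    obtain ⟨C, hC⟩ := isCompact_univ.bddAbove_image
      (FiniteMeasure.continuous_mass.comp hν).continuousOn
    exact ⟨C, fun s => NNReal.coe_le_coe.2 (hC ⟨s, trivial, rfl⟩)⟩
  let G : C(I, C(X, ℝ)) := ContinuousMap.curry ⟨g, hg⟩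
  refine continuous_iff_continuousAt.2 fun t₀ => ?_
  have h1 : Filter.Tendsto (fun t => ∫ x, G t₀ x ∂(ν t : Measure X)) (𝓝 t₀)
      (𝓝 (∫ x, G t₀ x ∂(ν t₀ : Measure X))) :=
    FiniteMeasure.tendsto_iff_forall_integral_tendsto.1 (hν.tendsto t₀)
      (BoundedContinuousFunction.mkOfCompact (G t₀))
  have h2 : Filter.Tendsto (fun t => (∫ x, G t x ∂(ν t : Measure X))
      - ∫ x, G t₀ x ∂(ν t : Measure X)) (𝓝 t₀) (𝓝 0) := by
    have hz : Filter.Tendsto (fun t => dist (G t) (G t₀) * C) (𝓝 t₀) (𝓝 0) := by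
      have : Continuous fun t => dist (G t) (G t₀) * C := by fun_prop
      simpa using this.tendsto t₀
    refine squeeze_zero_norm (fun t => ?_) hz
    have hi : ∀ g : C(X, ℝ), Integrable g (ν t : Measure X) := fun g =>
      g.continuous.integrable_of_hasCompactSupport (HasCompactSupport.of_compactSpace _)
    rw [← integral_sub (hi _) (hi _)]
    refine (norm_integral_le_of_norm_le_const (C := dist (G t) (G t₀))
      (ae_of_all _ fun x => ?_)).trans (mul_le_mul_of_nonneg_left (hC t) dist_nonneg)
    rw [← dist_eq_norm]
    exact ContinuousMap.dist_apply_le_dist x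
  have h3 := h2.add h1
  simp only [sub_add_cancel, zero_add] at h3
  exact h3

section Slices

variable {S B : Set (Vec d)} {α β : Measure S} {m : Measure (I × S)} {v : I × S → Vec d}
  {n : Measure (I × B)} {h : I × B → ℝ}

/-- Along a solution of the continuity equation, the slices of any narrowly continuous
disintegration are given by the initial datum, the flux and the source. -/
theorem ContEq.integral_slice (hS : IsCompact S) (hB : IsCompact B) [IsFiniteMeasure m]
    [IsFiniteMeasure n] (hv : Integrable v m) (hh : Integrable h n)
    (hm : m.map Prod.fst ≪ (volume : Measure I)) (hn : n.map Prod.fst ≪ (volume : Measure I))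
    (H : ContEq 0 1 α β m v n h) {ν : I → FiniteMeasure S} (hν : Continuous ν)
    (hd : ∀ B : Set (I × S), MeasurableSet B →
      m.real B = ∫ t : I, (ν t : Measure S).real (Prod.mk t ⁻¹' B))
    {φ : ℝ × Vec d → ℝ} (hφ : ContDiff ℝ 1 φ) (s : I) :
    ∫ x, φ (s, x) ∂(ν s : Measure S) = pairing α m v n h φ s := by
  have : CompactSpace S := isCompact_iff_compactSpace.1 hS
  have hc : Continuous fun p : I × S => φ (toAmbient p) := hφ.continuous.comp continuous_toAmbient
  refine congrFun (eq_of_forall_integral_mul_eq (continuous_integral_slices hν hc)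
    (continuous_pairing hS hB hv hh hm hn hφ) fun η hη => ?_) s
  rw [← H.integral_time_mul hS hB hv hh hm hn hφ hη, (eq_compProd_iff hν).2 hd,
    integral_compProd_sliceKernel hν (g := fun p => η p.1 * φ (toAmbient p))
      ((by fun_prop : Continuous fun p : I × S => η p.1).mul hc)]
  simp only [integral_const_mul]

theorem ContEq.exists_slices (hS : IsCompact S) (hB : IsCompact B) [IsFiniteMeasure m]
    [IsFiniteMeasure n] (hv : Integrable v m) (hh : Integrable h n)
    (hm : m.map Prod.fst ≪ (volume : Measure I)) (hn : n.map Prod.fst ≪ (volume : Measure I))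
    (H : ContEq 0 1 α β m v n h) :
    ∃ ν : I → FiniteMeasure S, Continuous ν ∧ ∀ B : Set (I × S), MeasurableSet B →
      m.real B = ∫ t : I, (ν t : Measure S).real (Prod.mk t ⁻¹' B) := by
  have : CompactSpace S := isCompact_iff_compactSpace.1 hS
  refine RingRoad.exists_slices (testAlgebra S) (testAlgebra_separatesPoints S) ?_
  rintro g ⟨φ, hφ, e⟩
  have hφ' : ContDiff ℝ 1 fun q : ℝ × Vec d => φ q.2 := hφ.comp contDiff_snd
  refine ⟨_, continuous_pairing (α := α) hS hB hv hh hm hn hφ', fun η hη => ?_⟩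
  rw [← H.integral_time_mul hS hB hv hh hm hn hφ' hη]
  simp only [e, toAmbient]

theorem pairing_zero (hm : m.map Prod.fst ≪ (volume : Measure I))
    (hn : n.map Prod.fst ≪ (volume : Measure I)) (φ : ℝ × Vec d → ℝ) :
    pairing α m v n h φ 0 = ∫ x, φ (0, x) ∂α := by
  have hz : ∀ {X : Set (Vec d)} {P : Measure (I × X)}, P.map Prod.fst ≪ (volume : Measure I) →
      P.restrict {p | p.1 ≤ 0} = 0 := by
    intro X P hP
    rw [Measure.restrict_eq_zero]
    refine measure_mono_null (fun p hp => ?_) (ae_iff.1 (Flow.ae_fst_ne hP 0))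
    have : p.1 = 0 := le_antisymm hp p.1.2.1
    simp [this]
  simp only [pairing, hz hm, hz hn, integral_zero_measure, add_zero]

theorem ContEq.pairing_one (H : ContEq 0 1 α β m v n h) {φ : ℝ × Vec d → ℝ}
    (hφ : ContDiff ℝ 1 φ) : pairing α m v n h φ 1 = ∫ x, φ (1, x) ∂β := by
  have hu : ∀ {X : Set (Vec d)}, {p : I × X | p.1 ≤ 1} = univ := by
    intro X
    ext p
    simp only [mem_ofPred_eq, mem_univ, iff_true]
    exact p.1.2.2
  have := H φ hφ
  simp only [pairing, hu, Measure.restrict_univ]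
  linarith

/-- A solution of the continuity equation restricted to the times in `(s, t]` connects the slices
at `s` and `t`. -/
theorem contEq_restrict (hS : IsCompact S) (hB : IsCompact B) [IsFiniteMeasure m]
    (hv : Integrable v m) (hh : Integrable h n) {ν : I → FiniteMeasure S}
    (hp : ∀ (φ : ℝ × Vec d → ℝ), ContDiff ℝ 1 φ → ∀ s : I,
      ∫ x, φ (s, x) ∂(ν s : Measure S) = pairing α m v n h φ s) {s t : I} (hst : s ≤ t) :
    ContEq s t (ν s : Measure S) (ν t) (m.restrict (Prod.fst ⁻¹' Ioc s t)) v
      (n.restrict (Prod.fst ⁻¹' Ioc s t)) h := by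
  intro φ hφ
  rw [hp φ hφ, hp φ hφ]
  have key : ∀ {X : Set (Vec d)} {P : Measure (I × X)} {k : I × X → ℝ}, Integrable k P →
      ∫ p in Prod.fst ⁻¹' Ioc s t, k p ∂P
        = (∫ p in {p | p.1 ≤ t}, k p ∂P) - ∫ p in {p | p.1 ≤ s}, k p ∂P := by
    intro X P k hk
    have e : {p : I × X | p.1 ≤ t} \ {p | p.1 ≤ s} = Prod.fst ⁻¹' Ioc s t := by
      ext p
      simp [and_comm]
    rw [← e]
    exact setIntegral_sdiff (measurableSet_fst_le s) hk.integrableOn fun p hp => le_trans hp hst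
  rw [key (integrable_adv hS hφ hv), key (integrable_test_mul hB hφ.continuous hh), pairing,
    pairing]
  ring

end Slices

namespace Flow

variable {Ω : Set (Vec d)} {κ : ℝ} {ρ₀ ρ₁ : POplus Ω} {Φ : Flow Ω}

theorem pairing_mass {S B : Set (Vec d)} {α : Measure S} {m : Measure (I × S)}
    {v : I × S → Vec d} {n : Measure (I × B)} {h : I × B → ℝ} (s : I) :
    pairing α m v n h (fun _ => 1) s = α.real univ + ∫ p in {p | p.1 ≤ s}, h p ∂n := by
  simp [pairing, adv, dt, dx]

/-- The slices of `m` and `n` form an interpolant: the exchange terms cancel, so that the total mass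
of the slices is one at every time. -/
theorem Joins.exists_interpolant (hΩ : Bornology.IsBounded Ω) (H : Φ.Joins 0 1 ρ₀ ρ₁)
    {μ : MeasureTuple Ω} (hω : μ.ω = Φ.m.toSignedMeasure) (hγ : μ.γ = Φ.n.toSignedMeasure) :
    ∃ ρ : I → POplus Ω, IsInterpolant μ ρ := by
  obtain ⟨hcl, hfr⟩ := compact_closure_frontier hΩ
  obtain ⟨hm, hn⟩ := H.map_fst_ac hΩ
  obtain ⟨ν, hνc, hνd⟩ := H.1.exists_slices hcl hfr Φ.integrable_v Φ.integrable_h.neg hm hn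
  obtain ⟨ν', hνc', hνd'⟩ := H.2.exists_slices hfr hfr Φ.integrable_w Φ.integrable_h hn hn
  have h1 := H.1.integral_slice hcl hfr Φ.integrable_v Φ.integrable_h.neg hm hn hνc hνd
    (φ := fun _ => 1) contDiff_const
  have h2 := H.2.integral_slice hfr hfr Φ.integrable_w Φ.integrable_h hn hn hνc' hνd'
    (φ := fun _ => 1) contDiff_const
  refine ⟨fun t => ⟨ν t, ν' t, ⟨?_⟩⟩, ⟨hνc, hνc', ?_, ?_⟩⟩
  · rw [Measure.add_apply, Measure.map_apply (by fun_prop) MeasurableSet.univ, preimage_univ,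
      ← ENNReal.toReal_eq_one_iff, ENNReal.toReal_add (measure_ne_top _ _) (measure_ne_top _ _)]
    have h1 := h1 t
    have h2 := h2 t
    rw [pairing_mass] at h1 h2
    simp only [integral_const, smul_eq_mul, mul_one, Pi.neg_apply, integral_neg] at h1 h2
    change (ν t : Measure (closure Ω)).real univ + (ν' t : Measure (frontier Ω)).real univ = 1
    linarith [ρ₀.mass]
  · intro B hB
    rw [hω, Measure.toSignedMeasure_apply_measurable hB]
    exact hνd B hB
  · intro B hB
    rw [hγ, Measure.toSignedMeasure_apply_measurable hB]
    exact hνd' B hB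

section Interpolant

variable {μ : MeasureTuple Ω} {ρ : I → POplus Ω}

theorem Joins.integral_interpolant (hΩ : Bornology.IsBounded Ω) (H : Φ.Joins 0 1 ρ₀ ρ₁)
    (hω : μ.ω = Φ.m.toSignedMeasure) (hγ : μ.γ = Φ.n.toSignedMeasure)
    (hρ : IsInterpolant μ ρ) {φ : ℝ × Vec d → ℝ} (hφ : ContDiff ℝ 1 φ) (s : I) :
    ∫ x, φ (s, x) ∂((ρ s).ω : Measure (closure Ω))
        = pairing (ρ₀.ω : Measure (closure Ω)) Φ.m Φ.v Φ.n (-Φ.h) φ s ∧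
      ∫ x, φ (s, x) ∂((ρ s).γ : Measure (frontier Ω))
        = pairing (ρ₀.γ : Measure (frontier Ω)) Φ.n Φ.w Φ.n Φ.h φ s := by
  obtain ⟨hcl, hfr⟩ := compact_closure_frontier hΩ
  obtain ⟨hm, hn⟩ := H.map_fst_ac hΩ
  refine ⟨H.1.integral_slice hcl hfr Φ.integrable_v Φ.integrable_h.neg hm hn hρ.continuous_ω
    (fun B hB => ?_) hφ s, H.2.integral_slice hfr hfr Φ.integrable_w Φ.integrable_h hn hn
    hρ.continuous_γ (fun B hB => ?_) hφ s⟩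
  · rw [← hρ.disintegration_ω B hB, hω, Measure.toSignedMeasure_apply_measurable hB]
  · rw [← hρ.disintegration_γ B hB, hγ, Measure.toSignedMeasure_apply_measurable hB]

theorem POplus_ext (hΩ : Bornology.IsBounded Ω) {ρ ρ' : POplus Ω}
    (h1 : ∀ φ : Vec d → ℝ, ContDiff ℝ 1 φ →
      ∫ x, φ x ∂(ρ.ω : Measure (closure Ω)) = ∫ x, φ x ∂(ρ'.ω : Measure (closure Ω)))
    (h2 : ∀ φ : Vec d → ℝ, ContDiff ℝ 1 φ →
      ∫ x, φ x ∂(ρ.γ : Measure (frontier Ω)) = ∫ x, φ x ∂(ρ'.γ : Measure (frontier Ω))) :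
    ρ = ρ' := by
  obtain ⟨hcl, hfr⟩ := compact_closure_frontier hΩ
  have eω : (ρ.ω : Measure (closure Ω)) = ρ'.ω := measure_eq_of_forall_contDiff hcl h1
  have eγ : (ρ.γ : Measure (frontier Ω)) = ρ'.γ := measure_eq_of_forall_contDiff hfr h2
  have hω : ρ.ω = ρ'.ω := Subtype.ext eω
  have hγ : ρ.γ = ρ'.γ := Subtype.ext eγ
  cases ρ; cases ρ'
  obtain rfl := hω
  obtain rfl := hγ
  rfl

theorem Joins.interpolant_zero (hΩ : Bornology.IsBounded Ω) (H : Φ.Joins 0 1 ρ₀ ρ₁)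
    (hω : μ.ω = Φ.m.toSignedMeasure) (hγ : μ.γ = Φ.n.toSignedMeasure)
    (hρ : IsInterpolant μ ρ) : ρ 0 = ρ₀ := by
  obtain ⟨hm, hn⟩ := H.map_fst_ac hΩ
  refine POplus_ext hΩ (fun φ hφ => ?_) fun φ hφ => ?_
  · have := (H.integral_interpolant hΩ hω hγ hρ (hφ.comp contDiff_snd) 0).1
    rwa [pairing_zero hm hn] at this
  · have := (H.integral_interpolant hΩ hω hγ hρ (hφ.comp contDiff_snd) 0).2
    rwa [pairing_zero hn hn] at this

theorem Joins.interpolant_one (hΩ : Bornology.IsBounded Ω) (H : Φ.Joins 0 1 ρ₀ ρ₁)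
    (hω : μ.ω = Φ.m.toSignedMeasure) (hγ : μ.γ = Φ.n.toSignedMeasure)
    (hρ : IsInterpolant μ ρ) : ρ 1 = ρ₁ := by
  refine POplus_ext hΩ (fun φ hφ => ?_) fun φ hφ => ?_
  · have := (H.integral_interpolant hΩ hω hγ hρ (hφ.comp contDiff_snd) 1).1
    rwa [H.1.pairing_one (hφ.comp contDiff_snd)] at this
  · have := (H.integral_interpolant hΩ hω hγ hρ (hφ.comp contDiff_snd) 1).2
    rwa [H.2.pairing_one (hφ.comp contDiff_snd)] at this

/-- Running the part of a flow in the time interval `(s, t]` during the unit time connects the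
values of an interpolant at `s` and `t`. -/
theorem Joins.WSq_interpolant_le (hΩ : Bornology.IsBounded Ω) (H : Φ.Joins 0 1 ρ₀ ρ₁)
    (hω : μ.ω = Φ.m.toSignedMeasure) (hγ : μ.γ = Φ.n.toSignedMeasure)
    (hρ : IsInterpolant μ ρ) {s t : I} (hst : s < t) :
    WSq κ (ρ s) (ρ t) ≤ ENNReal.ofReal (t - s) * (Φ.restrict (Ioc s t)).act κ := by
  obtain ⟨hcl, hfr⟩ := compact_closure_frontier hΩ
  have hJ : (Φ.restrict (Ioc s t)).Joins s t (ρ s) (ρ t) :=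
    ⟨contEq_restrict hcl hfr Φ.integrable_v Φ.integrable_h.neg (ν := fun t => (ρ t).ω)
      (fun φ hφ s => (H.integral_interpolant hΩ hω hγ hρ hφ s).1) hst.le,
    contEq_restrict hfr hfr Φ.integrable_w Φ.integrable_h (ν := fun t => (ρ t).γ)
      (fun φ hφ s => (H.integral_interpolant hΩ hω hγ hρ hφ s).2) hst.le⟩
  have hl : (0 : ℝ) < t - s := sub_pos.2 hst
  have hI : ∀ {X : Set (Vec d)} {P : Measure (I × X)},
      ∀ᵐ p ∂(P.restrict (Prod.fst ⁻¹' Ioc s t)),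
        -((t - s : ℝ)⁻¹ * s) + (t - s : ℝ)⁻¹ * (p.1 : ℝ) ∈ Icc (0 : ℝ) 1 := by
    intro X P
    filter_upwards [ae_restrict_mem (measurable_fst measurableSet_Ioc)] with p hp
    have h1 : (s : ℝ) < p.1 := hp.1
    have h2 : (p.1 : ℝ) ≤ t := hp.2
    have e : -((t - s : ℝ)⁻¹ * s) + (t - s : ℝ)⁻¹ * (p.1 : ℝ) = (p.1 - s) / (t - s) := by ring
    rw [e]
    exact ⟨div_nonneg (by linarith) hl.le, (div_le_one hl).2 (by linarith)⟩
  have hIm : ∀ᵐ p ∂(Φ.restrict (Ioc s t)).m,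
      -((t - s : ℝ)⁻¹ * s) + (t - s : ℝ)⁻¹ * (p.1 : ℝ) ∈ Icc (0 : ℝ) 1 := hI
  have hIn : ∀ᵐ p ∂(Φ.restrict (Ioc s t)).n,
      -((t - s : ℝ)⁻¹ * s) + (t - s : ℝ)⁻¹ * (p.1 : ℝ) ∈ Icc (0 : ℝ) 1 := hI
  have J := hJ.reparam_of_pos (inv_pos.2 hl) hIm hIn
  have e0 : -((t - s : ℝ)⁻¹ * s) + (t - s : ℝ)⁻¹ * s = 0 := by ring
  have e1 : -((t - s : ℝ)⁻¹ * s) + (t - s : ℝ)⁻¹ * t = 1 := by field_simp; ring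
  rw [e0, e1] at J
  refine (WSq_le_act hΩ J).trans_eq ?_
  rw [act_reparam, abs_of_pos (inv_pos.2 hl), inv_inv]

end Interpolant

theorem act_restrict_add_le (Φ : Flow Ω) {A B : Set I} (hB : MeasurableSet B)
    (hAB : Disjoint A B) :
    (Φ.restrict A).act κ + (Φ.restrict B).act κ ≤ (Φ.restrict (A ∪ B)).act κ := by
  simp only [act, restrict, preimage_union]
  rw [lintegral_union (measurable_fst hB) (hAB.preimage _),
    lintegral_union (measurable_fst hB) (hAB.preimage _), add_add_add_comm]

theorem act_restrict_le (Φ : Flow Ω) (A : Set I) : (Φ.restrict A).act κ ≤ Φ.act κ :=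
  add_le_add (setLIntegral_le_lintegral _ _) (setLIntegral_le_lintegral _ _)

end Flow

/-! ### Exchange of mass between the boundary and the interior -/

theorem hasDerivAt_time {φ : ℝ × Vec d → ℝ} (hφ : ContDiff ℝ 1 φ) (x : Vec d) (t : ℝ) :
    HasDerivAt (fun t => φ (t, x)) (dt φ (t, x)) t :=
  ((hφ.differentiable one_ne_zero) (t, x)).hasFDerivAt.comp_hasDerivAt t
    ((hasDerivAt_id t).prodMk (hasDerivAt_const t x))

/-- The fundamental theorem of calculus in time, integrated in space. -/
theorem integral_prod_deriv {S : Set (Vec d)} (hS : IsCompact S) {α : Measure S}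
    [IsFiniteMeasure α] {g g' : ℝ × Vec d → ℝ} (hg : Continuous g) (hg' : Continuous g')
    (hd : ∀ t x, HasDerivAt (fun t => g (t, x)) (g' (t, x)) t) :
    ∫ p : I × S, g' (toAmbient p) ∂((volume : Measure I).prod α)
      = (∫ x, g (1, x) ∂α) - ∫ x, g (0, x) ∂α := by
  have : CompactSpace S := isCompact_iff_compactSpace.1 hS
  have hi : ∀ c : ℝ, Integrable (fun x : S => g (c, x)) α := fun c =>
    Continuous.integrable_of_hasCompactSupport (by fun_prop) (HasCompactSupport.of_compactSpace _)
  rw [integral_prod_symm _ (integrable_test hS hg'), ← integral_sub (hi 1) (hi 0)]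
  refine integral_congr_ae (ae_of_all _ fun x => ?_)
  have h1 := integral_unitInterval fun t => g' (t, x)
  have h2 : ∫ t in (0 : ℝ)..1, g' (t, x) = g (1, x) - g (0, x) :=
    intervalIntegral.integral_eq_sub_of_hasDerivAt (fun t _ => hd t x)
      (Continuous.intervalIntegrable (by fun_prop) _ _)
  exact h1.trans h2

theorem integral_prod_map_inclusion {S T : Set (Vec d)} (hS : IsCompact S) (hT : IsCompact T)
    (hST : S ⊆ T) {γ : Measure S} [IsFiniteMeasure γ] {g : ℝ × Vec d → ℝ} (hg : Continuous g) :
    ∫ p : I × T, g (toAmbient p) ∂((volume : Measure I).prod (γ.map (inclusion hST)))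
      = ∫ p : I × S, g (toAmbient p) ∂((volume : Measure I).prod γ) := by
  rw [integral_prod _ (integrable_test hT hg), integral_prod _ (integrable_test hS hg)]
  refine integral_congr_ae (ae_of_all _ fun t => ?_)
  simp only
  rw [integral_map (by fun_prop)]
  · rfl
  · have : Continuous fun x : T => g ((t : ℝ), (x : Vec d)) := by fun_prop
    exact this.aestronglyMeasurable

theorem integral_withDensity_test {S : Set (Vec d)} {m : Measure (I × S)} {c : ℝ → ℝ}
    (hc : Continuous c) (h0 : ∀ t : I, 0 ≤ c t) (g : I × S → ℝ) :
    ∫ p, g p ∂(m.withDensity fun p => ENNReal.ofReal (c p.1)) = ∫ p, c p.1 * g p ∂m := by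
  rw [integral_withDensity_eq_integral_toReal_smul]
  · refine integral_congr_ae (ae_of_all _ fun p => ?_)
    simp only [smul_eq_mul, ENNReal.toReal_ofReal (h0 p.1)]
  · have : Continuous fun p : I × S => c p.1 := by fun_prop
    exact this.measurable.ennreal_ofReal
  · exact ae_of_all _ fun _ => ENNReal.ofReal_lt_top

section Exchange

variable {Ω : Set (Vec d)}

/-- Boundary mass evolving as `γ_t = (1 - ε t)² γ`, the lost mass being transferred in place to
the interior component, which is otherwise at rest. The square makes the action finite up to and
including `ε = 1`, where `γ` is exhausted; `ε = 0` is the constant flow. -/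
def exchange (hΩ : Bornology.IsBounded Ω) (ρ : POplus Ω) (ε : ℝ) : Flow Ω where
  m := (volume : Measure I).prod (ρ.ω : Measure (closure Ω)) +
    ((volume : Measure I).prod ((ρ.γ : Measure (frontier Ω)).map
      (inclusion frontier_subset_closure))).withDensity
        fun p => ENNReal.ofReal (1 - (1 - ε * (p.1 : ℝ)) ^ 2)
  v _ := 0
  n := ((volume : Measure I).prod (ρ.γ : Measure (frontier Ω))).withDensity
    fun p => ENNReal.ofReal ((1 - ε * (p.1 : ℝ)) ^ 2)
  w _ := 0
  h p := -(2 * ε) / (1 - ε * p.1)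
  finite_m := by
    obtain ⟨hcl, -⟩ := compact_closure_frontier hΩ
    have := isFiniteMeasure_withDensity_ofReal (integrable_test hcl
      (g := fun q => 1 - (1 - ε * q.1) ^ 2) (by fun_prop)
      (m := (volume : Measure I).prod ((ρ.γ : Measure (frontier Ω)).map
      (inclusion frontier_subset_closure)))).2
    simp only [toAmbient] at this
    infer_instance
  finite_n := isFiniteMeasure_withDensity_ofReal
    (integrable_test (compact_closure_frontier hΩ).2
      (g := fun q => (1 - ε * q.1) ^ 2) (by fun_prop)).2
  measurable_v := measurable_const
  measurable_w := measurable_const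
  measurable_h := by fun_prop
  integrable_v := integrable_zero _ _ _
  integrable_w := integrable_zero _ _ _
  integrable_h := by
    rw [integrable_withDensity_iff_integrable_smul₀' (by fun_prop)
      (ae_of_all _ fun _ => ENNReal.ofReal_lt_top)]
    refine (integrable_test (compact_closure_frontier hΩ).2
      (g := fun q => -(2 * ε) * (1 - ε * q.1)) (by fun_prop)).congr (ae_of_all _ fun p => ?_)
    simp only [toAmbient, smul_eq_mul, ENNReal.toReal_ofReal (sq_nonneg (1 - ε * (p.1 : ℝ)))]
    by_cases h : 1 - ε * (p.1 : ℝ) = 0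
    · simp [h]
    · field_simp
  tangent := ae_of_all _ fun p => zero_mem_tangentConeAt (subset_closure p.2.2)

theorem adv_zero (φ : ℝ × Vec d → ℝ) (q : ℝ × Vec d) : adv φ 0 q = dt φ q := by
  simp [adv]

/-- After the unit time a fraction `(1 - ε)²` of the boundary mass is left. -/
theorem exchange_joins (hΩ : Bornology.IsBounded Ω) {ρ ρ' : POplus Ω} {ε : ℝ} (h0 : 0 ≤ ε)
    (h1 : ε ≤ 1)
    (hω : (ρ'.ω : Measure (closure Ω)) = ρ.ω + ENNReal.ofReal (1 - (1 - ε) ^ 2) •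
      (ρ.γ : Measure (frontier Ω)).map (inclusion frontier_subset_closure))
    (hγ : (ρ'.γ : Measure (frontier Ω)) = ENNReal.ofReal ((1 - ε) ^ 2) •
      (ρ.γ : Measure (frontier Ω))) :
    (exchange hΩ ρ ε).Joins 0 1 ρ ρ' := by
  obtain ⟨hcl, hfr⟩ := compact_closure_frontier hΩ
  set γ' := (ρ.γ : Measure (frontier Ω)).map (inclusion frontier_subset_closure) with hγ'
  have hc1 : Continuous fun t : ℝ => 1 - (1 - ε * t) ^ 2 := by fun_prop
  have hc2 : Continuous fun t : ℝ => (1 - ε * t) ^ 2 := by fun_prop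
  have hp1 : ∀ t : I, 0 ≤ 1 - (1 - ε * (t : ℝ)) ^ 2 := by
    intro t
    have := t.2.1; have := t.2.2
    nlinarith [mul_nonneg h0 t.2.1, mul_le_one₀ h1 t.2.1 t.2.2]
  have hp2 : ∀ t : I, 0 ≤ (1 - ε * (t : ℝ)) ^ 2 := fun t => sq_nonneg _
  have hd : ∀ t : ℝ, HasDerivAt (fun t : ℝ => (1 - ε * t) ^ 2) (-(2 * ε) * (1 - ε * t)) t := by
    intro t
    have := (((hasDerivAt_id t).const_mul ε).const_sub 1).pow 2
    exact this.congr_deriv (by simp only [id_eq]; push_cast; ring)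
  -- the source term `h n` is `∂ₜ((1 - ε t)²) dt ⊗ γ`
  have hsrc : ∀ φ : ℝ × Vec d → ℝ,
      ∫ p : I × frontier Ω, φ (toAmbient p) * (exchange hΩ ρ ε).h p ∂(exchange hΩ ρ ε).n
      = ∫ p : I × frontier Ω, φ (toAmbient p) * (-(2 * ε) * (1 - ε * p.1))
        ∂((volume : Measure I).prod (ρ.γ : Measure (frontier Ω))) := by
    intro φ
    refine (integral_withDensity_test hc2 hp2 _).trans ?_
    refine integral_congr_ae (ae_of_all _ fun p => ?_)
    simp only [exchange]
    by_cases h : 1 - ε * (p.1 : ℝ) = 0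
    · simp [h]
    · field_simp
  constructor
  · intro φ hφ
    have hdt := continuous_dt hφ
    have hφc := hφ.continuous
    simp only [Pi.neg_apply, mul_neg, integral_neg]
    rw [hsrc]
    have e1 : (∫ p : I × closure Ω, adv φ ((exchange hΩ ρ ε).v p) (toAmbient p)
        ∂(exchange hΩ ρ ε).m) =
        (∫ p : I × closure Ω, dt φ (toAmbient p) ∂((volume : Measure I).prod
          (ρ.ω : Measure (closure Ω)))) +
        ∫ p : I × closure Ω, (1 - (1 - ε * (p.1 : ℝ)) ^ 2) * dt φ (toAmbient p)
          ∂((volume : Measure I).prod γ') := by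
      simp only [exchange, adv_zero]
      have hf := isFiniteMeasure_withDensity_ofReal (integrable_test hcl
        (g := fun q => 1 - (1 - ε * q.1) ^ 2) (by fun_prop)
        (m := (volume : Measure I).prod γ')).2
      simp only [toAmbient] at hf
      rw [integral_add_measure (integrable_test hcl hdt) (integrable_test hcl hdt)]
      congr 1
      exact integral_withDensity_test hc1 hp1 _
    have e2 := integral_prod_deriv hcl (α := (ρ.ω : Measure (closure Ω))) hφc hdt
      fun t x => hasDerivAt_time hφ x t
    have e3 := integral_prod_deriv hcl (α := γ') (g := fun q => (1 - (1 - ε * q.1) ^ 2) * φ q)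
      (g' := fun q => -(-(2 * ε) * (1 - ε * q.1)) * φ q + (1 - (1 - ε * q.1) ^ 2) * dt φ q)
      (by fun_prop) (by fun_prop)
      fun t x => ((hd t).const_sub 1).mul (hasDerivAt_time hφ x t)
    have e4 := integral_prod_map_inclusion hfr hcl (frontier_subset_closure (s := Ω))
      (γ := (ρ.γ : Measure (frontier Ω)))
      (g := fun q => φ q * (-(2 * ε) * (1 - ε * q.1))) (by fun_prop)
    have i1 : Integrable (fun p : I × closure Ω => -(-(2 * ε) * (1 - ε * p.1)) *
        φ (toAmbient p)) ((volume : Measure I).prod γ') :=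
      integrable_test hcl (g := fun q => -(-(2 * ε) * (1 - ε * q.1)) * φ q) (by fun_prop)
    have i2 : Integrable (fun p : I × closure Ω => (1 - (1 - ε * (p.1 : ℝ)) ^ 2) *
        dt φ (toAmbient p)) ((volume : Measure I).prod γ') :=
      integrable_test hcl (g := fun q => (1 - (1 - ε * q.1) ^ 2) * dt φ q) (by fun_prop)
    have e5 : ∫ p : I × closure Ω, -(-(2 * ε) * (1 - ε * p.1)) * φ (toAmbient p)
        ∂((volume : Measure I).prod γ') = -∫ p : I × frontier Ω, φ (toAmbient p) *
          (-(2 * ε) * (1 - ε * p.1))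
          ∂((volume : Measure I).prod (ρ.γ : Measure (frontier Ω))) := by
      refine Eq.trans ?_ (congrArg Neg.neg e4)
      rw [← integral_neg]
      refine integral_congr_ae (ae_of_all _ fun p => ?_)
      simp only [toAmbient]; ring
    have e6 := (integral_add i1 i2).symm.trans e3
    have hi : ∀ (α : Measure (closure Ω)) [IsFiniteMeasure α],
        Integrable (fun x : closure Ω => φ (1, x)) α := by
      intro α _
      have : CompactSpace (closure Ω) := isCompact_iff_compactSpace.1 hcl
      exact Continuous.integrable_of_hasCompactSupport (by fun_prop)
        (HasCompactSupport.of_compactSpace _)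
    have hfin : IsFiniteMeasure (ENNReal.ofReal (1 - (1 - ε) ^ 2) • γ') :=
      Measure.smul_finite _ ENNReal.ofReal_ne_top
    rw [hω, integral_add_measure (hi _) (hi _), integral_smul_measure,
      ENNReal.toReal_ofReal (by simpa using hp1 1), e1, smul_eq_mul]
    simp only [mul_one, mul_zero, sub_zero, one_pow, sub_self, zero_mul, integral_zero] at e6
    rw [integral_const_mul] at e6
    linear_combination e2 + e6 - e5
  · intro φ hφ
    have hdt := continuous_dt hφ
    have hφc := hφ.continuous
    rw [hsrc]
    have e1 : (∫ p : I × frontier Ω, adv φ ((exchange hΩ ρ ε).w p) (toAmbient p)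
        ∂(exchange hΩ ρ ε).n) =
        ∫ p : I × frontier Ω, (1 - ε * (p.1 : ℝ)) ^ 2 * dt φ (toAmbient p)
          ∂((volume : Measure I).prod (ρ.γ : Measure (frontier Ω))) := by
      simp only [exchange, adv_zero]
      exact integral_withDensity_test hc2 hp2 _
    have e3 := integral_prod_deriv hfr (α := (ρ.γ : Measure (frontier Ω)))
      (g := fun q => (1 - ε * q.1) ^ 2 * φ q)
      (g' := fun q => (-(2 * ε) * (1 - ε * q.1)) * φ q + (1 - ε * q.1) ^ 2 * dt φ q)
      (by fun_prop) (by fun_prop) fun t x => (hd t).mul (hasDerivAt_time hφ x t)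
    have i1 : Integrable (fun p : I × frontier Ω => (-(2 * ε) * (1 - ε * p.1)) *
        φ (toAmbient p)) ((volume : Measure I).prod (ρ.γ : Measure (frontier Ω))) :=
      integrable_test hfr (g := fun q => (-(2 * ε) * (1 - ε * q.1)) * φ q) (by fun_prop)
    have i2 : Integrable (fun p : I × frontier Ω => (1 - ε * (p.1 : ℝ)) ^ 2 *
        dt φ (toAmbient p)) ((volume : Measure I).prod (ρ.γ : Measure (frontier Ω))) :=
      integrable_test hfr (g := fun q => (1 - ε * q.1) ^ 2 * dt φ q) (by fun_prop)
    have e6 := (integral_add i1 i2).symm.trans e3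
    simp only [mul_one, mul_zero, sub_zero, one_pow, one_mul] at e6
    rw [integral_const_mul] at e6
    simp only [mul_comm (φ _)]
    rw [hγ, integral_smul_measure, ENNReal.toReal_ofReal (sq_nonneg _), smul_eq_mul, e1]
    linear_combination e6

/-- The factor `(1 - ε t)²` of the boundary mass compensates the action density `κ² h² / 2` of the
exchange, where `h = -2ε / (1 - ε t)`. -/
theorem act_exchange_le (hΩ : Bornology.IsBounded Ω) (ρ : POplus Ω) (κ ε : ℝ) :
    (exchange hΩ ρ ε).act κ
      ≤ ENNReal.ofReal (2 * κ ^ 2 * ε ^ 2) * (ρ.γ : Measure (frontier Ω)) univ := by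
  have h1 : (exchange hΩ ρ ε).act κ = ∫⁻ p, ENNReal.ofReal
      ((κ ^ 2 * (exchange hΩ ρ ε).h p ^ 2) / 2) ∂(exchange hΩ ρ ε).n := by
    simp [Flow.act, exchange]
  have mh := (exchange hΩ ρ ε).measurable_h
  rw [h1]
  change ∫⁻ p, _ ∂(((volume : Measure I).prod (ρ.γ : Measure (frontier Ω))).withDensity
    fun p => ENNReal.ofReal ((1 - ε * (p.1 : ℝ)) ^ 2)) ≤ _
  rw [lintegral_withDensity_eq_lintegral_mul _ (by fun_prop) (by fun_prop)]
  have h2 : ((volume : Measure I).prod (ρ.γ : Measure (frontier Ω))) univ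
      = (ρ.γ : Measure (frontier Ω)) univ := by
    rw [← univ_prod_univ, Measure.prod_prod]; simp
  rw [← h2, ← lintegral_const]
  refine lintegral_mono fun p => ?_
  rw [Pi.mul_apply, ← ENNReal.ofReal_mul (sq_nonneg _)]
  refine ENNReal.ofReal_le_ofReal ?_
  simp only [exchange]
  -- where the boundary mass vanishes, `h` is zero by the convention on division by zero
  by_cases h : 1 - ε * (p.1 : ℝ) = 0
  · rw [h]; simp; positivity
  · apply le_of_eq
    field_simp

/-- The constant flow, with `ε = 0`, has no action. -/
theorem WSq_self (hΩ : Bornology.IsBounded Ω) (κ : ℝ) (ρ : POplus Ω) : WSq κ ρ ρ = 0 := by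
  have h := exchange_joins hΩ (ρ := ρ) (ρ' := ρ) (ε := 0) le_rfl zero_le_one (by simp) (by simp)
  refine le_antisymm ((Flow.WSq_le_act (κ := κ) hΩ h).trans ?_) zero_le
  simpa using act_exchange_le hΩ ρ κ 0

end Exchange

/-! ### Transport along segments -/

/-- The image of the measure `V M` under `e` has a bounded density with respect to the image
of `M`: the conditional expectation of `V` given `e`. -/
theorem exists_density_map {X Y : Type*} [MeasurableSpace X] [MeasurableSpace Y]
    {M : Measure X} [IsFiniteMeasure M] {e : X → Y} (he : Measurable e) {V : X → ℝ}
    (hV : Measurable V) {K : ℝ} (hK : ∀ x, |V x| ≤ K) :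
    ∃ v : Y → ℝ, Measurable v ∧ (∀ᵐ y ∂(M.map e), |v y| ≤ K) ∧
      ∀ g : Y → ℝ, Measurable g → (∃ C, ∀ y, |g y| ≤ C) →
        ∫ y, g y * v y ∂(M.map e) = ∫ x, g (e x) * V x ∂M := by
  have hle : MeasurableSpace.comap e inferInstance ≤ (inferInstance : MeasurableSpace X) :=
    he.comap_le
  set E := M[V | MeasurableSpace.comap e inferInstance] with hE
  have hVi : Integrable V M := Integrable.of_bound hV.aestronglyMeasurable K (ae_of_all _ hK)
  have hsm : StronglyMeasurable[MeasurableSpace.comap e inferInstance] E :=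
    stronglyMeasurable_condExp
  obtain ⟨v, hv, hve⟩ := hsm.measurable.exists_eq_measurable_comp
  refine ⟨v, hv, ?_, fun g hg ⟨C, hC⟩ => ?_⟩
  · rw [ae_map_iff he.aemeasurable (measurableSet_le (by fun_prop) measurable_const)]
    have := ae_bdd_abs_condExp_of_ae_bdd_abs (m := MeasurableSpace.comap e inferInstance)
      (ae_of_all M hK)
    filter_upwards [this] with x hx
    rw [← hE, hve] at hx
    exact hx
  · rw [integral_map he.aemeasurable (f := fun y => g y * v y) (hg.mul hv).aestronglyMeasurable]
    have hge : StronglyMeasurable[MeasurableSpace.comap e inferInstance] (g ∘ e) :=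
      (hg.comp (comap_measurable e)).stronglyMeasurable
    have hi : Integrable ((g ∘ e) * V) M :=
      hVi.bdd_mul (hg.comp he).aestronglyMeasurable (ae_of_all _ fun x => hC (e x))
    have h1 := condExp_mul_of_stronglyMeasurable_left hge hi hVi
    have h2 := integral_condExp (μ := M) (f := (g ∘ e) * V) hle
    rw [integral_congr_ae h1] at h2
    rw [← hE, hve] at h2
    exact h2

theorem hasDerivAt_segment {φ : ℝ × Vec d → ℝ} (hφ : ContDiff ℝ 1 φ) (y u : Vec d) (t : ℝ) :
    HasDerivAt (fun t => φ (t, y + t • u)) (adv φ u (t, y + t • u)) t := by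
  have h := ((hφ.differentiable one_ne_zero) (t, y + t • u)).hasFDerivAt.comp_hasDerivAt t
    ((hasDerivAt_id t).prodMk (((hasDerivAt_id t).smul_const u).const_add y))
  refine h.congr_deriv ?_
  have hu : ((1 : ℝ), (1 : ℝ) • u) = (1, (0 : Vec d)) +
      ∑ i, u i • ((0 : ℝ), EuclideanSpace.single i (1 : ℝ)) := by
    have hs : ∑ i, u i • EuclideanSpace.single i (1 : ℝ) = u := by
      simpa using (EuclideanSpace.basisFun (Fin d) ℝ).sum_repr u
    refine Prod.ext (by simp [Prod.fst_sum]) ?_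
    simp [Prod.snd_sum, hs]
  rw [hu, map_add, map_sum]
  simp only [map_smul, smul_eq_mul, adv, dt, dx, mul_comm]

/-- The state with interior component `α` and no boundary mass. -/
def POplus.ofInterior {Ω : Set (Vec d)} (α : ProbabilityMeasure (closure Ω)) : POplus Ω where
  ω := α.toFiniteMeasure
  γ := 0
  isProb := by simpa using (inferInstance : IsProbabilityMeasure (α : Measure (closure Ω)))

section Transport

variable {Ω : Set (Vec d)}

/-- A state carried by the interior component can be transported, with finite action, along
straight segments contained in the closure of `Ω`. Since the trajectories of different labels may
cross, the velocity at a space-time point is the conditional mean of theirs. -/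
theorem WSq_map_lt_top (hΩ : Bornology.IsBounded Ω) (κ : ℝ)
    (l : ProbabilityMeasure (closure Ω)) {Y Y' : closure Ω → closure Ω} (hY : Measurable Y)
    (hY' : Measurable Y') (hseg : ∀ x, segment ℝ (Y x : Vec d) (Y' x) ⊆ closure Ω) :
    WSq κ (POplus.ofInterior (l.map hY.aemeasurable)) (POplus.ofInterior (l.map hY'.aemeasurable))
      < ⊤ := by
  obtain ⟨hcl, hfr⟩ := compact_closure_frontier hΩ
  obtain ⟨R, hR⟩ := hcl.isBounded.exists_norm_le
  let M : Measure (I × closure Ω) := (volume : Measure I).prod (l : Measure (closure Ω))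
  let U : closure Ω → Vec d := fun x => (Y' x : Vec d) - Y x
  have mU : Measurable U := by fun_prop
  have hU : ∀ x i, |U x i| ≤ 2 * R := fun x i => by
    refine (PiLp.norm_apply_le (U x) i).trans ((norm_sub_le _ _).trans ?_)
    linarith [hR _ (Y' x).2, hR _ (Y x).2]
  have hmem : ∀ p : I × closure Ω, (Y p.2 : Vec d) + (p.1 : ℝ) • U p.2 ∈ closure Ω := by
    intro p
    refine hseg p.2 ?_
    rw [segment_eq_image']
    exact ⟨p.1, p.1.2, rfl⟩
  let e : I × closure Ω → I × closure Ω := fun p => (p.1, ⟨_, hmem p⟩)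
  have me : Measurable e := by
    refine measurable_fst.prodMk (Measurable.subtype_mk ?_)
    fun_prop
  choose v mv bv hv using fun i => exists_density_map (M := M) me
    (V := fun p => U p.2 i) (by fun_prop) fun p => hU p.2 i
  have mv' : Measurable fun p => (WithLp.toLp 2 fun i => v i p : Vec d) :=
    (PiLp.continuous_toLp 2 _).measurable.comp (measurable_pi_iff.2 mv)
  have bv' : ∀ᵐ p ∂(M.map e), ‖(WithLp.toLp 2 fun i => v i p : Vec d)‖ ^ 2 ≤ d * (2 * R) ^ 2 := by
    filter_upwards [ae_all_iff.2 bv] with p hp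
    rw [EuclideanSpace.norm_sq_eq]
    refine (Finset.sum_le_sum fun i _ => pow_le_pow_left₀ (norm_nonneg _) (hp i) 2).trans ?_
    simp
  have iv : Integrable (fun p => (WithLp.toLp 2 fun i => v i p : Vec d)) (M.map e) :=
    Integrable.of_eval_piLp fun i => Integrable.of_bound (mv i).aestronglyMeasurable _ (bv i)
  let Φ : Flow Ω :=
    { m := M.map e
      v := fun p => WithLp.toLp 2 fun i => v i p
      n := 0
      w := 0
      h := 0
      finite_m := inferInstance
      finite_n := inferInstance
      measurable_v := mv'
      measurable_w := measurable_const
      measurable_h := measurable_const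
      integrable_v := iv
      integrable_w := integrable_zero_measure
      integrable_h := integrable_zero_measure
      tangent := by simp }
  have hJ : Φ.Joins 0 1 (POplus.ofInterior (l.map hY.aemeasurable))
      (POplus.ofInterior (l.map hY'.aemeasurable)) := by
    refine ⟨fun φ hφ => ?_, fun φ hφ => ?_⟩
    · have i1 : Integrable (fun p => dt φ (toAmbient (e p))) M :=
        (integrable_test hcl (continuous_dt hφ) (m := M.map e)).comp_measurable me
      have i2 : ∀ i, Integrable (fun p => dx i φ (toAmbient (e p)) * U p.2 i) M := fun i => by
        obtain ⟨C, hC⟩ := exists_bound_of_compact hcl (continuous_dx hφ i)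
        have mUi : Measurable fun p : I × closure Ω => U p.2 i := by fun_prop
        refine Integrable.bdd_mul (Integrable.of_bound mUi.aestronglyMeasurable (2 * R)
          (ae_of_all _ fun p => hU p.2 i)) ?_ (ae_of_all _ fun p => hC (e p))
        exact (((continuous_dx hφ i).comp continuous_toAmbient).measurable.comp
          me).aestronglyMeasurable
      have e1 : ∫ p, adv φ (Φ.v p) (toAmbient p) ∂Φ.m
          = ∫ p, adv φ (U p.2) (toAmbient (e p)) ∂M := by
        rw [integral_adv hcl hφ iv]
        unfold adv
        rw [integral_add i1 (integrable_finsetSum _ fun i _ => i2 i),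
          integral_finsetSum _ fun i _ => i2 i]
        congr 1
        · exact integral_map me.aemeasurable
            ((continuous_dt hφ).comp continuous_toAmbient).measurable.aestronglyMeasurable
        · exact Finset.sum_congr rfl fun i _ => hv i _
            ((continuous_dx hφ i).comp continuous_toAmbient).measurable
            (exists_bound_of_compact hcl (continuous_dx hφ i))
      have e2 : ∫ p, adv φ (U p.2) (toAmbient (e p)) ∂M
          = ∫ x, (φ (1, Y' x) - φ (0, Y x)) ∂(l : Measure (closure Ω)) := by
        have hi : Integrable (fun p => adv φ (U p.2) (toAmbient (e p))) M :=
          i1.add (integrable_finsetSum _ fun i _ => i2 i)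
        rw [integral_prod_symm _ hi]
        refine integral_congr_ae (ae_of_all _ fun x => ?_)
        have hc : Continuous fun t : ℝ => adv φ (U x) (t, (Y x : Vec d) + t • U x) := by
          have h0 : Continuous fun t : ℝ => (t, (Y x : Vec d) + t • U x) := by fun_prop
          have := (continuous_dt hφ).comp h0
          have := fun i => (continuous_dx hφ i).comp h0
          unfold adv
          fun_prop
        have h1 := integral_unitInterval fun t => adv φ (U x) (t, (Y x : Vec d) + t • U x)
        have h2 : ∫ t in (0 : ℝ)..1, adv φ (U x) (t, (Y x : Vec d) + t • U x)
            = φ (1, (Y x : Vec d) + (1 : ℝ) • U x) - φ (0, (Y x : Vec d) + (0 : ℝ) • U x) :=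
          intervalIntegral.integral_eq_sub_of_hasDerivAt
            (fun t _ => hasDerivAt_segment hφ _ _ t) (hc.intervalIntegrable _ _)
        refine (h1.trans h2).trans ?_
        simp [U]
      have hm : ∀ (c : ℝ) {Z : closure Ω → closure Ω} (hZ : Measurable Z),
          Integrable (fun x => φ (c, Z x)) (l : Measure (closure Ω)) ∧
          ∫ x, φ (c, x) ∂(Measure.map Z (l : Measure (closure Ω)))
            = ∫ x, φ (c, Z x) ∂(l : Measure (closure Ω)) := by
        intro c Z hZ
        have hc : Continuous fun x : closure Ω => φ (c, (x : Vec d)) :=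
          hφ.continuous.comp (by fun_prop)
        have : CompactSpace (closure Ω) := isCompact_iff_compactSpace.1 hcl
        exact ⟨(hc.integrable_of_hasCompactSupport (HasCompactSupport.of_compactSpace _)
          (μ := (l : Measure (closure Ω)).map Z)).comp_measurable hZ,
          integral_map hZ.aemeasurable hc.measurable.aestronglyMeasurable⟩
      rw [e1, e2, integral_sub (hm 1 hY').1 (hm 0 hY).1, ← (hm 1 hY').2, ← (hm 0 hY).2]
      simp [Φ, POplus.ofInterior]
    · simp [Φ, POplus.ofInterior]
  refine (Flow.WSq_le_act hΩ hJ).trans_lt ?_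
  have h1 : Φ.act κ ≤ ∫⁻ _, ENNReal.ofReal (d * (2 * R) ^ 2 / 2) ∂(M.map e) := by
    simp only [Flow.act, Φ, lintegral_zero_measure, add_zero]
    refine lintegral_mono_ae ?_
    filter_upwards [bv'] with p hp
    gcongr
  refine h1.trans_lt ?_
  rw [lintegral_const]
  exact ENNReal.mul_lt_top ENNReal.ofReal_lt_top (measure_lt_top _ _)

end Transport

/-! ### Finiteness of the distance -/

section Geometry

variable {Ω : Set (Vec d)}

/-- Near each point of its closure, a smooth bounded domain can be pushed into its interior by a
fixed translation that does not leave its closure on the way. -/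
theorem IsSmoothBoundedDomain.exists_inward (hΩ : IsSmoothBoundedDomain Ω) {x : Vec d}
    (hx : x ∈ closure Ω) :
    ∃ (u : Vec d) (δ : ℝ), 0 < δ ∧ Metric.ball (x + u) δ ⊆ Ω ∧
      ∀ y ∈ closure Ω, dist y x < δ → ∀ t ∈ Icc (0 : ℝ) 1, y + t • u ∈ closure Ω := by
  by_cases hxΩ : x ∈ Ω
  · obtain ⟨δ, hδ, hb⟩ := Metric.isOpen_iff.1 hΩ.isOpen x hxΩ
    exact ⟨0, δ, hδ, by simpa using hb, fun y hy _ t _ => by simpa using hy⟩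
  have hxf : x ∈ frontier Ω := by rw [hΩ.isOpen.frontier_eq]; exact ⟨hx, hxΩ⟩
  obtain ⟨r, hr, hr0, hev⟩ := hΩ.smooth_boundary x hxf
  obtain ⟨e, he⟩ : ∃ e, fderiv ℝ r x e < 0 := by
    by_contra! h
    refine hr0 (ContinuousLinearMap.ext fun e => le_antisymm ?_ (h e))
    simpa using h (-e)
  have hcont : Continuous fun y => fderiv ℝ r y e :=
    (hr.continuous_fderiv (by simp)).clm_apply continuous_const
  obtain ⟨η, hη, hball⟩ := Metric.eventually_nhds_iff_ball.1
    (hev.and (hcont.continuousAt.eventually_lt continuousAt_const he))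
  have he0 : 0 < ‖e‖ := norm_pos_iff.2 fun h => by simp [h] at he
  set c := η / (4 * ‖e‖) with hc
  have hc0 : 0 < c := by positivity
  have hce : ‖c • e‖ = η / 4 := by
    rw [norm_smul, Real.norm_of_nonneg hc0.le, hc]; field_simp
  have hmem : ∀ y, dist y x < η / 2 → ∀ t ∈ Icc (0 : ℝ) 1, y + t • c • e ∈ Metric.ball x η := by
    intro y hy t ht
    rw [Metric.mem_ball]
    have h1 : dist (y + t • c • e) y ≤ η / 4 := by
      rw [dist_eq_norm, add_sub_cancel_left, norm_smul, hce, Real.norm_of_nonneg ht.1]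
      nlinarith [ht.2]
    linarith [dist_triangle (y + t • c • e) y x]
  -- `r ≤ 0` on the closure of `Ω`, and `r` decreases strictly in the direction `e`
  have hin : ∀ y ∈ closure Ω, dist y x < η / 2 → ∀ t ∈ Icc (0 : ℝ) 1, 0 < t →
      y + t • c • e ∈ Ω := by
    intro y hy hyx t ht ht0
    have hry : r y ≤ 0 := by
      by_contra! h
      have h1 : ∀ᶠ z in 𝓝 y, 0 < r z := hr.continuous.continuousAt.eventually_const_lt h
      have h2 : ∀ᶠ z in 𝓝 y, z ∈ Metric.ball x η :=
        Metric.isOpen_ball.mem_nhds (by rw [Metric.mem_ball]; linarith)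
      obtain ⟨z, hz, hz1, hz2⟩ := ((mem_closure_iff_frequently.1 hy).and_eventually
        (h1.and h2)).exists
      exact absurd (((hball z hz2).1).1 hz) (not_lt.2 hz1.le)
    have hd : ∀ τ : ℝ, HasDerivAt (fun τ : ℝ => r (y + τ • c • e))
        (fderiv ℝ r (y + τ • c • e) (c • e)) τ := fun τ => by
      have := ((hr.differentiable (by simp)) (y + τ • c • e)).hasFDerivAt.comp_hasDerivAt τ
        (((hasDerivAt_id τ).smul_const (c • e)).const_add y)
      exact this.congr_deriv (by simp)
    have hanti := strictAntiOn_of_deriv_neg (convex_Icc (0 : ℝ) 1)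
      (fun τ _ => (hd τ).continuousAt.continuousWithinAt) fun τ hτ => by
        rw [interior_Icc] at hτ
        rw [(hd τ).deriv, map_smul, smul_eq_mul]
        exact mul_neg_of_pos_of_neg hc0 (hball _ (hmem y hyx τ ⟨hτ.1.le, hτ.2.le⟩)).2
    have := hanti ⟨le_rfl, zero_le_one⟩ ht ht0
    simp only [zero_smul, add_zero] at this
    exact ((hball _ (hmem y hyx t ht)).1).2 (this.trans_le hry)
  have hxu : x + c • e ∈ Ω := by
    simpa using hin x hx (by simpa using hη) 1 ⟨zero_le_one, le_rfl⟩ one_pos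
  obtain ⟨δ, hδ, hb⟩ := Metric.isOpen_iff.1 hΩ.isOpen _ hxu
  refine ⟨c • e, min δ (η / 2), lt_min hδ (by linarith),
    (Metric.ball_subset_ball (min_le_left _ _)).trans hb, fun y hy hyx t ht => ?_⟩
  rcases ht.1.eq_or_lt with rfl | ht0
  · simpa using hy
  · exact subset_closure (hin y hy (hyx.trans_le (min_le_right _ _)) t ht ht0)

/-- Measurable maps `Y`, `Y'` into `Ω̄` such that each segment `[Y x, Y' x]` stays in `Ω̄`. -/
def Move (Y Y' : closure Ω → closure Ω) : Prop :=
  Measurable Y ∧ Measurable Y' ∧ ∀ x, segment ℝ (Y x : Vec d) (Y' x) ⊆ closure Ω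

open Classical in
/-- Finite sequences of moves may be performed on a measurable set of labels only. -/
theorem moves_piecewise {Y Y' Z : closure Ω → closure Ω} {s : Set (closure Ω)}
    (hs : MeasurableSet s) (hZ : Measurable Z) (h : Relation.ReflTransGen Move Y Y') :
    Relation.ReflTransGen Move (s.piecewise Y Z) (s.piecewise Y' Z) := by
  refine Relation.ReflTransGen.lift (fun A => s.piecewise A Z) (fun A B hAB => ?_) _ _ h
  refine ⟨hAB.1.piecewise hs hZ, hAB.2.1.piecewise hs hZ, fun x => ?_⟩
  by_cases hx : x ∈ s
  · simpa [hx] using hAB.2.2 x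
  · simp [hx]

/-- Points of the connected open set `Ω` are joined by polygonal lines. -/
theorem moves_const (hΩ : IsSmoothBoundedDomain Ω) {x y : closure Ω} (hx : (x : Vec d) ∈ Ω)
    (hy : (y : Vec d) ∈ Ω) :
    Relation.ReflTransGen Move (fun _ : closure Ω => x) (fun _ => y) := by
  have key := hΩ.isConnected.isPreconnected.induction₂'
    (fun p q => ∀ (hp : p ∈ closure Ω) (hq : q ∈ closure Ω), Relation.ReflTransGen Move
      (fun _ : closure Ω => (⟨p, hp⟩ : closure Ω)) (fun _ => ⟨q, hq⟩)) ?_ ?_ hx hy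
  · exact key x.2 y.2
  · intro p hp
    obtain ⟨δ, hδ, hb⟩ := Metric.isOpen_iff.1 hΩ.isOpen p hp
    filter_upwards [mem_nhdsWithin_of_mem_nhds (Metric.ball_mem_nhds p hδ)] with q hq
    have hseg : segment ℝ p q ⊆ closure Ω :=
      (((convex_ball p δ).segment_subset (Metric.mem_ball_self hδ) hq).trans hb).trans
        subset_closure
    exact ⟨fun _ _ => .single ⟨measurable_const, measurable_const, fun _ => hseg⟩,
      fun _ _ => .single ⟨measurable_const, measurable_const, fun _ => by
        rw [segment_symm]; exact hseg⟩⟩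
  · intro p q z _ hq _ h1 h2 hp hz
    exact (h1 hp (subset_closure hq)).trans (h2 (subset_closure hq) hz)

/-- All of `Ω̄` can be brought to one point of `Ω` by finitely many moves. -/
theorem moves_id_const (hΩ : IsSmoothBoundedDomain Ω) {x₀ : closure Ω}
    (hx₀ : (x₀ : Vec d) ∈ Ω) :
    Relation.ReflTransGen Move (id : closure Ω → closure Ω) (fun _ => x₀) := by
  classical
  have hcl := (compact_closure_frontier hΩ.isBounded).1
  have : CompactSpace (closure Ω) := isCompact_iff_compactSpace.1 hcl
  suffices H : ∃ s : Set (closure Ω), MeasurableSet s ∧ univ ⊆ s ∧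
      Relation.ReflTransGen Move id (s.piecewise (fun _ => x₀) id) by
    obtain ⟨s, -, hsu, h⟩ := H
    rwa [univ_subset_iff.1 hsu, piecewise_univ] at h
  refine isCompact_univ.induction_on
    (p := fun t : Set (closure Ω) => ∃ s, MeasurableSet s ∧ t ⊆ s ∧
      Relation.ReflTransGen Move id (s.piecewise (fun _ => x₀) id))
    ⟨∅, .empty, subset_rfl, by rw [piecewise_empty]⟩
    (fun t t' htt' ⟨s, hs, hts, h⟩ => ⟨s, hs, htt'.trans hts, h⟩) ?_ ?_
  · rintro t t' ⟨s, hs, hts, h⟩ ⟨s', hs', hts', h'⟩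
    refine ⟨s ∪ s', hs.union hs', union_subset_union hts hts', h.trans ?_⟩
    have := moves_piecewise hs.compl (measurable_const (a := x₀)) h'
    rw [piecewise_compl, piecewise_compl] at this
    convert this using 1
    ext1 y
    by_cases hy : y ∈ s <;> by_cases hy' : y ∈ s' <;> simp [hy, hy']
  · intro x _
    obtain ⟨u, δ, hδ, hball, hmem⟩ := hΩ.exists_inward x.2
    refine ⟨Metric.ball x δ, mem_nhdsWithin_of_mem_nhds (Metric.ball_mem_nhds x hδ),
      Metric.ball x δ, Metric.isOpen_ball.measurableSet, subset_rfl, ?_⟩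
    have hb : ∀ y ∈ Metric.ball x δ, (y : Vec d) + u ∈ closure Ω := fun y hy => by
      simpa using hmem y y.2 hy 1 ⟨zero_le_one, le_rfl⟩
    have hxu : (x : Vec d) + u ∈ Ω := hball (Metric.mem_ball_self hδ)
    let Y : closure Ω → closure Ω := fun y =>
      ⟨if y ∈ Metric.ball x δ then y + u else y, by
        split_ifs with hy
        exacts [hb y hy, y.2]⟩
    have mY : Measurable Y :=
      Measurable.subtype_mk (Measurable.ite Metric.isOpen_ball.measurableSet (by fun_prop)
        (by fun_prop))
    have mb : Measurable
        ((Metric.ball x δ).piecewise (fun _ => (⟨x + u, subset_closure hxu⟩ : closure Ω)) id) :=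
      measurable_const.piecewise Metric.isOpen_ball.measurableSet measurable_id
    -- translate the ball by `u`, contract it to its centre `x + u`, then move that point to `x₀`
    refine .head (b := Y) ⟨measurable_id, mY, fun y => ?_⟩ (.head (b := (Metric.ball x δ).piecewise
      (fun _ => (⟨x + u, subset_closure hxu⟩ : closure Ω)) id) ⟨mY, mb, fun y => ?_⟩
      (moves_piecewise Metric.isOpen_ball.measurableSet measurable_id (moves_const hΩ hxu hx₀)))
    · by_cases hy : y ∈ Metric.ball x δ
      · simp only [Y, if_pos hy, id]
        rw [segment_eq_image']
        rintro _ ⟨t, ht, rfl⟩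
        simpa using hmem y y.2 hy t ht
      · simp only [Y, if_neg hy, id, segment_same, singleton_subset_iff, y.2]
    · by_cases hy : y ∈ Metric.ball x δ
      · simp only [Y, if_pos hy, piecewise_eq_of_mem _ _ _ hy]
        refine (((convex_ball ((x : Vec d) + u) δ).segment_subset ?_
          (Metric.mem_ball_self hδ)).trans hball).trans subset_closure
        rw [Metric.mem_ball, dist_add_right]
        exact hy
      · simp only [Y, if_neg hy, piecewise_eq_of_notMem _ _ _ hy, id, segment_same,
          singleton_subset_iff, y.2]

theorem WSq_map_lt_top_of_moves (hΩ : Bornology.IsBounded Ω) (κ : ℝ)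
    (l : ProbabilityMeasure (closure Ω)) {Y Y' : closure Ω → closure Ω} (hY : Measurable Y)
    (h : Relation.ReflTransGen Move Y Y') : ∀ hY' : Measurable Y',
    WSq κ (POplus.ofInterior (l.map hY.aemeasurable)) (POplus.ofInterior (l.map hY'.aemeasurable))
      < ⊤ := by
  induction h with
  | refl => intro _; rw [WSq_self hΩ]; exact ENNReal.zero_lt_top
  | tail _ hm ih =>
    intro hY'
    exact Flow.WSq_trans_lt_top hΩ (ih hm.1) (WSq_map_lt_top hΩ κ l hm.1 hm.2.1 hm.2.2)

/-- Handing over all the boundary mass to the interior component has finite action. -/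
theorem exists_WSq_ofInterior_lt_top (hΩ : IsSmoothBoundedDomain Ω) (κ : ℝ) (ρ : POplus Ω) :
    ∃ α : ProbabilityMeasure (closure Ω), WSq κ ρ (POplus.ofInterior α) < ⊤ := by
  refine ⟨⟨_, ρ.isProb⟩, ?_⟩
  refine (Flow.WSq_le_act hΩ.isBounded (exchange_joins hΩ.isBounded (ε := 1) zero_le_one le_rfl
    ?_ ?_)).trans_lt ((act_exchange_le hΩ.isBounded ρ κ 1).trans_lt
      (ENNReal.mul_lt_top ENNReal.ofReal_lt_top (measure_lt_top _ _)))
  · simp [POplus.ofInterior]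
    rfl
  · simp [POplus.ofInterior]

/-- Any two states are at finite distance: bring all the mass to the interior component, then to
one point. -/
theorem WSq_lt_top (hΩ : IsSmoothBoundedDomain Ω) (κ : ℝ) (ρ ρ' : POplus Ω) :
    WSq κ ρ ρ' < ⊤ := by
  obtain ⟨x₀, hx₀⟩ := hΩ.isConnected.nonempty
  have hb := hΩ.isBounded
  have key : ∀ ρ : POplus Ω, WSq κ ρ (POplus.ofInterior
      ⟨Measure.dirac ⟨x₀, subset_closure hx₀⟩, inferInstance⟩) < ⊤ := by
    intro ρ
    obtain ⟨α, hα⟩ := exists_WSq_ofInterior_lt_top hΩ κ ρ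
    refine Flow.WSq_trans_lt_top hb hα ?_
    have h := WSq_map_lt_top_of_moves hb κ α measurable_id
      (moves_id_const hΩ (x₀ := ⟨x₀, subset_closure hx₀⟩) hx₀) measurable_const
    convert h using 3
    · exact Subtype.ext Measure.map_id.symm
    · refine congrArg POplus.ofInterior (Subtype.ext ?_)
      change _ = Measure.map (fun _ => _) (α : Measure (closure Ω))
      simp [Measure.map_const]
  exact Flow.WSq_trans_lt_top hb (key ρ) (by rw [Flow.WSq_symm hb]; exact key ρ')

end Geometry

/-! ### Geodesics have constant speed -/

/-- The equality case of the Cauchy–Schwarz inequality: if `w i ^ 2 ≤ l i * a i`, where the `l i`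
add up to one, the `a i` to at most `x ^ 2` and the `w i` to at least `x`, then the `w i` are
proportional to the `l i`. -/
theorem eq_mul_of_sq_le_mul {l w a : Fin 3 → ℝ} {x : ℝ} (hl : ∀ i, 0 ≤ l i)
    (ha : ∀ i, 0 ≤ a i) (hw : ∀ i, w i ^ 2 ≤ l i * a i) (hx : 0 ≤ x) (hl1 : ∑ i, l i = 1)
    (hax : ∑ i, a i ≤ x ^ 2) (hxw : x ≤ ∑ i, w i) (i : Fin 3) : w i = l i * x := by
  -- the terms `(√a - x √l)² + 2 x (√l √a - w)` are nonnegative and add up to at most zero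
  have h1 : ∀ i, w i ≤ √(l i) * √(a i) := fun i => by
    rw [← Real.sqrt_mul (hl i)]
    exact Real.le_sqrt_of_sq_le (hw i)
  have h2 : ∀ i, 0 ≤ (√(a i) - x * √(l i)) ^ 2 + 2 * x * (√(l i) * √(a i) - w i) := fun i => by
    have := h1 i
    have : 0 ≤ √(l i) * √(a i) - w i := by linarith
    positivity
  have h3 : ∀ i, (√(a i) - x * √(l i)) ^ 2 + 2 * x * (√(l i) * √(a i) - w i)
      = a i + x ^ 2 * l i - 2 * x * w i := fun i => by
    have e1 := Real.sq_sqrt (hl i)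
    have e2 := Real.sq_sqrt (ha i)
    linear_combination e2 + x ^ 2 * e1
  have h4 : ∑ i, ((√(a i) - x * √(l i)) ^ 2 + 2 * x * (√(l i) * √(a i) - w i)) ≤ 0 := by
    simp only [h3, Finset.sum_sub_distrib, Finset.sum_add_distrib, ← Finset.mul_sum, hl1]
    nlinarith
  have h5 : ∀ i, √(a i) = x * √(l i) := fun i => by
    have h := (Finset.sum_eq_zero_iff_of_nonneg fun i _ => h2 i).1
      (le_antisymm h4 (Finset.sum_nonneg fun i _ => h2 i)) i (Finset.mem_univ i)
    have := h1 i
    have : 0 ≤ 2 * x * (√(l i) * √(a i) - w i) := by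
      have : 0 ≤ √(l i) * √(a i) - w i := by linarith
      positivity
    have h0 : (√(a i) - x * √(l i)) ^ 2 = 0 := by
      linarith [sq_nonneg (√(a i) - x * √(l i))]
    linarith [pow_eq_zero_iff two_ne_zero |>.1 h0]
  have h6 : ∀ i, w i ≤ l i * x := fun i => by
    have := h1 i
    rw [h5 i] at this
    nlinarith [Real.mul_self_sqrt (hl i)]
  have h7 : ∑ i, (l i * x - w i) = 0 := by
    refine le_antisymm ?_ (Finset.sum_nonneg fun i _ => by linarith [h6 i])
    rw [Finset.sum_sub_distrib, ← Finset.sum_mul, hl1]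
    linarith
  have h8 := (Finset.sum_eq_zero_iff_of_nonneg fun i _ => by linarith [h6 i]).1 h7 i
    (Finset.mem_univ i)
  linarith

section Geodesic

variable {Ω : Set (Vec d)} {κ : ℝ}

theorem W_eq_ofReal_sqrt {ρ ρ' : POplus Ω} (h : WSq κ ρ ρ' < ⊤) :
    W κ ρ ρ' = ENNReal.ofReal √(WSq κ ρ ρ').toReal := by
  rw [Real.sqrt_eq_rpow, ← ENNReal.ofReal_rpow_of_nonneg ENNReal.toReal_nonneg (by norm_num),
    ENNReal.ofReal_toReal h.ne, W]

/-- On each of the three time intervals cut out by `s ≤ t`, the interpolant of a minimizing flow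
travels a distance proportional to the length of the interval. -/
theorem Flow.Joins.sqrt_WSq_interpolant (hΩ : IsSmoothBoundedDomain Ω) {ρ₀ ρ₁ : POplus Ω}
    {Φ : Flow Ω} {μ : MeasureTuple Ω} {ρ : I → POplus Ω} (H : Φ.Joins 0 1 ρ₀ ρ₁)
    (hω : μ.ω = Φ.m.toSignedMeasure) (hγ : μ.γ = Φ.n.toSignedMeasure) (hρ : IsInterpolant μ ρ)
    (hmin : Φ.act κ = WSq κ ρ₀ ρ₁) {s t : I} (hst : s ≤ t) :
    √(WSq κ (ρ s) (ρ t)).toReal = ((t : ℝ) - s) * √(WSq κ ρ₀ ρ₁).toReal := by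
  have hb := hΩ.isBounded
  have fin := WSq_lt_top hΩ κ
  have hact : Φ.act κ < ⊤ := hmin ▸ fin ρ₀ ρ₁
  have hr : ∀ A : Set I, (Φ.restrict A).act κ < ⊤ := fun A =>
    (Φ.act_restrict_le A).trans_lt hact
  have step : ∀ {s t : I}, s ≤ t → √(WSq κ (ρ s) (ρ t)).toReal ^ 2
      ≤ ((t : ℝ) - s) * ((Φ.restrict (Ioc s t)).act κ).toReal := by
    intro s t hst
    rw [Real.sq_sqrt ENNReal.toReal_nonneg]
    rcases hst.eq_or_lt with rfl | hlt
    · simp [WSq_self hb]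
    · have h := H.WSq_interpolant_le (κ := κ) hb hω hγ hρ hlt
      have h0 : (0 : ℝ) ≤ t - s := sub_nonneg.2 hst
      have := ENNReal.toReal_mono (ENNReal.mul_lt_top ENNReal.ofReal_lt_top (hr _)).ne h
      rwa [ENNReal.toReal_mul, ENNReal.toReal_ofReal h0] at this
  have hsum : ((Φ.restrict (Ioc 0 s)).act κ).toReal + ((Φ.restrict (Ioc s t)).act κ).toReal
      + ((Φ.restrict (Ioc t 1)).act κ).toReal ≤ √(WSq κ ρ₀ ρ₁).toReal ^ 2 := by
    have d1 : Disjoint (Ioc 0 s ∪ Ioc s t) (Ioc t 1) := by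
      rw [Ioc_union_Ioc_eq_Ioc (by exact s.2.1) hst]
      exact Ioc_disjoint_Ioc_of_le le_rfl
    have h := (add_le_add_left (Φ.act_restrict_add_le (κ := κ) (A := Ioc 0 s) (B := Ioc s t)
      measurableSet_Ioc (Ioc_disjoint_Ioc_of_le le_rfl)) _).trans
      ((Φ.act_restrict_add_le (κ := κ) measurableSet_Ioc d1).trans (Φ.act_restrict_le _))
    rw [Real.sq_sqrt ENNReal.toReal_nonneg, ← hmin,
      ← ENNReal.toReal_add (hr _).ne (hr _).ne,
      ← ENNReal.toReal_add (ENNReal.add_lt_top.2 ⟨hr _, hr _⟩).ne (hr _).ne]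
    exact ENNReal.toReal_mono hact.ne h
  have htri : √(WSq κ ρ₀ ρ₁).toReal ≤ √(WSq κ (ρ 0) (ρ s)).toReal
      + √(WSq κ (ρ s) (ρ t)).toReal + √(WSq κ (ρ t) (ρ 1)).toReal := by
    have h1 := Flow.sqrt_WSq_triangle hb (fin (ρ 0) (ρ s)) (fin (ρ s) (ρ t))
    have h2 := Flow.sqrt_WSq_triangle hb (fin (ρ 0) (ρ t)) (fin (ρ t) (ρ 1))
    rw [H.interpolant_zero hb hω hγ hρ, H.interpolant_one hb hω hγ hρ] at *
    linarith
  have hs0 : (0 : I) ≤ s := s.2.1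
  have ht1 : t ≤ 1 := t.2.2
  refine eq_mul_of_sq_le_mul (l := ![(s : ℝ) - (0 : I), t - s, (1 : I) - t])
    (w := ![√(WSq κ (ρ 0) (ρ s)).toReal, √(WSq κ (ρ s) (ρ t)).toReal,
      √(WSq κ (ρ t) (ρ 1)).toReal])
    (a := ![((Φ.restrict (Ioc 0 s)).act κ).toReal, ((Φ.restrict (Ioc s t)).act κ).toReal,
      ((Φ.restrict (Ioc t 1)).act κ).toReal]) ?_ ?_ ?_ (Real.sqrt_nonneg _) ?_ ?_ ?_ 1
  · exact Fin.forall_fin_succ.2 ⟨sub_nonneg.2 hs0, Fin.forall_fin_two.2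
      ⟨sub_nonneg.2 hst, sub_nonneg.2 ht1⟩⟩
  · exact Fin.forall_fin_succ.2 ⟨ENNReal.toReal_nonneg, Fin.forall_fin_two.2
      ⟨ENNReal.toReal_nonneg, ENNReal.toReal_nonneg⟩⟩
  · exact Fin.forall_fin_succ.2 ⟨step hs0, Fin.forall_fin_two.2 ⟨step hst, step ht1⟩⟩
  · simp [Fin.sum_univ_three]
  · simpa [Fin.sum_univ_three] using hsum
  · simpa [Fin.sum_univ_three] using htri

end Geodesic

end RingRoad

end

theorem proposition3p6 {d : ℕ} {Ω : Set (EuclideanSpace ℝ (Fin d))}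
    (hΩ : RingRoad.IsSmoothBoundedDomain Ω) {κ : ℝ} (hκ : 0 < κ)
    (ρ₀ ρ₁ : RingRoad.POplus Ω) (μ : RingRoad.MeasureTuple Ω)
    (hμ : RingRoad.IsGeodesic κ ρ₀ ρ₁ μ) :
    (∃ ρ : I → RingRoad.POplus Ω, RingRoad.IsInterpolant μ ρ) ∧
    ∀ ρ : I → RingRoad.POplus Ω, RingRoad.IsInterpolant μ ρ →
      ∀ s t : I, RingRoad.W κ (ρ s) (ρ t) =
        ENNReal.ofReal |(t : ℝ) - (s : ℝ)| * RingRoad.W κ ρ₀ ρ₁ := by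
  have hb := hΩ.isBounded
  have fin := RingRoad.WSq_lt_top hΩ κ
  obtain ⟨Φ, H, hact, hω, hγ⟩ := RingRoad.Flow.exists_of_action_lt_top hb hμ.isCE
    (hμ.action_eq ▸ fin ρ₀ ρ₁)
  refine ⟨H.exists_interpolant hb hω hγ, fun ρ hρ s t => ?_⟩
  wlog hst : s ≤ t generalizing s t
  · rw [abs_sub_comm, ← this t s (le_of_not_ge hst), RingRoad.W, RingRoad.W,
      RingRoad.Flow.WSq_symm hb]
  · have h0 : (0 : ℝ) ≤ t - s := sub_nonneg.2 (Subtype.coe_le_coe.2 hst)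
    rw [RingRoad.W_eq_ofReal_sqrt (fin _ _), RingRoad.W_eq_ofReal_sqrt (fin _ _),
      H.sqrt_WSq_interpolant hΩ hω hγ hρ (hact.trans hμ.action_eq) hst,
      abs_of_nonneg h0, ENNReal.ofReal_mul h0]
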